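/- **Setting.** Let $A\in\mathcal A$ (treatment), $Z\in\mathcal Z$ (mediator) and $C\in\mathcal C$ (covariates) be discrete (countably valued), $Y$ a real outcome, and $Z(a)$, $Y(a)$, $Y(a,z)$ ($a\in\mathcal A$, $z\in\mathcal Z$) potential variables on the same probability space. Assume consistency (almost surely $A=a$ implies $Y=Y(a)$ and $Z=Z(a)$; $A=a,Z=z$ implies $Y=Y(a,z)$; $Y(a)=Y(a,Z(a))$), positivity $P(A=a,Z=z,C=c)>0$ for all $a,z,c$, integrability of $Y,Y(a^*),Y(a)$ for two fixed treatment values $a^*,a$, and, for all $a',a'',z$: * front-door: $Y(a',z)=Y(a'',z)$ a.s., $Z(a')\perp A$, $Y(a',z)\perp Z(a'')\mid A$; * two-door: $Y(a',z)=Y(a'',z)$ a.s., $Z(a')\perp A\mid C$, $Y(a',z)\perp Z(a'')\mid A,C$; * $Z(a')\perp C\mid A$. Let $\theta=EY(a^*)-EY(a)$, $X=(C,A,Z,Y)$ with law $P$, and write $\eta=(E(Y|A,Z,C),\,p(Z|A),\,p(A|C),\,p(A),\,p(C))$ for the nuisance functions, $\eta_0$ for their true values. Let $\varphi_{fd,td}(X,\eta,\theta)=m(X,\eta)-\theta$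 with $$m(X,\eta)=(Y-E(Y|A,Z,C))\frac{p(Z|a^*)-p(Z|a)}{p(Z|A)}+\sum_c\Big(\sum_{\bar a}E(Y|\bar a,Z,c)p(\bar a|c)-\sum_{\bar a,z}E(Y|\bar a,z,c)p(z|A)p(\bar a|c)\Big)\frac{(I(A=a^*)-I(A=a))p(c)}{p(A)}+\sum_zE(Y|A,z,C)\big(p(z|a^*)-p(z|a)\big).$$ Let $X_1,\dots,X_n$ be i.i.d. copies of $X$, and suppose there may be $r_n\ge 0$ further i.i.d. copies, independent of them. Let $\hat\eta$ be a (measurable) nuisance estimator computed from all these observations, and $\hat\theta$ a solution of $\frac1n\sum_{i=1}^n\varphi_{fd,td}(X_i,\hat\eta,\hat\theta)=0$. $\|f\|$ denotes the $L^2(P)$ norm in a new observation $X$, with $\hat\eta$ held fixed. **1. Consistency.** Suppose $\hat\eta=\eta(\hat\beta)$ for a finite-dimensional vector $\hat\beta\in\mathbb R^k$ (for finite supports, $\beta$ may be the vector of all values of the nuisance functions), and $\hat\beta\to\bar\beta$ in probability; let $\bar\eta=(\bar E,\bar p(Z|A),\bar p(A|C),\bar p(A),\bar p(C))=\eta(\bar\beta)$.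 Suppose that the series in $m(\cdot,\bar\eta)$ converge absolutely, namely $\sum_{\bar a,z,c}|\bar E(\bar a,z,c)\bar p(z|b)\bar p(\bar a|c)\bar p(c)|<\infty$ for $b\in\{a^*,a\}$, $\sum_{\bar a,c}|\bar E(\bar a,z,c)\bar p(\bar a|c)\bar p(c)|<\infty$ for each $z$, and $\sum_z|\bar E(\bar a,z,c)\bar p(z|b)|<\infty$ for each $\bar a,c$ and $b\in\{a^*,a\}$; that $E|m(X,\bar\eta)|<\infty$; that $P$-almost surely $\beta\mapsto m(X,\eta(\beta))$ is differentiable in a neighbourhood of $\bar\beta$ (not depending on $X$), with integrable gradient at $\bar\beta$; and that on a neighbourhood of $\bar\beta$ all partial derivatives are bounded in absolute value by $M(X)$ with $EM(X)<\infty$. Then $\hat\theta\to\theta$ in probability if at least one of the following holds: * $\bar E(Y|A,Z,C)=E(Y|A,Z,C)$, $\bar p(A|C)=p(A|C)$ and $\bar p(C)=p(C)$ (where $\bar p(b)=\sum_c\bar p(b|c)\bar p(c)$ for $b\in\{a^*,a\}$, as is the case if $\hat p(A)$ is computed from $\hat p(A|C)$ and $\hat p(C)$); * $\bar p(Z|A)=p(Z|A)$.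 **2. Asymptotic linearity and regularity.** Suppose $EY^2<\infty$, $r_n=O(n)$, and * $\|m(X,\hat\eta)-m(X,\eta_0)\|^2=o_p(1)$, and either $\hat\eta$ depends only on the $r_n$ further observations (sample splitting) or $m(\cdot,\hat\eta)$ lies in a $P$-Donsker class with probability tending to one; * there are constants $\epsilon_j$, positive for $j=2,3,5,6,8$, such that $P$-almost surely $p(Z|A)>\epsilon_2$, $p(A|C)>\epsilon_5$, $p(C)>\epsilon_8$, and, with probability tending to one (over the sample), $|\hat E(Y|A,Z,C)|<\epsilon_1$, $\hat p(Z|A)>\epsilon_3$, $|\hat p(Z|b)|<\epsilon_4$, $\hat p(b)>\epsilon_6$, $|\hat p(A|C)|<\epsilon_7$, $|\hat p(C)|<\epsilon_9$ hold $P$-almost surely in $X$, for $b\in\{a^*,a\}$; * the following products are $o_p(n^{-1/2})$, for $b\in\{a^*,a\}$: $\|\hat E(Y|A,Z,C)-E(Y|A,Z,C)\|\cdot\|\hat p(Z|A)-p(Z|A)\|$, $\ \|\hat p(Z|b)-p(Z|b)\|\cdot\|\hat p(b)-p(b)\|$, $\ \|\hat p(Z|b)-p(Z|b)\|\cdot\|\hat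 p(C)-p(C)\|$, $\ \|\hat p(Z|b)-p(Z|b)\|\cdot\|\hat p(A|C)-p(A|C)\|$, $\ \|\hat E(Y|A,Z,C)-E(Y|A,Z,C)\|\cdot\|\hat p(Z|b)-p(Z|b)\|$. Then $\hat\theta$ is a regular asymptotically linear estimator of $\theta$ with influence function $\varphi_{fd,td}(\cdot,\eta_0,\theta)$. That is, $E\varphi_{fd,td}=0$, $E\varphi_{fd,td}^2<\infty$ and $\sqrt n(\hat\theta-\theta)=n^{-1/2}\sum_{i=1}^n\varphi_{fd,td}(X_i,\eta_0,\theta)+o_p(1)$; and there is one probability law $L$ such that for every finite-dimensional parametric submodel $t\mapsto P_t$ of the model with $P_0=P$ (for $t$ near $0$, $P_t$ is the law of $X$ in a causal model satisfying all assumptions of the setting, with average causal effect $\theta(t)$) that is dominated by a $\sigma$-finite measure, differentiable in quadratic mean at $0$ with square-integrable score and has $E_{P_t}Y^2$ bounded for $t$ near $0$, and for every sequence $t_n=O(n^{-1/2})$, the distribution of $\sqrt n(\hat\theta-\theta(t_n))$ under i.i.d. sampling from $P_{t_n}$ converges weakly to $L$. -/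

import Mathlib

open MeasureTheory ProbabilityTheory Filter Topology
open scoped ENNReal BoundedContinuousFunction

universe u

namespace FDTD

noncomputable section

/-! ### Observed data, potential outcomes and the causal model -/

/-- An observation `X = (C, A, Z, Y)`: covariates, treatment, mediator, real outcome. -/
abbrev Obs (𝒜 𝒵 𝒞 : Type u) : Type u := 𝒞 × 𝒜 × 𝒵 × ℝ

section Accessors
variable {𝒜 𝒵 𝒞 : Type u}

/-- covariates `C` -/
def Obs.cov (x : Obs 𝒜 𝒵 𝒞) : 𝒞 := x.1
/-- treatment `A` -/
def Obs.trt (x : Obs 𝒜 𝒵 𝒞) : 𝒜 := x.2.1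
/-- mediator `Z` -/
def Obs.med (x : Obs 𝒜 𝒵 𝒞) : 𝒵 := x.2.2.1
/-- outcome `Y` -/
def Obs.out (x : Obs 𝒜 𝒵 𝒞) : ℝ := x.2.2.2

end Accessors

/-- Observed variables `C, A, Z, Y` and potential variables `Z(a)`, `Y(a)`, `Y(a,z)`
as random variables on a common space. -/
structure CausalVars (Ω 𝒜 𝒵 𝒞 : Type u) [MeasurableSpace Ω] [MeasurableSpace 𝒜]
    [MeasurableSpace 𝒵] [MeasurableSpace 𝒞] where
  C : Ω → 𝒞
  A : Ω → 𝒜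
  Z : Ω → 𝒵
  Y : Ω → ℝ
  Zpot : 𝒜 → Ω → 𝒵
  Ypot : 𝒜 → Ω → ℝ
  Yjoint : 𝒜 → 𝒵 → Ω → ℝ
  measurable_C : Measurable C
  measurable_A : Measurable A
  measurable_Z : Measurable Z
  measurable_Y : Measurable Y
  measurable_Zpot : ∀ a, Measurable (Zpot a)
  measurable_Ypot : ∀ a, Measurable (Ypot a)
  measurable_Yjoint : ∀ a z, Measurable (Yjoint a z)

/-- `f` and `g` are conditionally independent given the discrete random variable `W`:
they are independent under `μ( · | W = w)` for each `w` (for `μ(W = w) = 0` this is the zero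
measure, and nothing is required). -/
def CondIndepGiven {Ω α β γ : Type*} [MeasurableSpace Ω] [MeasurableSpace α] [MeasurableSpace β]
    (f : Ω → α) (g : Ω → β) (W : Ω → γ) (μ : Measure Ω) : Prop :=
  ∀ w : γ, IndepFun f g (ProbabilityTheory.cond μ (W ⁻¹' {w}))

section Model
variable {Ω 𝒜 𝒵 𝒞 : Type u} [MeasurableSpace Ω] [MeasurableSpace 𝒜] [MeasurableSpace 𝒵]
  [MeasurableSpace 𝒞]

/-- The observed data vector. -/
def CausalVars.obs (V : CausalVars Ω 𝒜 𝒵 𝒞) (ω : Ω) : Obs 𝒜 𝒵 𝒞 := (V.C ω, V.A ω, V.Z ω, V.Y ω)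

/-- Observed variables agree with the potential ones, and `Y(a) = Y(a, Z(a))`. -/
structure Consistency (V : CausalVars Ω 𝒜 𝒵 𝒞) (μ : Measure Ω) : Prop where
  outcome : ∀ a, ∀ᵐ ω ∂μ, V.A ω = a → V.Y ω = V.Ypot a ω
  mediator : ∀ a, ∀ᵐ ω ∂μ, V.A ω = a → V.Z ω = V.Zpot a ω
  joint : ∀ a z, ∀ᵐ ω ∂μ, V.A ω = a → V.Z ω = z → V.Y ω = V.Yjoint a z ω
  composition : ∀ a, ∀ᵐ ω ∂μ, V.Ypot a ω = V.Yjoint a (V.Zpot a ω) ω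

/-- The front-door assumption. -/
structure FrontDoor (V : CausalVars Ω 𝒜 𝒵 𝒞) (μ : Measure Ω) : Prop where
  fd1 : ∀ a a' z, V.Yjoint a z =ᵐ[μ] V.Yjoint a' z
  fd2 : ∀ a', IndepFun (V.Zpot a') V.A μ
  fd3 : ∀ a a' z, CondIndepGiven (V.Yjoint a z) (V.Zpot a') V.A μ

/-- The two-door assumption. -/
structure TwoDoor (V : CausalVars Ω 𝒜 𝒵 𝒞) (μ : Measure Ω) : Prop where
  td1 : ∀ a a' z, V.Yjoint a z =ᵐ[μ] V.Yjoint a' z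
  td2 : ∀ a', CondIndepGiven (V.Zpot a') V.A V.C μ
  td3 : ∀ a a' z, CondIndepGiven (V.Yjoint a z) (V.Zpot a') (fun ω => (V.A ω, V.C ω)) μ

/-- The causal model: consistency, positivity, the front-door and two-door assumptions,
`Z(a) ⊥ C | A`, and existence of the expectations defining the average causal effect of `a₁`
versus `a₀` and the outcome regression. -/
structure IsFDTDModel (V : CausalVars Ω 𝒜 𝒵 𝒞) (μ : Measure Ω) (a₁ a₀ : 𝒜) : Prop where
  consistency : Consistency V μ
  positivity : ∀ a z c, μ {ω | V.A ω = a ∧ V.Z ω = z ∧ V.C ω = c} ≠ 0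
  frontDoor : FrontDoor V μ
  twoDoor : TwoDoor V μ
  mediator_indep_cov : ∀ a, CondIndepGiven (V.Zpot a) V.C V.A μ
  integrable_Y : Integrable V.Y μ
  integrable_Ypot : ∀ a ∈ ({a₁, a₀} : Set 𝒜), Integrable (V.Ypot a) μ

/-- The average causal effect `E Y(a₁) - E Y(a₀)`. -/
def ACE (V : CausalVars Ω 𝒜 𝒵 𝒞) (μ : Measure Ω) (a₁ a₀ : 𝒜) : ℝ :=
  (∫ ω, V.Ypot a₁ ω ∂μ) - ∫ ω, V.Ypot a₀ ω ∂μ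

/-- `P` is the observed-data law of some causal model as above, with average causal effect `θ`. -/
def IsModelLaw (a₁ a₀ : 𝒜) (P : Measure (Obs 𝒜 𝒵 𝒞)) (θ : ℝ) : Prop :=
  ∃ (Ω' : Type u) (_ : MeasurableSpace Ω') (μ : Measure Ω') (V : CausalVars Ω' 𝒜 𝒵 𝒞),
    IsProbabilityMeasure μ ∧ IsFDTDModel V μ a₁ a₀ ∧ P = μ.map V.obs ∧ θ = ACE V μ a₁ a₀

end Model

/-! ### Nuisance functions and the influence function -/

/-- Values of the nuisance functions: `EY a z c` for `E(Y | a, z, c)`, `pZ z a` for `p(z | a)`,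
`pAC a c` for `p(a | c)`, `pA a` for `p(a)` and `pC c` for `p(c)`. No constraint is imposed, since
estimates need not be exact probabilities. -/
@[ext] structure Nuisance (𝒜 𝒵 𝒞 : Type u) where
  EY : 𝒜 → 𝒵 → 𝒞 → ℝ
  pZ : 𝒵 → 𝒜 → ℝ
  pAC : 𝒜 → 𝒞 → ℝ
  pA : 𝒜 → ℝ
  pC : 𝒞 → ℝ

section Nuis
variable {𝒜 𝒵 𝒞 : Type u}

/-- The true nuisance functions of the observed law `P`. -/
def trueNuisance [MeasurableSpace 𝒜] [MeasurableSpace 𝒵] [MeasurableSpace 𝒞]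
    (P : Measure (Obs 𝒜 𝒵 𝒞)) : Nuisance 𝒜 𝒵 𝒞 where
  EY a z c := (∫ x in {x | x.trt = a ∧ x.med = z ∧ x.cov = c}, x.out ∂P) /
    P.real {x | x.trt = a ∧ x.med = z ∧ x.cov = c}
  pZ z a := P.real {x | x.med = z ∧ x.trt = a} / P.real {x | x.trt = a}
  pAC a c := P.real {x | x.trt = a ∧ x.cov = c} / P.real {x | x.cov = c}
  pA a := P.real {x | x.trt = a}
  pC c := P.real {x | x.cov = c}

open Classical in
/-- `m(x, η)`, the uncentred influence function, for the contrast of `a₁` with `a₀`. -/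
def mFun (a₁ a₀ : 𝒜) (η : Nuisance 𝒜 𝒵 𝒞) (x : Obs 𝒜 𝒵 𝒞) : ℝ :=
  (x.out - η.EY x.trt x.med x.cov) *
      ((η.pZ x.med a₁ - η.pZ x.med a₀) / η.pZ x.med x.trt)
  + ∑' c, ((∑' a, η.EY a x.med c * η.pAC a c)
        - ∑' a, ∑' z, η.EY a z c * η.pZ z x.trt * η.pAC a c) *
      (((if x.trt = a₁ then 1 else 0) - (if x.trt = a₀ then 1 else 0)) * η.pC c / η.pA x.trt)
  + ∑' z, η.EY x.trt z x.cov * (η.pZ z a₁ - η.pZ z a₀)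

/-- `φ(x, η, θ) = m(x, η) - θ`. -/
def phi (a₁ a₀ : 𝒜) (η : Nuisance 𝒜 𝒵 𝒞) (θ : ℝ) (x : Obs 𝒜 𝒵 𝒞) : ℝ := mFun a₁ a₀ η x - θ

/-- The series occurring in `m( · , η)` converge absolutely (automatic for finite supports). -/
structure SeriesConverge (a₁ a₀ : 𝒜) (η : Nuisance 𝒜 𝒵 𝒞) : Prop where
  total : ∀ b ∈ ({a₁, a₀} : Set 𝒜), Summable fun q : 𝒜 × 𝒵 × 𝒞 =>
    η.EY q.1 q.2.1 q.2.2 * η.pZ q.2.1 b * η.pAC q.1 q.2.2 * η.pC q.2.2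
  over_ac : ∀ z, Summable fun q : 𝒜 × 𝒞 => η.EY q.1 z q.2 * η.pAC q.1 q.2 * η.pC q.2
  over_z : ∀ b ∈ ({a₁, a₀} : Set 𝒜), ∀ a c, Summable fun z => η.EY a z c * η.pZ z b

end Nuis

/-! ### Samples and stochastic convergence -/

/-- The data: `n` observations over which the estimating function is averaged, and `r` further
observations (possibly none) that may be used in the estimation of the nuisance functions. -/
abbrev Sample (𝒜 𝒵 𝒞 : Type u) (n r : ℕ) : Type u :=
  (Fin n → Obs 𝒜 𝒵 𝒞) × (Fin r → Obs 𝒜 𝒵 𝒞)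

/-- All observations are i.i.d. with law `P`. -/
def sampleLaw {𝒜 𝒵 𝒞 : Type u} [MeasurableSpace 𝒜] [MeasurableSpace 𝒵] [MeasurableSpace 𝒞]
    (P : Measure (Obs 𝒜 𝒵 𝒞)) (n r : ℕ) : Measure (Sample 𝒜 𝒵 𝒞 n r) :=
  (Measure.pi fun _ : Fin n => P).prod (Measure.pi fun _ : Fin r => P)

/-- `f n = o_p(1)`. -/
def IsLittleOP {S : ℕ → Type*} [∀ n, MeasurableSpace (S n)] (Q : ∀ n, Measure (S n))
    (f : ∀ n, S n → ℝ≥0∞) : Prop :=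
  ∀ ε : ℝ≥0∞, ε ≠ 0 → Tendsto (fun n => Q n {s | ε ≤ f n s}) atTop (𝓝 0)

/-- `f n = o_p(n^{-1/2})`. -/
def IsLittleOPRoot {S : ℕ → Type*} [∀ n, MeasurableSpace (S n)] (Q : ∀ n, Measure (S n))
    (f : ∀ n, S n → ℝ≥0∞) : Prop :=
  IsLittleOP Q fun n s => ENNReal.ofReal (√(n : ℝ)) * f n s

/-- The event `E n` holds with probability at least `1 - δ n` for some `δ n → 0`. -/
def WithHighProb {S : ℕ → Type*} [∀ n, MeasurableSpace (S n)] (Q : ∀ n, Measure (S n))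
    (E : ∀ n, S n → Prop) : Prop :=
  Tendsto (fun n => Q n {s | ¬ E n s}) atTop (𝓝 0)

section Estimation
variable {𝒜 𝒵 𝒞 : Type u}

/-- Cellwise measurability of a random nuisance function. -/
structure MeasurableNuisance {S : Type*} [MeasurableSpace S] (η : S → Nuisance 𝒜 𝒵 𝒞) : Prop where
  EY : ∀ a z c, Measurable fun s => (η s).EY a z c
  pZ : ∀ z a, Measurable fun s => (η s).pZ z a
  pAC : ∀ a c, Measurable fun s => (η s).pAC a c
  pA : ∀ a, Measurable fun s => (η s).pA a
  pC : ∀ c, Measurable fun s => (η s).pC c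

variable [MeasurableSpace 𝒜] [MeasurableSpace 𝒵] [MeasurableSpace 𝒞]

/-- Regularity for consistency. The nuisance functions depend on a vector `β ∈ ℝᵏ` through `N`
(for finite supports one can take for `β` the list of all the values of the nuisance functions);
`m(x, N β)` is differentiable in `β` around `b`, its gradient is integrable at `b`, and its partial
derivatives are dominated, near `b`, by an integrable function of `x`. -/
structure RegularityConsistency (a₁ a₀ : 𝒜) (P : Measure (Obs 𝒜 𝒵 𝒞)) {k : ℕ}
    (N : (Fin k → ℝ) → Nuisance 𝒜 𝒵 𝒞) (b : Fin k → ℝ) : Prop where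
  series : SeriesConverge a₁ a₀ (N b)
  integrable_m : Integrable (mFun a₁ a₀ (N b)) P
  differentiable : ∃ U ∈ 𝓝 b, ∀ᵐ x ∂P, ∀ β ∈ U,
    DifferentiableAt ℝ (fun β' => mFun a₁ a₀ (N β') x) β
  integrable_deriv : ∀ j : Fin k,
    Integrable (fun x => fderiv ℝ (fun β' => mFun a₁ a₀ (N β') x) b (Pi.single j 1)) P
  dominated : ∃ U ∈ 𝓝 b, ∃ M : Obs 𝒜 𝒵 𝒞 → ℝ, Integrable M P ∧
    ∀ᵐ x ∂P, ∀ β ∈ U, ∀ j : Fin k,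
      |fderiv ℝ (fun β' => mFun a₁ a₀ (N β') x) β (Pi.single j 1)| ≤ M x

/-! ### Donsker classes -/

/-- The space `ℓ^∞(ι)` of bounded real functions with the supremum norm. -/
abbrev EllInf (ι : Type*) : Type _ := lp (fun _ : ι => ℝ) ∞

instance ellInfMeasurableSpace (ι : Type*) : MeasurableSpace (EllInf ι) := borel _

/-- Outer expectation of a bounded function. -/
def outerExpectation {S : Type*} [MeasurableSpace S] (μ : Measure S) (g : S → ℝ) : ℝ :=
  sInf {I | ∃ U : S → ℝ, Measurable U ∧ Integrable U μ ∧ (∀ s, g s ≤ U s) ∧ I = ∫ s, U s ∂μ}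

open Classical in
/-- The empirical process `f ↦ √n (Pₙ f - P f)` as an element of `ℓ^∞(F)`. -/
def empiricalProcess {𝒳 : Type*} [MeasurableSpace 𝒳] (P : Measure 𝒳) (F : Set (𝒳 → ℝ)) (n : ℕ)
    (x : Fin n → 𝒳) : EllInf F :=
  if h : Memℓp (fun f : F => √(n : ℝ) * ((1 / n : ℝ) * ∑ i, f.1 (x i) - ∫ y, f.1 y ∂P)) ∞
  then ⟨_, h⟩ else 0

/-- `F` is `P`-Donsker: the empirical process converges in distribution (in the sense of outer
expectations) in `ℓ^∞(F)` to a tight Borel limit. -/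
structure IsDonsker {𝒳 : Type*} [MeasurableSpace 𝒳] (P : Measure 𝒳) (F : Set (𝒳 → ℝ)) : Prop where
  measurable : ∀ f ∈ F, Measurable f
  memLp : ∀ f ∈ F, MemLp f 2 P
  bounded : ∀ x, BddAbove (Set.range fun f : F => |f.1 x - ∫ y, f.1 y ∂P|)
  converges : ∃ L : Measure (EllInf F), IsProbabilityMeasure L ∧
    (∀ ε : ℝ≥0∞, ε ≠ 0 → ∃ K : Set (EllInf F), IsCompact K ∧ L Kᶜ ≤ ε) ∧
    ∀ h : EllInf F →ᵇ ℝ,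
      Tendsto (fun n => outerExpectation (Measure.pi fun _ : Fin n => P)
        (fun x => h (empiricalProcess P F n x))) atTop (𝓝 (∫ g, h g ∂L))

/-! ### Assumptions for asymptotic linearity -/

/-- Regularity for asymptotic normality: (a) `‖m(X, η̂) - m(X, η₀)‖² = o_p(1)`, the norm being that
of `L²(P)` with `η̂` held fixed; (b) `η̂` is computed from observations other than those averaged
over (sample splitting), or `m( · , η̂)` lies in a `P`-Donsker class with probability tending
to one. -/
structure RegularityNormality (a₁ a₀ : 𝒜) (P : Measure (Obs 𝒜 𝒵 𝒞)) (r : ℕ → ℕ)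
    (ηhat : ∀ n, Sample 𝒜 𝒵 𝒞 n (r n) → Nuisance 𝒜 𝒵 𝒞) : Prop where
  l2_consistent : IsLittleOP (fun n => sampleLaw P n (r n)) fun n s =>
    eLpNorm (fun x => mFun a₁ a₀ (ηhat n s) x - mFun a₁ a₀ (trueNuisance P) x) 2 P ^ 2
  split_or_donsker :
    (∀ n (x x' : Fin n → Obs 𝒜 𝒵 𝒞) (w : Fin (r n) → Obs 𝒜 𝒵 𝒞),
      ηhat n (x, w) = ηhat n (x', w)) ∨
    ∃ F : Set (Obs 𝒜 𝒵 𝒞 → ℝ), IsDonsker P F ∧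
      WithHighProb (fun n => sampleLaw P n (r n)) fun n s => mFun a₁ a₀ (ηhat n s) ∈ F

/-- Boundedness assumptions on the nuisance functions and on their estimators. -/
structure Boundedness (a₁ a₀ : 𝒜) (P : Measure (Obs 𝒜 𝒵 𝒞)) (r : ℕ → ℕ)
    (ηhat : ∀ n, Sample 𝒜 𝒵 𝒞 n (r n) → Nuisance 𝒜 𝒵 𝒞) : Prop where
  EY_hat : ∃ ε : ℝ, WithHighProb (fun n => sampleLaw P n (r n)) fun n s =>
    ∀ᵐ x ∂P, |(ηhat n s).EY x.trt x.med x.cov| < ε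
  pZ_true : ∃ ε > 0, ∀ᵐ x ∂P, ε < (trueNuisance P).pZ x.med x.trt
  pZ_hat_lower : ∃ ε > 0, WithHighProb (fun n => sampleLaw P n (r n)) fun n s =>
    ∀ᵐ x ∂P, ε < (ηhat n s).pZ x.med x.trt
  pZ_hat_upper : ∃ ε : ℝ, ∀ b ∈ ({a₁, a₀} : Set 𝒜),
    WithHighProb (fun n => sampleLaw P n (r n)) fun n s =>
      ∀ᵐ x ∂P, |(ηhat n s).pZ x.med b| < ε
  pAC_true : ∃ ε > 0, ∀ᵐ x ∂P, ε < (trueNuisance P).pAC x.trt x.cov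
  pA_hat_lower : ∃ ε > 0, ∀ b ∈ ({a₁, a₀} : Set 𝒜),
    WithHighProb (fun n => sampleLaw P n (r n)) fun n s => ε < (ηhat n s).pA b
  pAC_hat : ∃ ε : ℝ, WithHighProb (fun n => sampleLaw P n (r n)) fun n s =>
    ∀ᵐ x ∂P, |(ηhat n s).pAC x.trt x.cov| < ε
  pC_true : ∃ ε > 0, ∀ᵐ x ∂P, ε < (trueNuisance P).pC x.cov
  pC_hat : ∃ ε : ℝ, WithHighProb (fun n => sampleLaw P n (r n)) fun n s =>
    ∀ᵐ x ∂P, |(ηhat n s).pC x.cov| < ε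

/-- `‖Ê(Y|A,Z,C) - E(Y|A,Z,C)‖` in `L²(P)` -/
def errEY (P : Measure (Obs 𝒜 𝒵 𝒞)) (η : Nuisance 𝒜 𝒵 𝒞) : ℝ≥0∞ :=
  eLpNorm (fun x : Obs 𝒜 𝒵 𝒞 =>
    η.EY x.trt x.med x.cov - (trueNuisance P).EY x.trt x.med x.cov) 2 P

/-- `‖p̂(Z|A) - p(Z|A)‖` -/
def errZA (P : Measure (Obs 𝒜 𝒵 𝒞)) (η : Nuisance 𝒜 𝒵 𝒞) : ℝ≥0∞ :=
  eLpNorm (fun x : Obs 𝒜 𝒵 𝒞 => η.pZ x.med x.trt - (trueNuisance P).pZ x.med x.trt) 2 P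

/-- `‖p̂(Z|b) - p(Z|b)‖` for a fixed treatment value `b` -/
def errZ (P : Measure (Obs 𝒜 𝒵 𝒞)) (b : 𝒜) (η : Nuisance 𝒜 𝒵 𝒞) : ℝ≥0∞ :=
  eLpNorm (fun x : Obs 𝒜 𝒵 𝒞 => η.pZ x.med b - (trueNuisance P).pZ x.med b) 2 P

/-- `‖p̂(b) - p(b)‖` for a fixed treatment value `b` -/
def errA (P : Measure (Obs 𝒜 𝒵 𝒞)) (b : 𝒜) (η : Nuisance 𝒜 𝒵 𝒞) : ℝ≥0∞ :=
  eLpNorm (fun _ : Obs 𝒜 𝒵 𝒞 => η.pA b - (trueNuisance P).pA b) 2 P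

/-- `‖p̂(A|C) - p(A|C)‖` -/
def errAC (P : Measure (Obs 𝒜 𝒵 𝒞)) (η : Nuisance 𝒜 𝒵 𝒞) : ℝ≥0∞ :=
  eLpNorm (fun x : Obs 𝒜 𝒵 𝒞 => η.pAC x.trt x.cov - (trueNuisance P).pAC x.trt x.cov) 2 P

/-- `‖p̂(C) - p(C)‖` -/
def errC (P : Measure (Obs 𝒜 𝒵 𝒞)) (η : Nuisance 𝒜 𝒵 𝒞) : ℝ≥0∞ :=
  eLpNorm (fun x : Obs 𝒜 𝒵 𝒞 => η.pC x.cov - (trueNuisance P).pC x.cov) 2 P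

/-- The product-rate conditions. -/
structure ProductRates (a₁ a₀ : 𝒜) (P : Measure (Obs 𝒜 𝒵 𝒞)) (r : ℕ → ℕ)
    (ηhat : ∀ n, Sample 𝒜 𝒵 𝒞 n (r n) → Nuisance 𝒜 𝒵 𝒞) : Prop where
  EY_ZA : IsLittleOPRoot (fun n => sampleLaw P n (r n)) fun n s =>
    errEY P (ηhat n s) * errZA P (ηhat n s)
  Z_A : ∀ b ∈ ({a₁, a₀} : Set 𝒜), IsLittleOPRoot (fun n => sampleLaw P n (r n)) fun n s =>
    errZ P b (ηhat n s) * errA P b (ηhat n s)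
  Z_C : ∀ b ∈ ({a₁, a₀} : Set 𝒜), IsLittleOPRoot (fun n => sampleLaw P n (r n)) fun n s =>
    errZ P b (ηhat n s) * errC P (ηhat n s)
  Z_AC : ∀ b ∈ ({a₁, a₀} : Set 𝒜), IsLittleOPRoot (fun n => sampleLaw P n (r n)) fun n s =>
    errZ P b (ηhat n s) * errAC P (ηhat n s)
  EY_Z : ∀ b ∈ ({a₁, a₀} : Set 𝒜), IsLittleOPRoot (fun n => sampleLaw P n (r n)) fun n s =>
    errEY P (ηhat n s) * errZ P b (ηhat n s)

/-! ### Regular asymptotically linear estimators -/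

/-- The estimator is asymptotically linear at `P` with influence function `φ`. -/
structure IsAsymptoticallyLinear (P : Measure (Obs 𝒜 𝒵 𝒞)) (r : ℕ → ℕ)
    (θhat : ∀ n, Sample 𝒜 𝒵 𝒞 n (r n) → ℝ) (θ : ℝ) (φ : Obs 𝒜 𝒵 𝒞 → ℝ) : Prop where
  memLp : MemLp φ 2 P
  mean_zero : ∫ x, φ x ∂P = 0
  linear : IsLittleOP (fun n => sampleLaw P n (r n)) fun n s =>
    ‖√(n : ℝ) * (θhat n s - θ) - (1 / √(n : ℝ)) * ∑ i, φ (s.1 i)‖ₑ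

/-- A regular `k`-dimensional parametric submodel through `P`: a family of laws of the causal model,
indexed by `t` near `0 ∈ ℝᵏ`, dominated, differentiable in quadratic mean at `0`, with locally
bounded second moment of the outcome; `ace t` is the average causal effect under parameter `t`. -/
structure RegularSubmodel (a₁ a₀ : 𝒜) (P : Measure (Obs 𝒜 𝒵 𝒞)) (k : ℕ) where
  law : EuclideanSpace ℝ (Fin k) → Measure (Obs 𝒜 𝒵 𝒞)
  ace : EuclideanSpace ℝ (Fin k) → ℝ
  law_zero : law 0 = P
  mem_model : ∀ᶠ t in 𝓝 0, IsModelLaw a₁ a₀ (law t) (ace t)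
  dom : Measure (Obs 𝒜 𝒵 𝒞)
  sigmaFinite_dom : SigmaFinite dom
  density : EuclideanSpace ℝ (Fin k) → Obs 𝒜 𝒵 𝒞 → ℝ
  measurable_density : ∀ t, Measurable (density t)
  density_nonneg : ∀ t x, 0 ≤ density t x
  law_eq : ∀ᶠ t in 𝓝 0, law t = dom.withDensity fun x => ENNReal.ofReal (density t x)
  score : Obs 𝒜 𝒵 𝒞 → EuclideanSpace ℝ (Fin k)
  measurable_score : Measurable score
  memLp_score : MemLp score 2 P
  quadratic_mean_differentiable :
    (fun t : EuclideanSpace ℝ (Fin k) => ∫ x, (√(density t x) - √(density 0 x)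
        - 1 / 2 * inner ℝ t (score x) * √(density 0 x)) ^ 2 ∂dom)
      =o[𝓝 0] fun t => ‖t‖ ^ 2
  bounded_moment : ∃ B : ℝ, ∀ᶠ t in 𝓝 0,
    ∫⁻ x : Obs 𝒜 𝒵 𝒞, ENNReal.ofReal (x.out ^ 2) ∂(law t) ≤ ENNReal.ofReal B

/-- The estimator of the average causal effect is regular at `P`: along each local data generating
process `t n = O(n^{-1/2})` in each regular parametric submodel, `√n (θ̂ - θ(t n))` has a limiting
distribution that depends neither on the submodel nor on the local process. -/
def IsRegularEstimator (a₁ a₀ : 𝒜) (P : Measure (Obs 𝒜 𝒵 𝒞)) (r : ℕ → ℕ)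
    (θhat : ∀ n, Sample 𝒜 𝒵 𝒞 n (r n) → ℝ) : Prop :=
  ∃ L : Measure ℝ, IsProbabilityMeasure L ∧
    ∀ (k : ℕ) (M : RegularSubmodel a₁ a₀ P k) (t : ℕ → EuclideanSpace ℝ (Fin k)),
      (∃ B : ℝ, ∀ n : ℕ, √(n : ℝ) * ‖t n‖ ≤ B) →
      ∀ f : ℝ →ᵇ ℝ,
        Tendsto (fun n : ℕ => ∫ s, f (√(n : ℝ) * (θhat n s - M.ace (t n)))
          ∂(sampleLaw (M.law (t n)) n (r n))) atTop (𝓝 (∫ y, f y ∂L))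

end Estimation

end

end FDTD

set_option linter.unusedSectionVars false
set_option linter.style.haveILetI false

namespace FDTD

/-! ### Measurability of cells -/

section Cells
variable {𝒜 𝒵 𝒞 : Type u} [MeasurableSpace 𝒜] [MeasurableSpace 𝒵] [MeasurableSpace 𝒞]

/-! Identification. Within levels of A the front-door independences factor E[Y(b,z); Z(b)=z] as E
Y(b,z) · p(z|b), while the two-door independence, consistency and Y(b,z) = Y(a,z) give E[Y(b,z);
A=a, C=c] = E(Y|a,z,c) p(a,c). Hence θ = Σ E(Y|a,z,c) p(a,c) (p(z|a₁) - p(z|a₀)), absolutely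
convergent, and Z(a) ⊥ C | A gives p(a,z,c) = p(z|a) p(a,c). `ModelFacts` records these
consequences, and all later arguments about a law of the model rest on it alone.

Double robustness. m(X,η) is affine in Y with coefficients depending on the cell (A,Z,C) only, so E
m(X,η) is a series over cells. With g(z) = Σ E(a,z,c) p(a|c) p(c) and h(b) = Σ_z g(z) p(z|b), the
middle summand of m is a contrast of g(Z) - h(A), weighted by 1/p(A). If the mediator law is
correct, g averages to h, so this summand has mean zero, and the weighted residual cancels the error
of the outcome regression in the last summand. If the outcome regression and the law of (A,C) are
correct, the residual has mean zero and the wrong h(a₁) - h(a₀) cancels between the other two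
summands. Consistency then follows from the weak law of large numbers and a mean value inequality in
β (`isLittleOP_of_regularityConsistency`).

Asymptotic linearity. Conditional probabilities bounded away from zero force finite supports
(`ModelFacts.finite_types`). The error of the linearization is √n(Pₙ - P)(m(·,η̂) - m(·,η₀)) + √n(P
m(·,η̂) - θ). The first term is a random combination of finitely many fixed square-integrable
functions, orthogonal in L²(P), whose coefficients tend to zero with the L² distance. For the
second, the exact bias identity `ModelFacts.integral_mFun_sub` exhibits P m(·,η̂) - θ as a sum of
products of nuisance errors, which the rate conditions control.

Regularity. Let P_n be the law at t_n, with score contribution ℓ_n. The sample laws under P_n are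
contiguous to those under P (`LocalSeq.tendsto_measure_zero`), so the linearization persists. Under
P_n the normalized sum of φ has a Gaussian limit after recentring by √n E φℓ_n
(`LocalSeq.tendsto_charFun_pow`). The effect moves by the same amount: the bias identity under P_n
with η₀ plugged in is quadratic in errors of order n^{-1/2}, whence √n(θ(t_n) - θ) = √n E φℓ_n +
o(1) (`LocalSeq.tendsto_effect`). The two shifts cancel, leaving N(0, E φ²) in every submodel. -/

theorem measurable_cov : Measurable (Obs.cov : Obs 𝒜 𝒵 𝒞 → 𝒞) := measurable_fst

theorem measurable_trt : Measurable (Obs.trt : Obs 𝒜 𝒵 𝒞 → 𝒜) := measurable_fst.comp measurable_snd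

theorem measurable_med : Measurable (Obs.med : Obs 𝒜 𝒵 𝒞 → 𝒵) :=
  measurable_fst.comp (measurable_snd.comp measurable_snd)

theorem measurable_out : Measurable (Obs.out : Obs 𝒜 𝒵 𝒞 → ℝ) :=
  measurable_snd.comp (measurable_snd.comp measurable_snd)

theorem measurable_obs {Ω : Type u} [MeasurableSpace Ω] (V : CausalVars Ω 𝒜 𝒵 𝒞) :
    Measurable V.obs :=
  V.measurable_C.prodMk (V.measurable_A.prodMk (V.measurable_Z.prodMk V.measurable_Y))

/-- The discrete part `(A, Z, C)` of an observation. -/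
def cellOf (x : Obs 𝒜 𝒵 𝒞) : 𝒜 × 𝒵 × 𝒞 := (x.trt, x.med, x.cov)

theorem measurable_cellOf : Measurable (cellOf : Obs 𝒜 𝒵 𝒞 → _) :=
  measurable_trt.prodMk (measurable_med.prodMk measurable_cov)

/-- The event `{A = a, Z = z, C = c}`. -/
def cell (q : 𝒜 × 𝒵 × 𝒞) : Set (Obs 𝒜 𝒵 𝒞) := {x | x.trt = q.1 ∧ x.med = q.2.1 ∧ x.cov = q.2.2}

theorem cell_eq_preimage (q : 𝒜 × 𝒵 × 𝒞) : (cell q : Set (Obs 𝒜 𝒵 𝒞)) = cellOf ⁻¹' {q} := by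
  ext x
  simp [cell, cellOf, Prod.ext_iff]

/-- The joint probability `p(a, c)`. -/
noncomputable def probAC (P : Measure (Obs 𝒜 𝒵 𝒞)) (a : 𝒜) (c : 𝒞) : ℝ :=
  P.real {x | x.trt = a ∧ x.cov = c}

variable [DiscreteMeasurableSpace 𝒜] [DiscreteMeasurableSpace 𝒵] [DiscreteMeasurableSpace 𝒞]

theorem measurableSet_trt (a : 𝒜) : MeasurableSet {x : Obs 𝒜 𝒵 𝒞 | x.trt = a} :=
  measurable_trt (MeasurableSet.of_discrete (s := {a}))

theorem measurableSet_med (z : 𝒵) : MeasurableSet {x : Obs 𝒜 𝒵 𝒞 | x.med = z} :=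
  measurable_med (MeasurableSet.of_discrete (s := {z}))

theorem measurableSet_cov (c : 𝒞) : MeasurableSet {x : Obs 𝒜 𝒵 𝒞 | x.cov = c} :=
  measurable_cov (MeasurableSet.of_discrete (s := {c}))

theorem measurableSet_cell (q : 𝒜 × 𝒵 × 𝒞) : MeasurableSet (cell q : Set (Obs 𝒜 𝒵 𝒞)) :=
  (measurableSet_trt _).inter ((measurableSet_med _).inter (measurableSet_cov _))

end Cells

/-- The observed-data consequences of the causal model: `P` is a probability measure giving mass to
every cell, `Z ⊥ C | A`, and the average causal effect is the absolutely convergent series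
`∑ E(Y | a, z, c) p(a, c) (p(z | a₁) - p(z | a₀))`. -/
structure ModelFacts {𝒜 𝒵 𝒞 : Type u} [MeasurableSpace 𝒜] [MeasurableSpace 𝒵] [MeasurableSpace 𝒞]
    (a₁ a₀ : 𝒜) (P : Measure (Obs 𝒜 𝒵 𝒞)) (θ : ℝ) : Prop where
  prob : IsProbabilityMeasure P
  pos : ∀ q, 0 < P.real (cell q)
  factor : ∀ a z c, P.real (cell (a, z, c)) = (trueNuisance P).pZ z a * probAC P a c
  integrable_out : Integrable Obs.out P
  summable : ∀ b ∈ ({a₁, a₀} : Set 𝒜), Summable fun q : 𝒜 × 𝒵 × 𝒞 =>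
    (trueNuisance P).EY q.1 q.2.1 q.2.2 * probAC P q.1 q.2.2 * (trueNuisance P).pZ q.2.1 b
  hasSum : HasSum (fun q : 𝒜 × 𝒵 × 𝒞 => (trueNuisance P).EY q.1 q.2.1 q.2.2 *
    probAC P q.1 q.2.2 * ((trueNuisance P).pZ q.2.1 a₁ - (trueNuisance P).pZ q.2.1 a₀)) θ

/-! ### Identification -/

/-! ### Integrals over the levels of a discrete variable, and conditional independence as a product
rule -/

section General
variable {Ω : Type*} [MeasurableSpace Ω] {μ : Measure Ω}

theorem tsum_setLIntegral_preimage {γ : Type*} [Countable γ] [MeasurableSpace γ]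
    [DiscreteMeasurableSpace γ] {W : Ω → γ} (hW : Measurable W) {S : Set Ω} (hS : MeasurableSet S)
    (f : Ω → ℝ≥0∞) : ∑' w, ∫⁻ x in W ⁻¹' {w} ∩ S, f x ∂μ = ∫⁻ x in S, f x ∂μ := by
  rw [← lintegral_iUnion (fun w => (hW MeasurableSet.of_discrete).inter hS)]
  · congr 2
    ext x
    simp
  · intro i j hij
    refine Set.disjoint_left.2 fun x hx hx' => hij ?_
    simp only [Set.mem_inter_iff, Set.mem_preimage, Set.mem_singleton_iff] at hx hx'
    rw [← hx.1, hx'.1]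

theorem hasSum_setIntegral_preimage {γ : Type*} [Countable γ] [MeasurableSpace γ]
    [DiscreteMeasurableSpace γ] {W : Ω → γ} (hW : Measurable W) {S : Set Ω} (hS : MeasurableSet S)
    {f : Ω → ℝ} (hf : IntegrableOn f S μ) :
    HasSum (fun w => ∫ x in W ⁻¹' {w} ∩ S, f x ∂μ) (∫ x in S, f x ∂μ) := by
  have hU : (⋃ w, W ⁻¹' {w} ∩ S) = S := by
    ext x
    simp
  have := hasSum_integral_iUnion (μ := μ) (f := f) (s := fun w => W ⁻¹' {w} ∩ S)
    (fun w => (hW MeasurableSet.of_discrete).inter hS) ?_ (by rwa [hU])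
  · rwa [hU] at this
  · intro i j hij
    refine Set.disjoint_left.2 fun x hx hx' => hij ?_
    simp only [Set.mem_inter_iff, Set.mem_preimage, Set.mem_singleton_iff] at hx hx'
    rw [← hx.1, hx'.1]

variable {α β γ : Type*} [MeasurableSpace α] [MeasurableSpace β] [MeasurableSpace γ]
  [DiscreteMeasurableSpace β] [DiscreteMeasurableSpace γ]

/-- The version with lower integrals needs no integrability of `f`, so it can serve to derive the
integrability of Y(b,z). Multiplying out the conditioning probability keeps null events {W = w}
inside the statement. -/
theorem CondIndepGiven.setLIntegral_mul [IsFiniteMeasure μ] {f : Ω → ℝ} {g : Ω → β} {W : Ω → γ}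
    (h : CondIndepGiven f g W μ) (hf : Measurable f) (hg : Measurable g) (hW : Measurable W)
    (w : γ) (z : β) :
    (∫⁻ ω in W ⁻¹' {w} ∩ g ⁻¹' {z}, ‖f ω‖ₑ ∂μ) * μ (W ⁻¹' {w}) =
      (∫⁻ ω in W ⁻¹' {w}, ‖f ω‖ₑ ∂μ) * μ (W ⁻¹' {w} ∩ g ⁻¹' {z}) := by
  have hmW : MeasurableSet (W ⁻¹' {w}) := hW MeasurableSet.of_discrete
  have hmg : MeasurableSet (g ⁻¹' {z}) := hg MeasurableSet.of_discrete
  rcases eq_or_ne (μ (W ⁻¹' {w})) 0 with h0 | h0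
  · have : μ (W ⁻¹' {w} ∩ g ⁻¹' {z}) = 0 := measure_mono_null Set.inter_subset_left h0
    simp [h0, this]
  have hind : IndepFun (fun ω => ‖f ω‖ₑ) (fun ω => Set.indicator {z} (fun _ => (1 : ℝ≥0∞)) (g ω))
      (ProbabilityTheory.cond μ (W ⁻¹' {w})) :=
    (h w).comp measurable_enorm (Measurable.of_discrete (f := Set.indicator {z} fun _ => (1 : ℝ≥0∞)))
  have key := lintegral_mul_eq_lintegral_mul_lintegral_of_indepFun''
    (hf.enorm.aemeasurable) (Measurable.aemeasurable (by
      exact (measurable_const.indicator hmg : Measurable ((g ⁻¹' {z}).indicator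
        fun _ => (1 : ℝ≥0∞))))) hind
  have e1 : ∀ ω, ‖f ω‖ₑ * Set.indicator {z} (fun _ => (1 : ℝ≥0∞)) (g ω) =
      (g ⁻¹' {z}).indicator (fun ω => ‖f ω‖ₑ) ω := by
    intro ω
    by_cases hz : g ω = z <;> simp [hz]
  have e2 : ∀ ω, Set.indicator {z} (fun _ => (1 : ℝ≥0∞)) (g ω) = (g ⁻¹' {z}).indicator 1 ω :=
    fun ω => rfl
  simp_rw [e1, e2] at key
  rw [lintegral_indicator hmg, lintegral_indicator_one hmg, cond_apply hmW,
    ProbabilityTheory.cond, Measure.restrict_smul, lintegral_smul_measure, lintegral_smul_measure,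
    Measure.restrict_restrict hmg, smul_eq_mul, smul_eq_mul] at key
  have hfin := measure_ne_top μ (W ⁻¹' {w})
  have hc : (μ (W ⁻¹' {w}))⁻¹ * μ (W ⁻¹' {w}) = 1 := ENNReal.inv_mul_cancel h0 hfin
  rw [Set.inter_comm] at key
  -- With c = μ(W = w) finite and nonzero, factors c⁻¹c = 1 are inserted until the factorization
  -- under the conditional measure can be substituted.
  calc _ = ((μ (W ⁻¹' {w}))⁻¹ * ∫⁻ ω in W ⁻¹' {w} ∩ g ⁻¹' {z}, ‖f ω‖ₑ ∂μ) *
        (μ (W ⁻¹' {w}) * μ (W ⁻¹' {w})) := by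
        rw [mul_comm _ (∫⁻ ω in _, _ ∂μ), mul_assoc, ← mul_assoc _ (μ _) (μ _), hc, one_mul]
    _ = (((μ (W ⁻¹' {w}))⁻¹ * μ (W ⁻¹' {w})) * ((μ (W ⁻¹' {w}))⁻¹ * μ (W ⁻¹' {w}))) *
        ((∫⁻ ω in W ⁻¹' {w}, ‖f ω‖ₑ ∂μ) * μ (W ⁻¹' {w} ∩ g ⁻¹' {z})) := by
        rw [key]; ring
    _ = _ := by rw [hc]; ring

theorem CondIndepGiven.setIntegral_mul [IsFiniteMeasure μ] {f : Ω → ℝ} {g : Ω → β} {W : Ω → γ}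
    (h : CondIndepGiven f g W μ) (hf : Measurable f) (hg : Measurable g) (hW : Measurable W)
    (w : γ) (z : β) :
    (∫ ω in W ⁻¹' {w} ∩ g ⁻¹' {z}, f ω ∂μ) * μ.real (W ⁻¹' {w}) =
      (∫ ω in W ⁻¹' {w}, f ω ∂μ) * μ.real (W ⁻¹' {w} ∩ g ⁻¹' {z}) := by
  have hmW : MeasurableSet (W ⁻¹' {w}) := hW MeasurableSet.of_discrete
  have hmg : MeasurableSet (g ⁻¹' {z}) := hg MeasurableSet.of_discrete
  rcases eq_or_ne (μ (W ⁻¹' {w})) 0 with h0 | h0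
  · have : μ (W ⁻¹' {w} ∩ g ⁻¹' {z}) = 0 := measure_mono_null Set.inter_subset_left h0
    simp [Measure.real, h0, this]
  have hind : IndepFun f (fun ω => Set.indicator {z} (fun _ => (1 : ℝ)) (g ω))
      (ProbabilityTheory.cond μ (W ⁻¹' {w})) :=
    (h w).comp measurable_id (Measurable.of_discrete (f := Set.indicator {z} fun _ => (1 : ℝ)))
  have key := hind.integral_fun_mul_eq_mul_integral hf.aestronglyMeasurable
    (Measurable.aestronglyMeasurable (by
      exact (measurable_const.indicator hmg : Measurable ((g ⁻¹' {z}).indicator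
        fun _ => (1 : ℝ)))))
  have e1 : ∀ ω, f ω * Set.indicator {z} (fun _ => (1 : ℝ)) (g ω) =
      (g ⁻¹' {z}).indicator f ω := by
    intro ω
    by_cases hz : g ω = z <;> simp [hz]
  have e2 : ∀ ω, Set.indicator {z} (fun _ => (1 : ℝ)) (g ω) = (g ⁻¹' {z}).indicator 1 ω :=
    fun ω => rfl
  simp_rw [e1, e2] at key
  rw [integral_indicator hmg, integral_indicator_one hmg, measureReal_def, cond_apply hmW,
    ProbabilityTheory.cond, Measure.restrict_smul, integral_smul_measure, integral_smul_measure,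
    Measure.restrict_restrict hmg, smul_eq_mul, smul_eq_mul, ENNReal.toReal_mul,
    ENNReal.toReal_inv, ← measureReal_def, ← measureReal_def] at key
  have hr : μ.real (W ⁻¹' {w}) ≠ 0 := (ENNReal.toReal_pos h0 (measure_ne_top _ _)).ne'
  rw [Set.inter_comm] at key
  field_simp at key
  linarith

end General

/-! ### Identification of the average causal effect from the observed law -/

section Identification
variable {Ω 𝒜 𝒵 𝒞 : Type u} [MeasurableSpace Ω] [MeasurableSpace 𝒜] [MeasurableSpace 𝒵]
  [MeasurableSpace 𝒞] [DiscreteMeasurableSpace 𝒜] [DiscreteMeasurableSpace 𝒵]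
  [DiscreteMeasurableSpace 𝒞] {μ : Measure Ω} [IsProbabilityMeasure μ]
  {V : CausalVars Ω 𝒜 𝒵 𝒞} {a₁ a₀ : 𝒜}

theorem measureReal_map_obs {S : Set (Obs 𝒜 𝒵 𝒞)} (hS : MeasurableSet S) :
    (μ.map V.obs).real S = μ.real (V.obs ⁻¹' S) :=
  map_measureReal_apply (measurable_obs V) hS

theorem measure_trt_ne_zero [Nonempty 𝒵] [Nonempty 𝒞] (h : IsFDTDModel V μ a₁ a₀) (a : 𝒜) :
    μ (V.A ⁻¹' {a}) ≠ 0 := by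
  obtain ⟨z⟩ := ‹Nonempty 𝒵›
  obtain ⟨c⟩ := ‹Nonempty 𝒞›
  exact fun h0 => h.positivity a z c (measure_mono_null (fun ω hω => hω.1) h0)

theorem measureReal_trt_pos [Nonempty 𝒵] [Nonempty 𝒞] (h : IsFDTDModel V μ a₁ a₀) (a : 𝒜) :
    0 < μ.real (V.A ⁻¹' {a}) :=
  ENNReal.toReal_pos (measure_trt_ne_zero h a) (measure_ne_top _ _)

theorem measure_med_trt (h : IsFDTDModel V μ a₁ a₀) (a : 𝒜) (z : 𝒵) :
    μ (V.A ⁻¹' {a} ∩ V.Zpot a ⁻¹' {z}) = μ (V.A ⁻¹' {a} ∩ V.Z ⁻¹' {z}) := by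
  refine measure_congr ?_
  filter_upwards [h.consistency.mediator a] with ω hω
  simp only [eq_iff_iff]
  change (V.A ω = a ∧ V.Zpot a ω = z) ↔ (V.A ω = a ∧ V.Z ω = z)
  constructor
  · rintro ⟨h1, h2⟩; exact ⟨h1, by rw [hω h1, h2]⟩
  · rintro ⟨h1, h2⟩; exact ⟨h1, by rw [← hω h1, h2]⟩

/-- `p(z | a) = P(Z(a) = z)`. -/
theorem trueNuisance_pZ_eq [Nonempty 𝒵] [Nonempty 𝒞] (h : IsFDTDModel V μ a₁ a₀) (a : 𝒜) (z : 𝒵) :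
    (trueNuisance (μ.map V.obs)).pZ z a = μ.real (V.Zpot a ⁻¹' {z}) := by
  have hpos := measureReal_trt_pos h a
  have h1 : (μ.map V.obs).real {x | x.med = z ∧ x.trt = a} =
      μ.real (V.A ⁻¹' {a} ∩ V.Zpot a ⁻¹' {z}) := by
    rw [measureReal_map_obs (show MeasurableSet {x : Obs 𝒜 𝒵 𝒞 | x.med = z ∧ x.trt = a} from
      (measurableSet_med z).inter (measurableSet_trt a)), measureReal_def, measureReal_def, measure_med_trt h, Set.inter_comm]
    rfl
  have h2 : (μ.map V.obs).real {x | x.trt = a} = μ.real (V.A ⁻¹' {a}) := by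
    rw [measureReal_map_obs (measurableSet_trt a)]; rfl
  have h3 := (h.frontDoor.fd2 a).measure_inter_preimage_eq_mul {z} {a} MeasurableSet.of_discrete
    MeasurableSet.of_discrete
  simp only [trueNuisance]
  rw [h1, h2, measureReal_def, Set.inter_comm, h3, ENNReal.toReal_mul, ← measureReal_def,
    ← measureReal_def, mul_div_assoc, div_self hpos.ne', mul_one]

theorem preimage_trt_cov (a : 𝒜) (c : 𝒞) :
    (fun ω => (V.A ω, V.C ω)) ⁻¹' {(a, c)} = V.A ⁻¹' {a} ∩ V.C ⁻¹' {c} := by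
  ext ω
  simp

theorem probAC_map (a : 𝒜) (c : 𝒞) :
    probAC (μ.map V.obs) a c = μ.real (V.A ⁻¹' {a} ∩ V.C ⁻¹' {c}) := by
  rw [probAC, measureReal_map_obs (show MeasurableSet {x : Obs 𝒜 𝒵 𝒞 | x.trt = a ∧ x.cov = c} from
    (measurableSet_trt a).inter (measurableSet_cov c))]
  rfl

theorem measureReal_cell_map (q : 𝒜 × 𝒵 × 𝒞) : (μ.map V.obs).real (cell q) =
    μ.real {ω | V.A ω = q.1 ∧ V.Z ω = q.2.1 ∧ V.C ω = q.2.2} := by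
  rw [measureReal_map_obs (measurableSet_cell _)]
  rfl

/-- `Z ⊥ C | A`. -/
theorem measureReal_cell_factor [Nonempty 𝒵] [Nonempty 𝒞] (h : IsFDTDModel V μ a₁ a₀)
    (a : 𝒜) (z : 𝒵) (c : 𝒞) :
    (μ.map V.obs).real (cell (a, z, c)) =
      (trueNuisance (μ.map V.obs)).pZ z a * probAC (μ.map V.obs) a c := by
  have hpos := measureReal_trt_pos h a
  have hA : MeasurableSet (V.A ⁻¹' {a}) := V.measurable_A MeasurableSet.of_discrete
  have h3 := (h.mediator_indep_cov a a).measure_inter_preimage_eq_mul {z} {c}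
    MeasurableSet.of_discrete MeasurableSet.of_discrete
  rw [cond_apply hA, cond_apply hA, cond_apply hA] at h3
  have h4 := congrArg ENNReal.toReal h3
  simp only [ENNReal.toReal_mul, ENNReal.toReal_inv, ← measureReal_def] at h4
  have h5 : μ.real (V.A ⁻¹' {a} ∩ (V.Zpot a ⁻¹' {z} ∩ V.C ⁻¹' {c})) =
      (μ.map V.obs).real (cell (a, z, c)) := by
    rw [measureReal_cell_map]
    refine measureReal_congr ?_
    filter_upwards [h.consistency.mediator a] with ω hω
    simp only [eq_iff_iff]
    change (V.A ω = a ∧ V.Zpot a ω = z ∧ V.C ω = c) ↔ (V.A ω = a ∧ V.Z ω = z ∧ V.C ω = c)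
    constructor
    · rintro ⟨h1, h2⟩; exact ⟨h1, by rwa [hω h1]⟩
    · rintro ⟨h1, h2⟩; exact ⟨h1, by rwa [← hω h1]⟩
  have h6 : μ.real (V.A ⁻¹' {a} ∩ V.Zpot a ⁻¹' {z}) =
      μ.real (V.Zpot a ⁻¹' {z}) * μ.real (V.A ⁻¹' {a}) := by
    have := (h.frontDoor.fd2 a).measure_inter_preimage_eq_mul {z} {a} MeasurableSet.of_discrete
      MeasurableSet.of_discrete
    rw [Set.inter_comm, measureReal_def, this, ENNReal.toReal_mul]
    rfl
  rw [h5, h6] at h4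
  rw [trueNuisance_pZ_eq h, probAC_map]
  field_simp at h4
  linarith

variable [Countable 𝒜] [Countable 𝒵] [Countable 𝒞]

/-- Y(b,z) and Z(b) are independent only within levels of A. Since Z(b) ⊥ A, the weight P(Z(b) = z)
is the same in every level, so summing over the levels restores the product for the unconditional
law. -/
theorem setLIntegral_Zpot [Nonempty 𝒵] [Nonempty 𝒞] (h : IsFDTDModel V μ a₁ a₀) (b : 𝒜) (z : 𝒵) :
    ∫⁻ ω in V.Zpot b ⁻¹' {z}, ‖V.Yjoint b z ω‖ₑ ∂μ =
      μ (V.Zpot b ⁻¹' {z}) * ∫⁻ ω, ‖V.Yjoint b z ω‖ₑ ∂μ := by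
  have hZ : MeasurableSet (V.Zpot b ⁻¹' {z}) := V.measurable_Zpot b MeasurableSet.of_discrete
  rw [← tsum_setLIntegral_preimage V.measurable_A hZ, ← setLIntegral_univ,
    ← tsum_setLIntegral_preimage V.measurable_A MeasurableSet.univ, ← ENNReal.tsum_mul_left]
  refine tsum_congr fun a => ?_
  have h1 := (h.frontDoor.fd3 b b z).setLIntegral_mul (V.measurable_Yjoint b z)
    (V.measurable_Zpot b) V.measurable_A a z
  have h2 := (h.frontDoor.fd2 b).measure_inter_preimage_eq_mul {z} {a} MeasurableSet.of_discrete
      MeasurableSet.of_discrete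
  rw [Set.inter_comm] at h2
  rw [h2, ← mul_assoc] at h1
  have h3 := (ENNReal.mul_left_inj (measure_trt_ne_zero h a) (measure_ne_top _ _)).1 h1
  rw [h3, Set.inter_univ, mul_comm]

theorem lintegral_Ypot_on_Zpot (h : IsFDTDModel V μ a₁ a₀) (b : 𝒜) (z : 𝒵) :
    ∫⁻ ω in V.Zpot b ⁻¹' {z}, ‖V.Ypot b ω‖ₑ ∂μ = ∫⁻ ω in V.Zpot b ⁻¹' {z}, ‖V.Yjoint b z ω‖ₑ ∂μ :=
  setLIntegral_congr_fun_ae (V.measurable_Zpot b MeasurableSet.of_discrete)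
    ((h.consistency.composition b).mono fun ω hω hz => by
      rw [hω, show V.Zpot b ω = z from hz])

theorem measure_Zpot_ne_zero [Nonempty 𝒞] (h : IsFDTDModel V μ a₁ a₀) (b : 𝒜) (z : 𝒵) :
    μ (V.Zpot b ⁻¹' {z}) ≠ 0 := by
  obtain ⟨c⟩ := ‹Nonempty 𝒞›
  intro h0
  refine h.positivity b z c (measure_mono_null (t := V.A ⁻¹' {b} ∩ V.Z ⁻¹' {z})
    (fun ω hω => ⟨hω.1, hω.2.1⟩) ?_)
  rw [← measure_med_trt h]
  exact measure_mono_null Set.inter_subset_right h0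

/-- Only Y(b) is assumed integrable. It dominates Y(b,z) on {Z(b) = z}, where the lower integral
factors as P(Z(b) = z) · E|Y(b,z)|, and P(Z(b) = z) > 0 by positivity. -/
theorem integrable_Yjoint [Nonempty 𝒵] [Nonempty 𝒞] (h : IsFDTDModel V μ a₁ a₀) {b : 𝒜}
    (hb : b ∈ ({a₁, a₀} : Set 𝒜)) (z : 𝒵) : Integrable (V.Yjoint b z) μ := by
  refine ⟨(V.measurable_Yjoint b z).aestronglyMeasurable, ?_⟩
  have h1 : ∫⁻ ω in V.Zpot b ⁻¹' {z}, ‖V.Ypot b ω‖ₑ ∂μ < ∞ :=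
    (setLIntegral_le_lintegral _ _).trans_lt (h.integrable_Ypot b hb).2
  rw [lintegral_Ypot_on_Zpot h, setLIntegral_Zpot h] at h1
  by_contra hcon
  rw [hasFiniteIntegral_def, not_lt, top_le_iff] at hcon
  rw [hcon, ENNReal.mul_top (measure_Zpot_ne_zero h b z)] at h1
  exact lt_irrefl _ h1

theorem setIntegral_Zpot [Nonempty 𝒵] [Nonempty 𝒞] (h : IsFDTDModel V μ a₁ a₀) {b : 𝒜}
    (hb : b ∈ ({a₁, a₀} : Set 𝒜)) (z : 𝒵) :
    ∫ ω in V.Zpot b ⁻¹' {z}, V.Ypot b ω ∂μ =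
      (∫ ω, V.Yjoint b z ω ∂μ) * μ.real (V.Zpot b ⁻¹' {z}) := by
  have hZ : MeasurableSet (V.Zpot b ⁻¹' {z}) := V.measurable_Zpot b MeasurableSet.of_discrete
  have hint := integrable_Yjoint h hb z
  have e : ∫ ω in V.Zpot b ⁻¹' {z}, V.Ypot b ω ∂μ =
      ∫ ω in V.Zpot b ⁻¹' {z}, V.Yjoint b z ω ∂μ :=
    setIntegral_congr_ae hZ ((h.consistency.composition b).mono fun ω hω hz => by
      rw [hω, show V.Zpot b ω = z from hz])
  rw [e]
  have s1 := hasSum_setIntegral_preimage V.measurable_A hZ hint.integrableOn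
  have s2 := (hasSum_setIntegral_preimage V.measurable_A MeasurableSet.univ
    hint.integrableOn).mul_right (μ.real (V.Zpot b ⁻¹' {z}))
  rw [setIntegral_univ] at s2
  refine s1.unique (HasSum.congr_fun s2 fun a => ?_)
  have h1 := (h.frontDoor.fd3 b b z).setIntegral_mul (V.measurable_Yjoint b z)
    (V.measurable_Zpot b) V.measurable_A a z
  have h2 := (h.frontDoor.fd2 b).measure_inter_preimage_eq_mul {z} {a} MeasurableSet.of_discrete
      MeasurableSet.of_discrete
  rw [Set.inter_comm] at h2
  rw [measureReal_def, measureReal_def, h2, ENNReal.toReal_mul, ← mul_assoc] at h1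
  have h3 := mul_right_cancel₀ (ENNReal.toReal_pos (measure_trt_ne_zero h a)
    (measure_ne_top _ _)).ne' h1
  rw [h3, Set.inter_univ, measureReal_def]

/-- `∫_{A = a, C = c} Y(b, z) = E(Y | a, z, c) p(a, c)`. -/
theorem setIntegral_Yjoint (h : IsFDTDModel V μ a₁ a₀) (b : 𝒜) (a : 𝒜) (z : 𝒵) (c : 𝒞) :
    ∫ ω in V.A ⁻¹' {a} ∩ V.C ⁻¹' {c}, V.Yjoint b z ω ∂μ =
      (trueNuisance (μ.map V.obs)).EY a z c * probAC (μ.map V.obs) a c := by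
  have hAC : Measurable fun ω => (V.A ω, V.C ω) := V.measurable_A.prodMk V.measurable_C
  -- The treatment argument is moved to the level a of A, because consistency speaks of Y(a,z) only
  -- on {A = a, Z = z}.
  have hbase : ∫ ω in V.A ⁻¹' {a} ∩ V.C ⁻¹' {c}, V.Yjoint b z ω ∂μ =
      ∫ ω in V.A ⁻¹' {a} ∩ V.C ⁻¹' {c}, V.Yjoint a z ω ∂μ :=
    integral_congr_ae (ae_restrict_of_ae (h.frontDoor.fd1 b a z))
  have hcellm : MeasurableSet {ω | V.A ω = a ∧ V.Z ω = z ∧ V.C ω = c} :=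
    (V.measurable_A (MeasurableSet.of_discrete (s := {a}))).inter
      ((V.measurable_Z (MeasurableSet.of_discrete (s := {z}))).inter
        (V.measurable_C (MeasurableSet.of_discrete (s := {c}))))
  -- Conditional on (A,C) = (a,c), restricting to Z(a) = z does not alter the mean of Y(a,z); on the
  -- restricted event Z(a) = Z, so the mean is the outcome regression.
  have h1 := (h.twoDoor.td3 a a z).setIntegral_mul (V.measurable_Yjoint a z)
    (V.measurable_Zpot a) hAC (a, c) z
  rw [preimage_trt_cov] at h1
  have hset : ((V.A ⁻¹' {a} ∩ V.C ⁻¹' {c}) ∩ V.Zpot a ⁻¹' {z} : Set Ω) =ᵐ[μ]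
      {ω | V.A ω = a ∧ V.Z ω = z ∧ V.C ω = c} := by
    filter_upwards [h.consistency.mediator a] with ω hω
    simp only [eq_iff_iff]
    change ((V.A ω = a ∧ V.C ω = c) ∧ V.Zpot a ω = z) ↔ (V.A ω = a ∧ V.Z ω = z ∧ V.C ω = c)
    constructor
    · rintro ⟨⟨h1, h2⟩, h3⟩; exact ⟨h1, by rwa [hω h1], h2⟩
    · rintro ⟨h1, h2, h3⟩; exact ⟨⟨h1, h3⟩, by rwa [← hω h1]⟩
  have hY : ∫ ω in {ω | V.A ω = a ∧ V.Z ω = z ∧ V.C ω = c}, V.Yjoint a z ω ∂μ =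
      ∫ ω in {ω | V.A ω = a ∧ V.Z ω = z ∧ V.C ω = c}, V.Y ω ∂μ :=
    setIntegral_congr_ae hcellm ((h.consistency.joint a z).mono fun ω hω hm =>
      (hω hm.1 hm.2.1).symm)
  have hP : ∫ x in {x | x.trt = a ∧ x.med = z ∧ x.cov = c}, x.out ∂(μ.map V.obs) =
      ∫ ω in {ω | V.A ω = a ∧ V.Z ω = z ∧ V.C ω = c}, V.Y ω ∂μ := by
    rw [setIntegral_map (show MeasurableSet {x : Obs 𝒜 𝒵 𝒞 | x.trt = a ∧ x.med = z ∧ x.cov = c}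
      from measurableSet_cell (a, z, c)) measurable_out.aestronglyMeasurable
      (measurable_obs V).aemeasurable]
    rfl
  have hq := measureReal_cell_map (μ := μ) (V := V) (a, z, c)
  have hpos : 0 < μ.real {ω | V.A ω = a ∧ V.Z ω = z ∧ V.C ω = c} :=
    ENNReal.toReal_pos (h.positivity a z c) (measure_ne_top _ _)
  rw [hbase]
  rw [setIntegral_congr_set hset, measureReal_congr hset, hY] at h1
  have hE : (trueNuisance (μ.map V.obs)).EY a z c =
      (∫ ω in {ω | V.A ω = a ∧ V.Z ω = z ∧ V.C ω = c}, V.Y ω ∂μ) /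
        μ.real {ω | V.A ω = a ∧ V.Z ω = z ∧ V.C ω = c} := by
    rw [← hP, ← hq]
    rfl
  rw [hE, probAC_map, div_mul_eq_mul_div, h1, mul_div_assoc, div_self hpos.ne', mul_one]

/-- Total expectation over Z(b), then over (A,C). Iterated sums alone would not determine an
unordered sum, so absolute summability comes separately: the same factorization with absolute values
bounds Σ|F| by E|Y(b)|. -/
theorem hasSum_identification [Nonempty 𝒵] [Nonempty 𝒞] (h : IsFDTDModel V μ a₁ a₀) {b : 𝒜}
    (hb : b ∈ ({a₁, a₀} : Set 𝒜)) :
    HasSum (fun q : 𝒜 × 𝒵 × 𝒞 => (trueNuisance (μ.map V.obs)).EY q.1 q.2.1 q.2.2 *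
      probAC (μ.map V.obs) q.1 q.2.2 * (trueNuisance (μ.map V.obs)).pZ q.2.1 b)
      (∫ ω, V.Ypot b ω ∂μ) := by
  have hAC : Measurable fun ω => (V.A ω, V.C ω) := V.measurable_A.prodMk V.measurable_C
  set F : 𝒵 × 𝒜 × 𝒞 → ℝ := fun q =>
    (trueNuisance (μ.map V.obs)).EY q.2.1 q.1 q.2.2 *
      probAC (μ.map V.obs) q.2.1 q.2.2 * (trueNuisance (μ.map V.obs)).pZ q.1 b with hF
  have hFval : ∀ z w, F (z, w) = (∫ ω in (fun ω => (V.A ω, V.C ω)) ⁻¹' {w} ∩ Set.univ,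
      V.Yjoint b z ω ∂μ) * μ.real (V.Zpot b ⁻¹' {z}) := by
    rintro z ⟨a, c⟩
    rw [Set.inter_univ, preimage_trt_cov, setIntegral_Yjoint h, ← trueNuisance_pZ_eq h]
  have hz : ∀ z, HasSum (fun w => F (z, w)) (∫ ω in V.Zpot b ⁻¹' {z}, V.Ypot b ω ∂μ) := by
    intro z
    have s2 := (hasSum_setIntegral_preimage hAC MeasurableSet.univ
      (integrable_Yjoint h hb z).integrableOn).mul_right (μ.real (V.Zpot b ⁻¹' {z}))
    rw [setIntegral_univ, ← setIntegral_Zpot h hb] at s2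
    simpa only [hFval] using s2
  have hsum : Summable F := by
    have hle : ∑' q, ‖F q‖ₑ ≤ ∫⁻ ω, ‖V.Ypot b ω‖ₑ ∂μ := by
      rw [ENNReal.tsum_prod', ← setLIntegral_univ,
        ← tsum_setLIntegral_preimage (V.measurable_Zpot b) MeasurableSet.univ]
      refine ENNReal.tsum_le_tsum fun z => ?_
      rw [Set.inter_univ, lintegral_Ypot_on_Zpot h, setLIntegral_Zpot h, ← setLIntegral_univ,
        ← tsum_setLIntegral_preimage hAC MeasurableSet.univ, ← ENNReal.tsum_mul_left]
      refine ENNReal.tsum_le_tsum fun w => ?_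
      rw [hFval, enorm_mul, mul_comm]
      gcongr
      · rw [Real.enorm_of_nonneg measureReal_nonneg, ofReal_measureReal]
      · exact enorm_integral_le_lintegral_enorm _
    have hfin : ∑' q, ‖F q‖ₑ ≠ ∞ := (hle.trans_lt (h.integrable_Ypot b hb).2).ne
    exact (summable_norm_iff.1 (by
      simpa using ENNReal.summable_toReal hfin))
  have htot : HasSum F (∫ ω, V.Ypot b ω ∂μ) := by
    have s := hasSum_setIntegral_preimage (V.measurable_Zpot b) MeasurableSet.univ
      (h.integrable_Ypot b hb).integrableOn
    simp only [Set.inter_univ, setIntegral_univ] at s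
    have := hsum.hasSum.prod_fiberwise hz
    rw [← this.unique s]
    exact hsum.hasSum
  have e : (fun q : 𝒜 × 𝒵 × 𝒞 => (trueNuisance (μ.map V.obs)).EY q.1 q.2.1 q.2.2 *
      probAC (μ.map V.obs) q.1 q.2.2 * (trueNuisance (μ.map V.obs)).pZ q.2.1 b) =
      F ∘ (Equiv.mk (fun q : 𝒜 × 𝒵 × 𝒞 => (q.2.1, q.1, q.2.2))
        (fun q : 𝒵 × 𝒜 × 𝒞 => (q.2.1, q.1, q.2.2)) (fun _ => rfl) (fun _ => rfl)) := rfl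
  rw [e, Equiv.hasSum_iff]
  exact htot

theorem IsFDTDModel.modelFacts (h : IsFDTDModel V μ a₁ a₀) :
    ModelFacts a₁ a₀ (μ.map V.obs) (ACE V μ a₁ a₀) := by
  obtain ⟨ω⟩ := nonempty_of_isProbabilityMeasure μ
  haveI : Nonempty 𝒵 := ⟨V.Z ω⟩
  haveI : Nonempty 𝒞 := ⟨V.C ω⟩
  refine ⟨Measure.isProbabilityMeasure_map (measurable_obs V).aemeasurable, fun q => ?_,
    measureReal_cell_factor h, ?_, fun b hb => (hasSum_identification h hb).summable, ?_⟩
  · rw [measureReal_cell_map]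
    exact ENNReal.toReal_pos (h.positivity _ _ _) (measure_ne_top _ _)
  · exact (integrable_map_measure measurable_out.aestronglyMeasurable
      (measurable_obs V).aemeasurable).2 h.integrable_Y
  · simp only [mul_sub]
    exact (hasSum_identification h (by simp)).sub (hasSum_identification h (by simp))

theorem IsModelLaw.modelFacts {P : Measure (Obs 𝒜 𝒵 𝒞)} {θ : ℝ} (h : IsModelLaw a₁ a₀ P θ) :
    ModelFacts a₁ a₀ P θ := by
  obtain ⟨Ω', _, μ', V', hμ, hV, rfl, rfl⟩ := h
  exact hV.modelFacts

end Identification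

end FDTD

namespace FDTD

/-! ### Rearrangements of series -/

section Series

/-- `((a, c), z) ↦ (a, z, c)` -/
def equivACZ (α β γ : Type*) : (α × γ) × β ≃ α × β × γ where
  toFun p := (p.1.1, p.2, p.1.2)
  invFun q := ((q.1, q.2.2), q.2.1)
  left_inv _ := rfl
  right_inv _ := rfl

/-- `(z, a, c) ↦ (a, z, c)` -/
def equivZAC (α β γ : Type*) : β × α × γ ≃ α × β × γ where
  toFun p := (p.2.1, p.1, p.2.2)
  invFun q := (q.2.1, q.1, q.2.2)
  left_inv _ := rfl
  right_inv _ := rfl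

/-- `(c, a, z) ↦ (a, z, c)` -/
def equivCAZ (α β γ : Type*) : γ × α × β ≃ α × β × γ where
  toFun p := (p.2.1, p.2.2, p.1)
  invFun q := (q.2.2, q.1, q.2.1)
  left_inv _ := rfl
  right_inv _ := rfl

/-- Spreading each term over a probability vector keeps the sum, and also the sum of absolute
values, hence convergence. It serves to attach p(z|a) to a function of (A,C). -/
theorem hasSum_mul_weight {ι κ : Type*} {f : ι → ℝ} {S : ℝ} (hf : HasSum f S) {k : ι → κ → ℝ}
    (hk0 : ∀ i j, 0 ≤ k i j) (hk : ∀ i, HasSum (k i) 1) :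
    HasSum (fun p : ι × κ => f p.1 * k p.1 p.2) S := by
  have hfib : ∀ i, HasSum (fun j => f i * k i j) (f i) := fun i => by
    simpa using (hk i).mul_left (f i)
  have hs : Summable fun p : ι × κ => f p.1 * k p.1 p.2 := by
    rw [← summable_norm_iff]
    have hfib' : ∀ i, HasSum (fun j => ‖f i * k i j‖) ‖f i‖ := fun i => by
      simpa [abs_of_nonneg (hk0 i _)] using (hk i).mul_left ‖f i‖
    rw [summable_prod_of_nonneg fun p => norm_nonneg _]
    refine ⟨fun i => (hfib' i).summable, ?_⟩
    simp_rw [fun i => (hfib' i).tsum_eq]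
    exact hf.summable.norm
  have := hs.hasSum.prod_fiberwise hfib
  rw [hf.unique this]
  exact hs.hasSum

open Classical in
theorem hasSum_indicator_fst {α β : Type*} {Φ : β → ℝ} {S : ℝ} (h : HasSum Φ S) (b : α) :
    HasSum (fun q : α × β => (if q.1 = b then 1 else 0) * Φ q.2) S := by
  have hinj : Function.Injective (fun p : β => (b, p)) := fun p p' h => (Prod.ext_iff.1 h).2
  rw [← hinj.hasSum_iff]
  · simpa [Function.comp_def] using h
  · rintro ⟨a, p⟩ hq
    have : a ≠ b := fun hab => hq ⟨p, by rw [hab]⟩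
    simp [this]

end Series

/-! ### The uncentred influence function as an affine function of the outcome -/

section Affine
variable {𝒜 𝒵 𝒞 : Type u}

/-- The coefficient of `Y` in `m(X, η)`. -/
noncomputable def mSlope (a₁ a₀ : 𝒜) (η : Nuisance 𝒜 𝒵 𝒞) (a : 𝒜) (z : 𝒵) : ℝ :=
  (η.pZ z a₁ - η.pZ z a₀) / η.pZ z a

open Classical in
/-- The contrast `I(a = a₁) - I(a = a₀)`. -/
noncomputable def contrast (a₁ a₀ a : 𝒜) : ℝ :=
  (if a = a₁ then 1 else 0) - (if a = a₀ then 1 else 0)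

/-- The summand of `m(X, η)` that depends on `(A, Z)` only. -/
noncomputable def mTreat (a₁ a₀ : 𝒜) (η : Nuisance 𝒜 𝒵 𝒞) (a : 𝒜) (z : 𝒵) : ℝ :=
  ∑' c, ((∑' a', η.EY a' z c * η.pAC a' c) - ∑' a', ∑' z', η.EY a' z' c * η.pZ z' a * η.pAC a' c) *
    (contrast a₁ a₀ a * η.pC c / η.pA a)

/-- The summand of `m(X, η)` that depends on `(A, C)` only. -/
noncomputable def mReg (a₁ a₀ : 𝒜) (η : Nuisance 𝒜 𝒵 𝒞) (a : 𝒜) (c : 𝒞) : ℝ :=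
  ∑' z, η.EY a z c * (η.pZ z a₁ - η.pZ z a₀)

/-- The value of `m(X, η)` at `Y = 0`. -/
noncomputable def mIntercept (a₁ a₀ : 𝒜) (η : Nuisance 𝒜 𝒵 𝒞) (q : 𝒜 × 𝒵 × 𝒞) : ℝ :=
  -(η.EY q.1 q.2.1 q.2.2 * mSlope a₁ a₀ η q.1 q.2.1) + mTreat a₁ a₀ η q.1 q.2.1 +
    mReg a₁ a₀ η q.1 q.2.2

theorem mFun_eq (a₁ a₀ : 𝒜) (η : Nuisance 𝒜 𝒵 𝒞) (x : Obs 𝒜 𝒵 𝒞) :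
    mFun a₁ a₀ η x =
      mSlope a₁ a₀ η (cellOf x).1 (cellOf x).2.1 * x.out + mIntercept a₁ a₀ η (cellOf x) := by
  change (x.out - η.EY x.trt x.med x.cov) * mSlope a₁ a₀ η x.trt x.med +
    mTreat a₁ a₀ η x.trt x.med + mReg a₁ a₀ η x.trt x.cov = _
  simp only [mIntercept, cellOf]
  ring

/-- `∑_{a,c} E(a, z, c) p(a | c) p(c)` -/
noncomputable def gReg (η : Nuisance 𝒜 𝒵 𝒞) (z : 𝒵) : ℝ :=
  ∑' q : 𝒜 × 𝒞, η.EY q.1 z q.2 * η.pAC q.1 q.2 * η.pC q.2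

/-- `∑_{a,z,c} E(a, z, c) p(z | b) p(a | c) p(c)` -/
noncomputable def hReg (η : Nuisance 𝒜 𝒵 𝒞) (b : 𝒜) : ℝ :=
  ∑' q : 𝒜 × 𝒵 × 𝒞, η.EY q.1 q.2.1 q.2.2 * η.pZ q.2.1 b * η.pAC q.1 q.2.2 * η.pC q.2.2

/-- Merging the nested series into g and h requires absolute convergence of the series for h(a),
which is available for a ∈ {a₁, a₀} only. For every other a the contrast is zero and both sides
vanish. -/
theorem mTreat_eq {a₁ a₀ : 𝒜} {η : Nuisance 𝒜 𝒵 𝒞} (hη : SeriesConverge a₁ a₀ η) (a : 𝒜) (z : 𝒵) :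
    mTreat a₁ a₀ η a z = contrast a₁ a₀ a / η.pA a * (gReg η z - hReg η a) := by
  by_cases ha : a ∈ ({a₁, a₀} : Set 𝒜)
  · have hg := (Equiv.prodComm 𝒞 𝒜).summable_iff.2 (hη.over_ac z)
    have hh := (equivCAZ 𝒜 𝒵 𝒞).summable_iff.2 (hη.total a ha)
    have eg : ∀ c, ∑' a', ((fun q : 𝒜 × 𝒞 => η.EY q.1 z q.2 * η.pAC q.1 q.2 * η.pC q.2) ∘
        Equiv.prodComm 𝒞 𝒜) (c, a') = (∑' a', η.EY a' z c * η.pAC a' c) * η.pC c := fun c => by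
      simp only [Function.comp_apply, Equiv.prodComm_apply, Prod.swap]
      rw [tsum_mul_right]
    have eh : ∀ c, ∑' p : 𝒜 × 𝒵, ((fun q : 𝒜 × 𝒵 × 𝒞 => η.EY q.1 q.2.1 q.2.2 * η.pZ q.2.1 a *
        η.pAC q.1 q.2.2 * η.pC q.2.2) ∘ equivCAZ 𝒜 𝒵 𝒞) (c, p) =
        (∑' a', ∑' z', η.EY a' z' c * η.pZ z' a * η.pAC a' c) * η.pC c := fun c => by
      rw [(hh.prod_factor c).tsum_prod]
      simp only [Function.comp_apply, equivCAZ, Equiv.coe_fn_mk]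
      simp_rw [tsum_mul_right]
    have sg := hg.prod
    have sh := hh.prod
    have tg := hg.tsum_prod
    have th := hh.tsum_prod
    rw [Function.comp_def, Equiv.tsum_eq (Equiv.prodComm 𝒞 𝒜)
      (fun q : 𝒜 × 𝒞 => η.EY q.1 z q.2 * η.pAC q.1 q.2 * η.pC q.2)] at tg
    rw [Function.comp_def, Equiv.tsum_eq (equivCAZ 𝒜 𝒵 𝒞) (fun q : 𝒜 × 𝒵 × 𝒞 =>
      η.EY q.1 q.2.1 q.2.2 * η.pZ q.2.1 a * η.pAC q.1 q.2.2 * η.pC q.2.2)] at th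
    simp only [Function.comp_def] at eg sg eh sh
    simp only [eg] at sg tg
    simp only [eh] at sh th
    rw [gReg, hReg, tg, th, ← sg.tsum_sub sh, ← tsum_mul_left, mTreat]
    refine tsum_congr fun c => ?_
    ring
  · have h1 : a ≠ a₁ := fun h => ha (by simp [h])
    have h0 : a ≠ a₀ := fun h => ha (by simp [h])
    simp [mTreat, contrast, h1, h0]

end Affine

/-! ### Expectation of the estimating function and double robustness -/

section Expectation
variable {𝒜 𝒵 𝒞 : Type u} [MeasurableSpace 𝒜] [MeasurableSpace 𝒵] [MeasurableSpace 𝒞]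
  [DiscreteMeasurableSpace 𝒜] [DiscreteMeasurableSpace 𝒵] [DiscreteMeasurableSpace 𝒞]
  [Countable 𝒜] [Countable 𝒵] [Countable 𝒞]
  {a₁ a₀ : 𝒜} {P : Measure (Obs 𝒜 𝒵 𝒞)} {θ : ℝ}

theorem ModelFacts.pA_pos (h : ModelFacts a₁ a₀ P θ) [Nonempty 𝒵] [Nonempty 𝒞] (a : 𝒜) :
    0 < (trueNuisance P).pA a := by
  haveI := h.prob
  obtain ⟨z⟩ := ‹Nonempty 𝒵›
  obtain ⟨c⟩ := ‹Nonempty 𝒞›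
  exact (h.pos (a, z, c)).trans_le (measureReal_mono fun x hx => hx.1)

theorem ModelFacts.pC_pos (h : ModelFacts a₁ a₀ P θ) [Nonempty 𝒜] [Nonempty 𝒵] (c : 𝒞) :
    0 < (trueNuisance P).pC c := by
  haveI := h.prob
  obtain ⟨z⟩ := ‹Nonempty 𝒵›
  obtain ⟨a⟩ := ‹Nonempty 𝒜›
  exact (h.pos (a, z, c)).trans_le (measureReal_mono fun x hx => hx.2.2)

theorem ModelFacts.pZ_pos (h : ModelFacts a₁ a₀ P θ) [Nonempty 𝒞] (z : 𝒵) (a : 𝒜) :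
    0 < (trueNuisance P).pZ z a := by
  haveI := h.prob
  obtain ⟨c⟩ := ‹Nonempty 𝒞›
  have h1 := h.pos (a, z, c)
  rw [h.factor] at h1
  exact pos_of_mul_pos_left h1 measureReal_nonneg

theorem ModelFacts.pAC_mul_pC (h : ModelFacts a₁ a₀ P θ) [Nonempty 𝒜] [Nonempty 𝒵]
    (a : 𝒜) (c : 𝒞) : (trueNuisance P).pAC a c * (trueNuisance P).pC c = probAC P a c := by
  have := h.pC_pos c
  change P.real {x | x.trt = a ∧ x.cov = c} / (trueNuisance P).pC c * (trueNuisance P).pC c = _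
  rw [div_mul_cancel₀ _ this.ne']
  rfl

theorem hasSum_probAC [IsProbabilityMeasure P] (a : 𝒜) :
    HasSum (fun c => probAC P a c) ((trueNuisance P).pA a) := by
  have := hasSum_setIntegral_preimage (μ := P) measurable_cov (measurableSet_trt a)
    (f := fun _ => (1 : ℝ)) (integrable_const _).integrableOn
  simp only [setIntegral_const, smul_eq_mul, mul_one] at this
  refine this.congr_fun fun c => ?_
  rw [Set.inter_comm]
  rfl

theorem ModelFacts.hasSum_pZ (h : ModelFacts a₁ a₀ P θ) [Nonempty 𝒵] [Nonempty 𝒞] (a : 𝒜) :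
    HasSum (fun z => (trueNuisance P).pZ z a) 1 := by
  haveI := h.prob
  have h1 := hasSum_setIntegral_preimage (μ := P) measurable_med (measurableSet_trt a)
    (f := fun _ => (1 : ℝ)) (integrable_const _).integrableOn
  simp only [setIntegral_const, smul_eq_mul, mul_one] at h1
  have h2 := h1.div_const (P.real {x | x.trt = a})
  rw [div_self (show P.real {x | x.trt = a} ≠ 0 from (h.pA_pos a).ne')] at h2
  exact h2

theorem ModelFacts.EY_mul_cell (h : ModelFacts a₁ a₀ P θ) (q : 𝒜 × 𝒵 × 𝒞) :
    (trueNuisance P).EY q.1 q.2.1 q.2.2 * P.real (cell q) = ∫ x in cell q, x.out ∂P :=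
  div_mul_cancel₀ _ (h.pos q).ne'

/-- The expectation of an affine function of the outcome with cellwise coefficients. -/
theorem ModelFacts.hasSum_integral_affine (h : ModelFacts a₁ a₀ P θ) {U W : 𝒜 × 𝒵 × 𝒞 → ℝ}
    (hint : Integrable (fun x : Obs 𝒜 𝒵 𝒞 => U (cellOf x) * x.out + W (cellOf x)) P) :
    HasSum (fun q => (U q * (trueNuisance P).EY q.1 q.2.1 q.2.2 + W q) * P.real (cell q))
      (∫ x, (U (cellOf x) * x.out + W (cellOf x)) ∂P) := by
  haveI := h.prob
  have h1 := hasSum_setIntegral_preimage measurable_cellOf MeasurableSet.univ hint.integrableOn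
  rw [setIntegral_univ] at h1
  refine h1.congr_fun fun q => ?_
  rw [Set.inter_univ, ← cell_eq_preimage]
  have e : ∫ x in cell q, (U (cellOf x) * x.out + W (cellOf x)) ∂P =
      ∫ x in cell q, (U q * x.out + W q) ∂P := by
    refine setIntegral_congr_fun (measurableSet_cell q) fun x hx => ?_
    rw [cell_eq_preimage] at hx
    simp only [show cellOf x = q from hx]
  rw [e, integral_add (h.integrable_out.integrableOn.const_mul _) (integrable_const _),
    integral_const_mul, setIntegral_const, smul_eq_mul, ← h.EY_mul_cell]
  ring

/-- The expectation of the summand of `m(X, η)` depending on `(A, Z)`. -/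
theorem ModelFacts.hasSum_mTreat (h : ModelFacts a₁ a₀ P θ) [Nonempty 𝒵] [Nonempty 𝒞]
    {η : Nuisance 𝒜 𝒵 𝒞} (hη : SeriesConverge a₁ a₀ η)
    (hg : ∀ b ∈ ({a₁, a₀} : Set 𝒜), Summable fun z => gReg η z * (trueNuisance P).pZ z b) :
    HasSum (fun q : 𝒜 × 𝒵 × 𝒞 => mTreat a₁ a₀ η q.1 q.2.1 * P.real (cell q))
      ((trueNuisance P).pA a₁ / η.pA a₁ *
          ((∑' z, gReg η z * (trueNuisance P).pZ z a₁) - hReg η a₁) -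
        (trueNuisance P).pA a₀ / η.pA a₀ *
          ((∑' z, gReg η z * (trueNuisance P).pZ z a₀) - hReg η a₀)) := by
  classical
  haveI := h.prob
  have key : ∀ b ∈ ({a₁, a₀} : Set 𝒜), HasSum (fun p : 𝒵 × 𝒞 =>
      1 / η.pA b * ((gReg η p.1 * (trueNuisance P).pZ p.1 b - hReg η b * (trueNuisance P).pZ p.1 b) *
        probAC P b p.2)) ((trueNuisance P).pA b / η.pA b *
          ((∑' z, gReg η z * (trueNuisance P).pZ z b) - hReg η b)) := by
    intro b hb
    have s1 := (hg b hb).hasSum.sub ((h.hasSum_pZ b).mul_left (hReg η b))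
    have s2 := hasSum_probAC (P := P) b
    have s3 := (s1.mul s2 (summable_mul_of_summable_norm s1.summable.norm
      s2.summable.norm)).mul_left (1 / η.pA b)
    rw [show (trueNuisance P).pA b / η.pA b *
      ((∑' z, gReg η z * (trueNuisance P).pZ z b) - hReg η b) = 1 / η.pA b *
      (((∑' z, gReg η z * (trueNuisance P).pZ z b) - hReg η b * 1) * (trueNuisance P).pA b) by ring]
    exact s3
  have s := (hasSum_indicator_fst (key a₁ (by simp)) a₁).sub
    (hasSum_indicator_fst (key a₀ (by simp)) a₀)
  refine s.congr_fun fun q => ?_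
  obtain ⟨a, z, c⟩ := q
  rw [mTreat_eq hη, h.factor, contrast]
  -- Each of the two treatment values contributes on its own slice {A = b}; if a₁ = a₀ the slices
  -- coincide and cancel.
  by_cases h1 : a = a₁ <;> by_cases h0 : a = a₀
  · subst h1; subst h0; simp
  · subst h1; simp [h0]; ring
  · subst h0; simp [h1]; ring
  · simp [h1, h0]

/-- `E m(X, η) = θ` when the outcome regression and the law of `(A, C)` are correct. -/
theorem ModelFacts.integral_mFun_of_outcome (h : ModelFacts a₁ a₀ P θ) [Nonempty 𝒜] [Nonempty 𝒵]
    [Nonempty 𝒞] {η : Nuisance 𝒜 𝒵 𝒞} (hη : SeriesConverge a₁ a₀ η)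
    (hint : Integrable (mFun a₁ a₀ η) P) (hE : η.EY = (trueNuisance P).EY)
    (hAC : η.pAC = (trueNuisance P).pAC) (hC : η.pC = (trueNuisance P).pC)
    (hA : ∀ a ∈ ({a₁, a₀} : Set 𝒜), η.pA a = ∑' c, η.pAC a c * η.pC c) :
    ∫ x, mFun a₁ a₀ η x ∂P = θ := by
  haveI := h.prob
  have hρ : ∀ a c, η.pAC a c * η.pC c = probAC P a c := fun a c => by
    rw [hAC, hC, h.pAC_mul_pC]
  have hAeq : ∀ a ∈ ({a₁, a₀} : Set 𝒜), (trueNuisance P).pA a / η.pA a = 1 := fun a ha => by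
    rw [hA a ha]
    simp_rw [hρ]
    rw [(hasSum_probAC a).tsum_eq, div_self (h.pA_pos a).ne']
  have hgz : ∀ b ∈ ({a₁, a₀} : Set 𝒜), HasSum (fun z => gReg η z * (trueNuisance P).pZ z b)
      (∑' q : 𝒜 × 𝒵 × 𝒞, (trueNuisance P).EY q.1 q.2.1 q.2.2 * probAC P q.1 q.2.2 *
        (trueNuisance P).pZ q.2.1 b) := by
    intro b hb
    have s := (equivZAC 𝒜 𝒵 𝒞).summable_iff.2 (h.summable b hb)
    have t := s.hasSum.prod_fiberwise fun z => (s.prod_factor z).hasSum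
    rw [Function.comp_def, Equiv.tsum_eq (equivZAC 𝒜 𝒵 𝒞) (fun q : 𝒜 × 𝒵 × 𝒞 =>
      (trueNuisance P).EY q.1 q.2.1 q.2.2 * probAC P q.1 q.2.2 *
        (trueNuisance P).pZ q.2.1 b)] at t
    refine t.congr_fun fun z => ?_
    simp only [equivZAC, Equiv.coe_fn_mk]
    rw [tsum_mul_right, gReg]
    congr 1
    refine tsum_congr fun q => ?_
    rw [mul_assoc, hρ, hE]
  have sT := h.hasSum_mTreat hη fun b hb => (hgz b hb).summable
  have hhb : ∀ b ∈ ({a₁, a₀} : Set 𝒜), HasSum (fun q : 𝒜 × 𝒵 × 𝒞 =>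
      η.EY q.1 q.2.1 q.2.2 * probAC P q.1 q.2.2 * η.pZ q.2.1 b) (hReg η b) := by
    intro b hb
    refine (hη.total b hb).hasSum.congr_fun fun q => ?_
    rw [← hρ]; ring
  -- The regression summand is free of Z, so p(z|a) enters as a weight of total mass one. Its mean
  -- h(a₁) - h(a₀) cancels the terms -h(b) of the treatment summand, in which the mediator law may
  -- be wrong.
  have sR : HasSum (fun q : 𝒜 × 𝒵 × 𝒞 => mReg a₁ a₀ η q.1 q.2.2 * P.real (cell q))
      (hReg η a₁ - hReg η a₀) := by
    have s1 := (equivACZ 𝒜 𝒵 𝒞).hasSum_iff.2 ((hhb a₁ (by simp)).sub (hhb a₀ (by simp)))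
    have s2 := s1.prod_fiberwise fun p => (s1.summable.prod_factor p).hasSum
    have s3 := hasSum_mul_weight s2 (k := fun p z => (trueNuisance P).pZ z p.1)
      (fun p z => (h.pZ_pos z p.1).le) (fun p => h.hasSum_pZ p.1)
    rw [← (equivACZ 𝒜 𝒵 𝒞).hasSum_iff]
    refine s3.congr_fun fun p => ?_
    simp only [Function.comp_apply, equivACZ, Equiv.coe_fn_mk]
    rw [h.factor, mReg, mul_comm (a := (trueNuisance P).pZ _ _), ← mul_assoc, ← tsum_mul_right]
    congr 1
    refine tsum_congr fun z => ?_
    ring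
  rw [funext (mFun_eq a₁ a₀ η)] at hint ⊢
  have sI := h.hasSum_integral_affine (U := fun q => mSlope a₁ a₀ η q.1 q.2.1) hint
  have hθ := (h.summable a₁ (by simp)).hasSum.sub (h.summable a₀ (by simp)).hasSum
  simp_rw [← mul_sub] at hθ
  rw [hAeq a₁ (by simp), hAeq a₀ (by simp), (hgz a₁ (by simp)).tsum_eq,
    (hgz a₀ (by simp)).tsum_eq] at sT
  have sS := sT.add sR
  -- With the correct outcome regression the residual has mean zero on each cell, so only the other
  -- two summands contribute.
  have e := sI.unique (sS.congr_fun fun q => by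
    rw [mIntercept, hE]
    ring)
  rw [e, h.hasSum.unique hθ]
  ring

/-- `E m(X, η) = θ` when the mediator law is correct. -/
theorem ModelFacts.integral_mFun_of_mediator (h : ModelFacts a₁ a₀ P θ) [Nonempty 𝒵]
    [Nonempty 𝒞] {η : Nuisance 𝒜 𝒵 𝒞} (hη : SeriesConverge a₁ a₀ η)
    (hint : Integrable (mFun a₁ a₀ η) P) (hZ : η.pZ = (trueNuisance P).pZ) :
    ∫ x, mFun a₁ a₀ η x ∂P = θ := by
  haveI := h.prob
  have hgz : ∀ b ∈ ({a₁, a₀} : Set 𝒜), HasSum (fun z => gReg η z * (trueNuisance P).pZ z b)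
      (hReg η b) := by
    intro b hb
    have s := (equivZAC 𝒜 𝒵 𝒞).summable_iff.2 (hη.total b hb)
    have t := s.hasSum.prod_fiberwise fun z => (s.prod_factor z).hasSum
    rw [Function.comp_def, Equiv.tsum_eq (equivZAC 𝒜 𝒵 𝒞) (fun q : 𝒜 × 𝒵 × 𝒞 =>
      η.EY q.1 q.2.1 q.2.2 * η.pZ q.2.1 b * η.pAC q.1 q.2.2 * η.pC q.2.2)] at t
    refine t.congr_fun fun z => ?_
    simp only [equivZAC, Equiv.coe_fn_mk]
    rw [gReg, ← tsum_mul_right]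
    refine tsum_congr fun q => ?_
    rw [hZ]; ring
  have sT := h.hasSum_mTreat hη fun b hb => (hgz b hb).summable
  -- Under the true mediator law g averages to h, so the treatment summand has mean zero whatever
  -- the value of p̄(b).
  rw [(hgz a₁ (by simp)).tsum_eq, (hgz a₀ (by simp)).tsum_eq, sub_self, sub_self, mul_zero,
    mul_zero, sub_self] at sT
  rw [funext (mFun_eq a₁ a₀ η)] at hint ⊢
  have sI := h.hasSum_integral_affine (U := fun q => mSlope a₁ a₀ η q.1 q.2.1) hint
  generalize (∫ x, (mSlope a₁ a₀ η (cellOf x).1 (cellOf x).2.1 * x.out +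
    mIntercept a₁ a₀ η (cellOf x)) ∂P) = I at sI ⊢
  have sR := (sI.sub sT).sub h.hasSum
  -- Once the series of θ is subtracted, the true outcome regression disappears. What remains
  -- involves E̅ alone, and for fixed (a,c) the residual correction summed over z is the negative of
  -- the regression summand.
  have hfib : ∀ p : 𝒜 × 𝒞, HasSum (fun z => -(η.EY p.1 z p.2 *
      (η.pZ z a₁ - η.pZ z a₀) * probAC P p.1 p.2) +
      mReg a₁ a₀ η p.1 p.2 * probAC P p.1 p.2 * (trueNuisance P).pZ z p.1) 0 := by
    intro p
    have s1 := ((hη.over_z a₁ (by simp) p.1 p.2).sub (hη.over_z a₀ (by simp) p.1 p.2)).hasSum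
    simp_rw [← mul_sub] at s1
    have s2 := ((s1.mul_right (probAC P p.1 p.2)).neg).add
      ((h.hasSum_pZ p.1).mul_left (mReg a₁ a₀ η p.1 p.2 * probAC P p.1 p.2))
    rw [show (0 : ℝ) = -((∑' z, η.EY p.1 z p.2 * (η.pZ z a₁ - η.pZ z a₀)) * probAC P p.1 p.2) +
      mReg a₁ a₀ η p.1 p.2 * probAC P p.1 p.2 * 1 by rw [mReg]; ring]
    exact s2
  have sR' := (equivACZ 𝒜 𝒵 𝒞).hasSum_iff.2 sR
  have s0 : HasSum (fun p : (𝒜 × 𝒞) × 𝒵 =>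
      -(η.EY p.1.1 p.2 p.1.2 * (η.pZ p.2 a₁ - η.pZ p.2 a₀) * probAC P p.1.1 p.1.2) +
      mReg a₁ a₀ η p.1.1 p.1.2 * probAC P p.1.1 p.1.2 * (trueNuisance P).pZ p.2 p.1.1) (I - 0 - θ) := by
    refine sR'.congr_fun fun p => ?_
    obtain ⟨⟨a, c⟩, z⟩ := p
    have hpz := (h.pZ_pos z a).ne'
    simp only [Function.comp_apply, equivACZ, Equiv.coe_fn_mk, h.factor, mIntercept, mSlope, hZ]
    field_simp
    ring
  have := (s0.prod_fiberwise hfib).unique hasSum_zero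
  linarith

end Expectation

end FDTD

namespace FDTD

/-! ### Stochastic convergence of sample averages -/

section Averages
variable {𝒳 : Type*} [MeasurableSpace 𝒳] {P : Measure 𝒳} [IsProbabilityMeasure P]

/-- The sample spaces change with n, whereas the strong law lives on one infinite product; this
projection carries deviation probabilities from one to the other. -/
theorem map_infinitePi_fin (n : ℕ) :
    (Measure.infinitePi fun _ : ℕ => P).map (fun ω (i : Fin n) => ω i) =
      Measure.pi fun _ : Fin n => P := by
  have h := iIndepFun_infinitePi (P := fun _ : ℕ => P) (X := fun _ x => x)
    (fun _ => measurable_id)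
  have h2 := h.precomp (g := (Fin.val : Fin n → ℕ)) Fin.val_injective
  rw [iIndepFun_iff_map_fun_eq_pi_map (fun i => (measurable_pi_apply _).aemeasurable)] at h2
  rw [h2]
  congr 1
  funext i
  exact (measurePreserving_eval_infinitePi (fun _ : ℕ => P) i).map_eq

/-- The weak law of large numbers on finite product spaces. -/
theorem tendsto_measure_average_sub {g : 𝒳 → ℝ} (hg : Integrable g P) {ε : ℝ} (hε : 0 < ε) :
    Tendsto (fun n : ℕ => (Measure.pi fun _ : Fin n => P)
      {x | ε ≤ |1 / (n : ℝ) * ∑ i, g (x i) - ∫ y, g y ∂P|}) atTop (𝓝 0) := by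
  set Q := Measure.infinitePi fun _ : ℕ => P with hQ
  have hev : ∀ i : ℕ, MeasurePreserving (Function.eval i) Q P := fun i =>
    measurePreserving_eval_infinitePi (fun _ : ℕ => P) i
  -- A strongly measurable version of g makes the deviation event measurable, so that it can be
  -- pulled back to the infinite product.
  obtain ⟨g', hg'm, hgg'⟩ := hg.aestronglyMeasurable
  have hg' : Integrable g' P := hg.congr hgg'
  have hslln := strong_law_ae_real (μ := Q) (fun i ω => g' (ω i))
    ((hev 0).integrable_comp_of_integrable hg')
    (fun i j hij => (iIndepFun_infinitePi (P := fun _ : ℕ => P) (X := fun _ x => g' x)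
      (fun _ => hg'm.measurable)).indepFun hij)
    (fun i => by
      refine ⟨(hg'm.measurable.comp (measurable_pi_apply i)).aemeasurable,
        (hg'm.measurable.comp (measurable_pi_apply 0)).aemeasurable, ?_⟩
      have e : ∀ i : ℕ, Q.map (fun ω => g' (ω i)) = P.map g' := fun i => by
        rw [← (hev i).map_eq, Measure.map_map hg'm.measurable (hev i).measurable]
        rfl
      rw [e, e])
  have hint : ∫ ω, g' (ω 0) ∂Q = ∫ y, g' y ∂P := by
    rw [← (hev 0).map_eq, integral_map (hev 0).measurable.aemeasurable
      (by rw [(hev 0).map_eq]; exact hg'm.aestronglyMeasurable)]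
  rw [hint] at hslln
  have hmeas := tendstoInMeasure_of_tendsto_ae (fun n => by
    refine Measurable.aestronglyMeasurable ?_
    exact (Finset.measurable_fun_sum _ fun i _ =>
      hg'm.measurable.comp (measurable_pi_apply i)).div_const _) hslln
  have h0 := hmeas (ENNReal.ofReal ε) (by simpa using hε)
  refine h0.congr fun n => ?_
  have hae : ∀ᵐ x ∂(Measure.pi fun _ : Fin n => P), ∀ i, g (x i) = g' (x i) :=
    ae_all_iff.2 fun i =>
      (measurePreserving_eval (fun _ : Fin n => P) i).quasiMeasurePreserving.ae hgg'
  have hS : MeasurableSet {x : Fin n → 𝒳 | ε ≤ |1 / (n : ℝ) * ∑ i, g' (x i) - ∫ y, g' y ∂P|} := by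
    refine measurableSet_le measurable_const (Measurable.abs ?_)
    exact ((Finset.measurable_fun_sum _ fun i _ =>
      hg'm.measurable.comp (measurable_pi_apply i)).const_mul _).sub_const _
  have e1 : (Measure.pi fun _ : Fin n => P) {x | ε ≤ |1 / (n : ℝ) * ∑ i, g (x i) - ∫ y, g y ∂P|} =
      (Measure.pi fun _ : Fin n => P)
        {x | ε ≤ |1 / (n : ℝ) * ∑ i, g' (x i) - ∫ y, g' y ∂P|} := by
    refine measure_congr ?_
    filter_upwards [hae] with x hx
    simp only [eq_iff_iff]
    change (ε ≤ |1 / (n : ℝ) * ∑ i, g (x i) - ∫ y, g y ∂P|) ↔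
      (ε ≤ |1 / (n : ℝ) * ∑ i, g' (x i) - ∫ y, g' y ∂P|)
    simp_rw [hx, integral_congr_ae hgg']
  rw [e1, ← map_infinitePi_fin, Measure.map_apply
    (measurable_pi_lambda _ fun i => measurable_pi_apply _) hS]
  congr 1
  ext ω
  simp only [Set.mem_ofPred_eq, Set.mem_preimage]
  rw [edist_dist, ENNReal.ofReal_le_ofReal_iff dist_nonneg, Real.dist_eq,
    Fin.sum_univ_eq_sum_range (fun i => g' (ω i)), one_div, inv_mul_eq_div]

end Averages

/-! ### Averages over the sample and consistency of the plug-in estimator -/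

section SampleLaw
variable {𝒜 𝒵 𝒞 : Type u} [MeasurableSpace 𝒜] [MeasurableSpace 𝒵] [MeasurableSpace 𝒞]
  {P : Measure (Obs 𝒜 𝒵 𝒞)} [IsProbabilityMeasure P]

instance (n r : ℕ) : IsProbabilityMeasure (sampleLaw P n r) := by
  unfold sampleLaw; infer_instance

theorem sampleLaw_fst (n r : ℕ) (E : Set (Fin n → Obs 𝒜 𝒵 𝒞)) :
    sampleLaw P n r {s | s.1 ∈ E} = (Measure.pi fun _ : Fin n => P) E := by
  have : {s : Sample 𝒜 𝒵 𝒞 n r | s.1 ∈ E} = E ×ˢ Set.univ := by ext; simp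
  rw [this, sampleLaw, Measure.prod_prod, measure_univ, mul_one]

theorem ae_sampleLaw_forall {p : Obs 𝒜 𝒵 𝒞 → Prop} (hp : ∀ᵐ x ∂P, p x) (n r : ℕ) :
    ∀ᵐ s ∂(sampleLaw P n r), ∀ i, p (s.1 i) := by
  have hae : ∀ᵐ x ∂(Measure.pi fun _ : Fin n => P), ∀ i, p (x i) :=
    ae_all_iff.2 fun i =>
      (measurePreserving_eval (fun _ : Fin n => P) i).quasiMeasurePreserving.ae hp
  exact Measure.quasiMeasurePreserving_fst.ae hae

theorem isLittleOP_iff_real {S : ℕ → Type*} [∀ n, MeasurableSpace (S n)] {Q : ∀ n, Measure (S n)}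
    {f : ∀ n, S n → ℝ} : IsLittleOP Q (fun n s => ‖f n s‖ₑ) ↔
      ∀ ε : ℝ, 0 < ε → Tendsto (fun n => Q n {s | ε ≤ |f n s|}) atTop (𝓝 0) := by
  have e : ∀ (ε : ℝ), 0 < ε → ∀ n s, ENNReal.ofReal ε ≤ ‖f n s‖ₑ ↔ ε ≤ |f n s| := fun ε hε n s => by
    rw [← ofReal_norm, ENNReal.ofReal_le_ofReal_iff (norm_nonneg _), Real.norm_eq_abs]
  constructor
  · intro h ε hε
    refine (h (ENNReal.ofReal ε) (by simpa using hε)).congr fun n => ?_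
    simp_rw [e ε hε]
  · intro h ε hε
    -- The level ε = ∞ is never reached by the norm of a real number.
    rcases eq_or_ne ε ∞ with rfl | hfin
    · simp
    · have hpos : 0 < ε.toReal := ENNReal.toReal_pos hε hfin
      refine (h ε.toReal hpos).congr fun n => ?_
      simp_rw [← e _ hpos, ENNReal.ofReal_toReal hfin]

/-- Events contained, up to null sets, in a union of finitely many events of vanishing
probability. -/
theorem tendsto_measure_zero_of_ae_imp {S : ℕ → Type*} [∀ n, MeasurableSpace (S n)]
    {Q : ∀ n, Measure (S n)} {E : ∀ n, S n → Prop} {ι : Type*} [Fintype ι]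
    {F : ι → ∀ n, S n → Prop} (hF : ∀ i, Tendsto (fun n => Q n {s | F i n s}) atTop (𝓝 0))
    (h : ∀ᶠ n in atTop, ∀ᵐ s ∂(Q n), E n s → ∃ i, F i n s) :
    Tendsto (fun n => Q n {s | E n s}) atTop (𝓝 0) := by
  have hs : Tendsto (fun n => ∑ i, Q n {s | F i n s}) atTop (𝓝 0) := by
    simpa using tendsto_finsetSum Finset.univ fun i _ => hF i
  refine tendsto_of_tendsto_of_tendsto_of_le_of_le' tendsto_const_nhds hs
    (Eventually.of_forall fun n => zero_le) ?_
  filter_upwards [h] with n hn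
  calc Q n {s | E n s} ≤ Q n (⋃ i ∈ Finset.univ, {s | F i n s}) := by
        refine measure_mono_ae ?_
        filter_upwards [hn] with s hs hE
        obtain ⟨i, hi⟩ := hs hE
        exact Set.mem_biUnion (Finset.mem_coe.2 (Finset.mem_univ i)) hi
    _ ≤ _ := measure_biUnion_finset_le _ _

/-- The estimating equation is linear in θ, hence has an explicit solution. For n = 0 the empty
average makes every θ a solution. -/
theorem thetaHat_eq {a₁ a₀ : 𝒜} {n : ℕ} (hn : n ≠ 0) {η : Nuisance 𝒜 𝒵 𝒞} {θ : ℝ}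
    {x : Fin n → Obs 𝒜 𝒵 𝒞} (h : (1 / (n : ℝ)) * ∑ i, phi a₁ a₀ η θ (x i) = 0) :
    θ = 1 / (n : ℝ) * ∑ i, mFun a₁ a₀ η (x i) := by
  have hn' : (n : ℝ) ≠ 0 := by exact_mod_cast hn
  simp only [phi, Finset.sum_sub_distrib, Finset.sum_const, Finset.card_univ, Fintype.card_fin,
    nsmul_eq_mul] at h
  field_simp at h
  field_simp
  linarith

theorem opNorm_le_sum_single {k : ℕ} (L : (Fin k → ℝ) →L[ℝ] ℝ) {B : ℝ}
    (h : ∀ j, |L (Pi.single j 1)| ≤ B) (hB : 0 ≤ B) : ‖L‖ ≤ k * B := by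
  refine L.opNorm_le_bound (by positivity) fun v => ?_
  have e : L v = ∑ j, v j * L (Pi.single j 1) := by
    conv_lhs => rw [pi_eq_sum_univ' v]
    simp [map_sum]
  rw [e]
  calc ‖∑ j, v j * L (Pi.single j 1)‖ ≤ ∑ j, ‖v j * L (Pi.single j 1)‖ := norm_sum_le _ _
    _ ≤ ∑ _j : Fin k, ‖v‖ * B := by
        refine Finset.sum_le_sum fun j _ => ?_
        rw [norm_mul]
        exact mul_le_mul (norm_le_pi_norm v j) (h j) (norm_nonneg _) (norm_nonneg _)
    _ = k * B * ‖v‖ := by simp; ring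

/-- The plug-in average `Pₙ m(·, η(β̂))` converges in probability to `E m(X, η(β̄))`. -/
theorem isLittleOP_of_regularityConsistency {a₁ a₀ : 𝒜} {r : ℕ → ℕ} {θ : ℝ}
    {θhat : ∀ n, Sample 𝒜 𝒵 𝒞 n (r n) → ℝ} {k : ℕ} {N : (Fin k → ℝ) → Nuisance 𝒜 𝒵 𝒞}
    {βhat : ∀ n, Sample 𝒜 𝒵 𝒞 n (r n) → Fin k → ℝ} {b : Fin k → ℝ}
    (hθhat : ∀ n (s : Sample 𝒜 𝒵 𝒞 n (r n)), n ≠ 0 →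
      θhat n s = 1 / (n : ℝ) * ∑ i, mFun a₁ a₀ (N (βhat n s)) (s.1 i))
    (hβ : IsLittleOP (fun n => sampleLaw P n (r n)) (fun n s => ‖βhat n s - b‖ₑ))
    (hreg : RegularityConsistency a₁ a₀ P N b) (hθ : ∫ x, mFun a₁ a₀ (N b) x ∂P = θ) :
    IsLittleOP (fun n => sampleLaw P n (r n)) (fun n s => ‖θhat n s - θ‖ₑ) := by
  obtain ⟨U₁, hU₁, hdiff⟩ := hreg.differentiable
  obtain ⟨U₂, hU₂, M, hM, hdom⟩ := hreg.dominated
  obtain ⟨ρ, hρ, hball⟩ := Metric.mem_nhds_iff.1 (inter_mem hU₁ hU₂)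
  -- Mean value inequality on a ball inside both neighbourhoods; k bounded partial derivatives bound
  -- the operator norm for the sup norm on ℝᵏ.
  have hlip : ∀ᵐ x ∂P, ∀ β ∈ Metric.ball b ρ,
      |mFun a₁ a₀ (N β) x - mFun a₁ a₀ (N b) x| ≤ k * |M x| * ‖β - b‖ := by
    filter_upwards [hdiff, hdom] with x hx1 hx2 β hβ
    have := (convex_ball b ρ).norm_image_sub_le_of_norm_fderiv_le
      (f := fun β' => mFun a₁ a₀ (N β') x) (C := k * |M x|) (𝕜 := ℝ)
      (fun β hβ => hx1 β (hball hβ).1)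
      (fun β hβ => opNorm_le_sum_single _ (fun j => (hx2 β (hball hβ).2 j).trans (le_abs_self _))
        (abs_nonneg _)) (Metric.mem_ball_self hρ) hβ
    simpa only [Real.norm_eq_abs] using this
  rw [isLittleOP_iff_real]
  intro ε hε
  set I : ℝ := ∫ x, |M x| ∂P with hI
  have hI0 : 0 ≤ I := integral_nonneg fun x => abs_nonneg _
  -- Chosen so that k(I + 1)δ ≤ ε/2, where I + 1 bounds the average of |M| outside a rare event. The
  -- extra 1 in the denominator keeps it positive for k = 0.
  set δ : ℝ := min ρ (ε / 2 / (k * (I + 1) + 1)) with hδ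
  have hδ0 : 0 < δ := by positivity
  have hβ' : Tendsto (fun n => sampleLaw P n (r n) {s | δ ≤ ‖βhat n s - b‖}) atTop (𝓝 0) := by
    refine (hβ (ENNReal.ofReal δ) (by simpa using hδ0)).congr fun n => ?_
    simp_rw [← ofReal_norm, ENNReal.ofReal_le_ofReal_iff (norm_nonneg _)]
  have h1 : Tendsto (fun n => sampleLaw P n (r n)
      {s | ε / 2 ≤ |1 / (n : ℝ) * ∑ i, mFun a₁ a₀ (N b) (s.1 i) - θ|}) atTop (𝓝 0) := by
    refine (tendsto_measure_average_sub hreg.integrable_m (half_pos hε)).congr fun n => ?_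
    rw [← sampleLaw_fst n (r n), hθ]
    rfl
  have h2 : Tendsto (fun n => sampleLaw P n (r n)
      {s | 1 ≤ |1 / (n : ℝ) * ∑ i, |M (s.1 i)| - I|}) atTop (𝓝 0) := by
    refine (tendsto_measure_average_sub hM.abs one_pos).congr fun n => ?_
    rw [← sampleLaw_fst n (r n)]
    rfl
  refine tendsto_measure_zero_of_ae_imp (ι := Fin 3)
    (F := ![fun n s => δ ≤ ‖βhat n s - b‖,
      fun n s => ε / 2 ≤ |1 / (n : ℝ) * ∑ i, mFun a₁ a₀ (N b) (s.1 i) - θ|,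
      fun n s => 1 ≤ |1 / (n : ℝ) * ∑ i, |M (s.1 i)| - I|]) ?_ ?_
  · intro i
    fin_cases i
    exacts [hβ', h1, h2]
  · filter_upwards [eventually_ne_atTop 0] with n hn
    filter_upwards [ae_sampleLaw_forall hlip n (r n)] with s hs hE
    by_contra hcon
    push Not at hcon
    have c0 : ‖βhat n s - b‖ < δ := not_le.1 (hcon 0)
    have c1 : |1 / (n : ℝ) * ∑ i, mFun a₁ a₀ (N b) (s.1 i) - θ| < ε / 2 := not_le.1 (hcon 1)
    have c2 : |1 / (n : ℝ) * ∑ i, |M (s.1 i)| - I| < 1 := not_le.1 (hcon 2)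
    have hn0 : (0 : ℝ) < n := by exact_mod_cast Nat.pos_of_ne_zero hn
    have hmem : βhat n s ∈ Metric.ball b ρ := by
      rw [mem_ball_iff_norm]
      exact c0.trans_le (min_le_left _ _)
    have hav : |1 / (n : ℝ) * ∑ i, mFun a₁ a₀ (N (βhat n s)) (s.1 i) -
        1 / (n : ℝ) * ∑ i, mFun a₁ a₀ (N b) (s.1 i)| ≤
        k * (1 / (n : ℝ) * ∑ i, |M (s.1 i)|) * ‖βhat n s - b‖ := by
      rw [← mul_sub, ← Finset.sum_sub_distrib, abs_mul, abs_of_nonneg (by positivity)]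
      calc _ ≤ 1 / (n : ℝ) * ∑ i, k * |M (s.1 i)| * ‖βhat n s - b‖ := by
            gcongr
            exact (Finset.abs_sum_le_sum_abs _ _).trans
              (Finset.sum_le_sum fun i _ => hs i _ hmem)
        _ = _ := by rw [← Finset.sum_mul, ← Finset.mul_sum]; ring
    have hMI : 1 / (n : ℝ) * ∑ i, |M (s.1 i)| ≤ I + 1 := by
      linarith [(abs_lt.1 c2).2]
    have hb : k * (1 / (n : ℝ) * ∑ i, |M (s.1 i)|) * ‖βhat n s - b‖ ≤ ε / 2 := by
      have hden : 0 < k * (I + 1) + 1 := by positivity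
      calc _ ≤ k * (I + 1) * (ε / 2 / (k * (I + 1) + 1)) := by
            gcongr
            exact c0.le.trans (min_le_right _ _)
        _ ≤ (k * (I + 1) + 1) * (ε / 2 / (k * (I + 1) + 1)) := by
            gcongr; linarith
        _ = ε / 2 := by field_simp
    rw [hθhat n s hn] at hE
    have tri := abs_add_le (1 / (n : ℝ) * ∑ i, mFun a₁ a₀ (N (βhat n s)) (s.1 i) -
        1 / (n : ℝ) * ∑ i, mFun a₁ a₀ (N b) (s.1 i))
      (1 / (n : ℝ) * ∑ i, mFun a₁ a₀ (N b) (s.1 i) - θ)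
    rw [sub_add_sub_cancel] at tri
    linarith

end SampleLaw

end FDTD

namespace FDTD

/-! ### Finiteness of the supports under positivity bounded away from zero -/

/-- The terms of a summable family tend to zero along the cofinite filter, so only finitely many of
them exceed ε. -/
theorem finite_of_summable_of_lt {ι : Type*} {f : ι → ℝ} (hf : Summable f) {ε : ℝ} (hε : 0 < ε)
    (h : ∀ i, ε < f i) : Finite ι := by
  have h1 := hf.tendsto_cofinite_zero.eventually (gt_mem_nhds hε)
  have h2 : {i | ¬ f i < ε} = Set.univ := Set.eq_univ_of_forall fun i => not_lt.2 (h i).le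
  rw [Filter.eventually_cofinite, h2] at h1
  exact Set.finite_univ_iff.1 h1

section Cellwise
variable {𝒜 𝒵 𝒞 : Type u} [MeasurableSpace 𝒜] [MeasurableSpace 𝒵] [MeasurableSpace 𝒞]
  [DiscreteMeasurableSpace 𝒜] [DiscreteMeasurableSpace 𝒵] [DiscreteMeasurableSpace 𝒞]
  [Countable 𝒜] [Countable 𝒵] [Countable 𝒞]
  {a₁ a₀ : 𝒜} {P : Measure (Obs 𝒜 𝒵 𝒞)} {θ : ℝ}

/-- A property of the cell that holds almost surely holds for every cell. -/
theorem ModelFacts.forall_of_ae (h : ModelFacts a₁ a₀ P θ) {p : 𝒜 × 𝒵 × 𝒞 → Prop}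
    (hp : ∀ᵐ x ∂P, p (cellOf x)) (q : 𝒜 × 𝒵 × 𝒞) : p q := by
  by_contra hq
  have h0 : P (cell q) = 0 := by
    refine measure_mono_null (fun x hx => ?_) hp
    rw [cell_eq_preimage] at hx
    have : cellOf x = q := hx
    simpa [this] using hq
  have := h.pos q
  rw [measureReal_def, h0] at this
  simp at this

/-- The families p(·|c), p(·|a) and p(·) are summable, yet the boundedness assumptions keep every
one of their terms above a positive constant, because each cell carries mass. -/
theorem ModelFacts.finite_types (h : ModelFacts a₁ a₀ P θ) [Nonempty 𝒜] [Nonempty 𝒵] [Nonempty 𝒞]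
    {r : ℕ → ℕ} {ηhat : ∀ n, Sample 𝒜 𝒵 𝒞 n (r n) → Nuisance 𝒜 𝒵 𝒞}
    (hb : Boundedness a₁ a₀ P r ηhat) : Finite 𝒜 ∧ Finite 𝒵 ∧ Finite 𝒞 := by
  haveI := h.prob
  obtain ⟨a⟩ := ‹Nonempty 𝒜›
  obtain ⟨z⟩ := ‹Nonempty 𝒵›
  obtain ⟨c⟩ := ‹Nonempty 𝒞›
  obtain ⟨ε₂, hε₂, h₂⟩ := hb.pZ_true
  obtain ⟨ε₅, hε₅, h₅⟩ := hb.pAC_true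
  obtain ⟨ε₈, hε₈, h₈⟩ := hb.pC_true
  refine ⟨?_, ?_, ?_⟩
  · refine finite_of_summable_of_lt (f := fun a' => (trueNuisance P).pAC a' c) ?_ hε₅
      fun a' => h.forall_of_ae (p := fun q => ε₅ < (trueNuisance P).pAC q.1 q.2.2) h₅ (a', z, c)
    have h1 := hasSum_setIntegral_preimage (μ := P) measurable_trt (measurableSet_cov c)
      (f := fun _ => (1 : ℝ)) (integrable_const _).integrableOn
    simp only [setIntegral_const, smul_eq_mul, mul_one] at h1
    exact (h1.div_const (P.real {x | x.cov = c})).summable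
  · exact finite_of_summable_of_lt (f := fun z' => (trueNuisance P).pZ z' a)
      (h.hasSum_pZ a).summable hε₂
      fun z' => h.forall_of_ae (p := fun q => ε₂ < (trueNuisance P).pZ q.2.1 q.1) h₂ (a, z', c)
  · refine finite_of_summable_of_lt (f := fun c' => (trueNuisance P).pC c') ?_ hε₈
      fun c' => h.forall_of_ae (p := fun q => ε₈ < (trueNuisance P).pC q.2.2) h₈ (a, z, c')
    have h1 := hasSum_setIntegral_preimage (μ := P) measurable_cov MeasurableSet.univ
      (f := fun _ => (1 : ℝ)) (integrable_const _).integrableOn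
    simp only [setIntegral_const, smul_eq_mul, mul_one, Set.inter_univ] at h1
    exact h1.summable

end Cellwise

/-! ### The bias of the estimating function for finite supports -/

section Finite
variable {𝒜 𝒵 𝒞 : Type u} [MeasurableSpace 𝒜] [MeasurableSpace 𝒵] [MeasurableSpace 𝒞]
  [DiscreteMeasurableSpace 𝒜] [DiscreteMeasurableSpace 𝒵] [DiscreteMeasurableSpace 𝒞]
  [Fintype 𝒜] [Fintype 𝒵] [Fintype 𝒞]
  {a₁ a₀ : 𝒜} {P : Measure (Obs 𝒜 𝒵 𝒞)} {θ : ℝ}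

theorem seriesConverge_of_finite (η : Nuisance 𝒜 𝒵 𝒞) : SeriesConverge a₁ a₀ η :=
  ⟨fun _ _ => Summable.of_finite, fun _ => Summable.of_finite, fun _ _ _ _ => Summable.of_finite⟩

theorem measurable_cellwise (U : 𝒜 × 𝒵 × 𝒞 → ℝ) :
    Measurable fun x : Obs 𝒜 𝒵 𝒞 => U (cellOf x) :=
  (Measurable.of_discrete (f := U)).comp measurable_cellOf

theorem exists_bound_cellwise (U : 𝒜 × 𝒵 × 𝒞 → ℝ) : ∃ C, ∀ q, ‖U q‖ ≤ C :=
  ⟨∑ q, ‖U q‖, fun q => Finset.single_le_sum (f := fun q => ‖U q‖)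
    (fun _ _ => norm_nonneg _) (Finset.mem_univ q)⟩

theorem measurable_affine (U W : 𝒜 × 𝒵 × 𝒞 → ℝ) :
    Measurable fun x : Obs 𝒜 𝒵 𝒞 => U (cellOf x) * x.out + W (cellOf x) :=
  ((measurable_cellwise U).mul measurable_out).add (measurable_cellwise W)

theorem memLp_affine [IsFiniteMeasure P] {p : ℝ≥0∞} (hY : MemLp Obs.out p P)
    (U W : 𝒜 × 𝒵 × 𝒞 → ℝ) :
    MemLp (fun x : Obs 𝒜 𝒵 𝒞 => U (cellOf x) * x.out + W (cellOf x)) p P := by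
  obtain ⟨C, hC⟩ := exists_bound_cellwise U
  obtain ⟨C', hC'⟩ := exists_bound_cellwise W
  refine MemLp.add (f := fun x : Obs 𝒜 𝒵 𝒞 => U (cellOf x) * x.out) ?_ ?_
  · refine hY.of_le_mul (c := C) ((measurable_cellwise U).mul measurable_out).aestronglyMeasurable
      (Eventually.of_forall fun x => ?_)
    rw [norm_mul]
    exact mul_le_mul_of_nonneg_right (hC _) (norm_nonneg _)
  · exact MemLp.of_bound (measurable_cellwise W).aestronglyMeasurable C'
      (Eventually.of_forall fun x => hC' _)

theorem ModelFacts.integrable_affine (h : ModelFacts a₁ a₀ P θ) (U W : 𝒜 × 𝒵 × 𝒞 → ℝ) :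
    Integrable (fun x : Obs 𝒜 𝒵 𝒞 => U (cellOf x) * x.out + W (cellOf x)) P := by
  haveI := h.prob
  exact memLp_one_iff_integrable.1 (memLp_affine (memLp_one_iff_integrable.2 h.integrable_out) U W)

theorem ModelFacts.integrable_mFun (h : ModelFacts a₁ a₀ P θ) (η : Nuisance 𝒜 𝒵 𝒞) :
    Integrable (mFun a₁ a₀ η) P := by
  rw [funext (mFun_eq a₁ a₀ η)]
  exact h.integrable_affine (fun q => mSlope a₁ a₀ η q.1 q.2.1) (mIntercept a₁ a₀ η)

theorem sum_cells {f : 𝒜 × 𝒵 × 𝒞 → ℝ} : ∑ q, f q = ∑ z, ∑ p : 𝒜 × 𝒞, f (p.1, z, p.2) := by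
  rw [← (equivZAC 𝒜 𝒵 𝒞).sum_comp, Fintype.sum_prod_type]
  rfl

/-- `∑_{a,c} E(Y | a, z, c) p(a, c)` -/
noncomputable def outcomeReg (P : Measure (Obs 𝒜 𝒵 𝒞)) (z : 𝒵) : ℝ :=
  ∑ p : 𝒜 × 𝒞, (trueNuisance P).EY p.1 z p.2 * probAC P p.1 p.2

/-- The exact bias of the estimating function. -/
theorem ModelFacts.integral_mFun_sub (h : ModelFacts a₁ a₀ P θ) [Nonempty 𝒵] [Nonempty 𝒞]
    (η : Nuisance 𝒜 𝒵 𝒞) (hZ : ∀ z a, η.pZ z a ≠ 0) (hA : ∀ b ∈ ({a₁, a₀} : Set 𝒜), η.pA b ≠ 0) :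
    ∫ x, mFun a₁ a₀ η x ∂P - θ =
      (∑ q : 𝒜 × 𝒵 × 𝒞, ((trueNuisance P).EY q.1 q.2.1 q.2.2 - η.EY q.1 q.2.1 q.2.2) *
        mSlope a₁ a₀ η q.1 q.2.1 * probAC P q.1 q.2.2 *
        ((trueNuisance P).pZ q.2.1 q.1 - η.pZ q.2.1 q.1)) +
      (∑ z, (η.pZ z a₁ - (trueNuisance P).pZ z a₁) * (outcomeReg P z - gReg η z -
        gReg η z * ((trueNuisance P).pA a₁ - η.pA a₁) / η.pA a₁)) -
      (∑ z, (η.pZ z a₀ - (trueNuisance P).pZ z a₀) * (outcomeReg P z - gReg η z -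
        gReg η z * ((trueNuisance P).pA a₀ - η.pA a₀) / η.pA a₀)) := by
  haveI := h.prob
  have hη := seriesConverge_of_finite (a₁ := a₁) (a₀ := a₀) η
  have hm : ∫ x, mFun a₁ a₀ η x ∂P = ∑ q : 𝒜 × 𝒵 × 𝒞, (mSlope a₁ a₀ η q.1 q.2.1 *
      (trueNuisance P).EY q.1 q.2.1 q.2.2 + mIntercept a₁ a₀ η q) * P.real (cell q) := by
    have hint := h.integrable_affine (fun q => mSlope a₁ a₀ η q.1 q.2.1) (mIntercept a₁ a₀ η)
    have s := (h.hasSum_integral_affine (U := fun q => mSlope a₁ a₀ η q.1 q.2.1) hint).tsum_eq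
    rw [tsum_fintype] at s
    simp_rw [mFun_eq]
    exact s.symm
  have hθ : θ = ∑ z, outcomeReg P z * ((trueNuisance P).pZ z a₁ - (trueNuisance P).pZ z a₀) := by
    rw [← h.hasSum.tsum_eq, tsum_fintype, sum_cells]
    simp_rw [outcomeReg, Finset.sum_mul]
  have hT : ∑ q : 𝒜 × 𝒵 × 𝒞, mTreat a₁ a₀ η q.1 q.2.1 * P.real (cell q) =
      ((trueNuisance P).pA a₁ / η.pA a₁ *
          (∑ z, gReg η z * ((trueNuisance P).pZ z a₁ - η.pZ z a₁))) -
        (trueNuisance P).pA a₀ / η.pA a₀ *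
          (∑ z, gReg η z * ((trueNuisance P).pZ z a₀ - η.pZ z a₀)) := by
    have hh : ∀ b, hReg η b = ∑ z, gReg η z * η.pZ z b := fun b => by
      rw [hReg, tsum_fintype, sum_cells]
      simp_rw [gReg, tsum_fintype, Finset.sum_mul]
      refine Finset.sum_congr rfl fun z _ => Finset.sum_congr rfl fun p _ => ?_
      ring
    have s := h.hasSum_mTreat hη fun b _ => Summable.of_finite
    have s' := s.tsum_eq
    rw [tsum_fintype] at s'
    rw [s', hh, hh, tsum_fintype, tsum_fintype]
    simp_rw [mul_sub, Finset.sum_sub_distrib, mul_sub]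
  have hR : ∑ q : 𝒜 × 𝒵 × 𝒞, mReg a₁ a₀ η q.1 q.2.2 * P.real (cell q) =
      ∑ q : 𝒜 × 𝒵 × 𝒞, η.EY q.1 q.2.1 q.2.2 * probAC P q.1 q.2.2 *
        (η.pZ q.2.1 a₁ - η.pZ q.2.1 a₀) := by
    rw [← (equivACZ 𝒜 𝒵 𝒞).sum_comp, ← (equivACZ 𝒜 𝒵 𝒞).sum_comp]
    refine (Fintype.sum_prod_type _).trans
      ((Finset.sum_congr rfl fun p _ => ?_).trans (Fintype.sum_prod_type _).symm)
    simp only [equivACZ, Equiv.coe_fn_mk, h.factor, mReg, tsum_fintype]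
    have h1 : ∑ z, (trueNuisance P).pZ z p.1 = 1 := by
      have s := (h.hasSum_pZ p.1).tsum_eq
      rwa [tsum_fintype] at s
    rw [← Finset.mul_sum, ← Finset.sum_mul, h1, one_mul, Finset.sum_mul]
    refine Finset.sum_congr rfl fun z _ => ?_
    ring
  have hS : ∑ q : 𝒜 × 𝒵 × 𝒞, (mSlope a₁ a₀ η q.1 q.2.1 *
      ((trueNuisance P).EY q.1 q.2.1 q.2.2 - η.EY q.1 q.2.1 q.2.2)) * P.real (cell q) =
      (∑ q : 𝒜 × 𝒵 × 𝒞, ((trueNuisance P).EY q.1 q.2.1 q.2.2 - η.EY q.1 q.2.1 q.2.2) *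
        mSlope a₁ a₀ η q.1 q.2.1 * probAC P q.1 q.2.2 *
        ((trueNuisance P).pZ q.2.1 q.1 - η.pZ q.2.1 q.1)) +
      ∑ q : 𝒜 × 𝒵 × 𝒞, ((trueNuisance P).EY q.1 q.2.1 q.2.2 - η.EY q.1 q.2.1 q.2.2) *
        probAC P q.1 q.2.2 * (η.pZ q.2.1 a₁ - η.pZ q.2.1 a₀) := by
    rw [← Finset.sum_add_distrib]
    refine Finset.sum_congr rfl fun q _ => ?_
    obtain ⟨a, z, c⟩ := q
    have := hZ z a
    simp only [h.factor, mSlope]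
    field_simp
    ring
  have hE : ∑ q : 𝒜 × 𝒵 × 𝒞, (trueNuisance P).EY q.1 q.2.1 q.2.2 * probAC P q.1 q.2.2 *
      (η.pZ q.2.1 a₁ - η.pZ q.2.1 a₀) = ∑ z, outcomeReg P z * (η.pZ z a₁ - η.pZ z a₀) := by
    rw [sum_cells]
    simp_rw [outcomeReg, Finset.sum_mul]
  have hsplit : ∑ q : 𝒜 × 𝒵 × 𝒞, (mSlope a₁ a₀ η q.1 q.2.1 *
      (trueNuisance P).EY q.1 q.2.1 q.2.2 + mIntercept a₁ a₀ η q) * P.real (cell q) =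
      ∑ q : 𝒜 × 𝒵 × 𝒞, (mSlope a₁ a₀ η q.1 q.2.1 *
      ((trueNuisance P).EY q.1 q.2.1 q.2.2 - η.EY q.1 q.2.1 q.2.2)) * P.real (cell q) +
      ∑ q : 𝒜 × 𝒵 × 𝒞, mTreat a₁ a₀ η q.1 q.2.1 * P.real (cell q) +
      ∑ q : 𝒜 × 𝒵 × 𝒞, mReg a₁ a₀ η q.1 q.2.2 * P.real (cell q) := by
    rw [← Finset.sum_add_distrib, ← Finset.sum_add_distrib]
    refine Finset.sum_congr rfl fun q _ => ?_
    rw [mIntercept]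
    ring
  have hE2 : ∑ q : 𝒜 × 𝒵 × 𝒞, ((trueNuisance P).EY q.1 q.2.1 q.2.2 - η.EY q.1 q.2.1 q.2.2) *
        probAC P q.1 q.2.2 * (η.pZ q.2.1 a₁ - η.pZ q.2.1 a₀) =
      (∑ z, outcomeReg P z * (η.pZ z a₁ - η.pZ z a₀)) -
      ∑ q : 𝒜 × 𝒵 × 𝒞, η.EY q.1 q.2.1 q.2.2 * probAC P q.1 q.2.2 *
        (η.pZ q.2.1 a₁ - η.pZ q.2.1 a₀) := by
    rw [← hE, ← Finset.sum_sub_distrib]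
    refine Finset.sum_congr rfl fun q _ => ?_
    ring
  -- By p(b)/p̂(b) = 1 + (p(b) - p̂(b))/p̂(b), the error of p(Z|b) multiplies both the error of g
  -- and that of p(b).
  have hb : ∀ b ∈ ({a₁, a₀} : Set 𝒜), ∑ z, (η.pZ z b - (trueNuisance P).pZ z b) *
      (outcomeReg P z - gReg η z - gReg η z * ((trueNuisance P).pA b - η.pA b) / η.pA b) =
      (∑ z, outcomeReg P z * (η.pZ z b - (trueNuisance P).pZ z b)) +
      (trueNuisance P).pA b / η.pA b *
        ∑ z, gReg η z * ((trueNuisance P).pZ z b - η.pZ z b) := by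
    intro b hb
    have := hA b hb
    rw [Finset.mul_sum, ← Finset.sum_add_distrib]
    refine Finset.sum_congr rfl fun z _ => ?_
    field_simp
    ring
  have hcomb : (∑ z, outcomeReg P z * (η.pZ z a₁ - η.pZ z a₀)) -
      ∑ z, outcomeReg P z * ((trueNuisance P).pZ z a₁ - (trueNuisance P).pZ z a₀) =
      (∑ z, outcomeReg P z * (η.pZ z a₁ - (trueNuisance P).pZ z a₁)) -
      ∑ z, outcomeReg P z * (η.pZ z a₀ - (trueNuisance P).pZ z a₀) := by
    rw [← Finset.sum_sub_distrib, ← Finset.sum_sub_distrib]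
    refine Finset.sum_congr rfl fun z _ => ?_
    ring
  rw [hm, hsplit, hS, hT, hR, hE2, hθ, hb a₁ (by simp), hb a₀ (by simp)]
  linarith

/-- Uniform bounds on the values of a nuisance function. -/
structure NuisanceBound (a₁ a₀ : 𝒜) (η : Nuisance 𝒜 𝒵 𝒞) (K : ℝ) : Prop where
  EY : ∀ q : 𝒜 × 𝒵 × 𝒞, |η.EY q.1 q.2.1 q.2.2| ≤ K
  pZ : ∀ b ∈ ({a₁, a₀} : Set 𝒜), ∀ z, |η.pZ z b| ≤ K
  pZ_pos : ∀ z a, 0 < η.pZ z a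
  pZ_inv : ∀ z a, (η.pZ z a)⁻¹ ≤ K
  pA_pos : ∀ b ∈ ({a₁, a₀} : Set 𝒜), 0 < η.pA b
  pA_inv : ∀ b ∈ ({a₁, a₀} : Set 𝒜), (η.pA b)⁻¹ ≤ K
  pAC : ∀ a c, |η.pAC a c| ≤ K
  pC : ∀ c, |η.pC c| ≤ K

/-- Uniform distances between two nuisance functions. -/
structure NuisanceDist (a₁ a₀ : 𝒜) (η η' : Nuisance 𝒜 𝒵 𝒞) (dE dZA dAC dC : ℝ) (dZ dA : 𝒜 → ℝ) :
    Prop where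
  EY : ∀ q : 𝒜 × 𝒵 × 𝒞, |η.EY q.1 q.2.1 q.2.2 - η'.EY q.1 q.2.1 q.2.2| ≤ dE
  pZA : ∀ z a, |η.pZ z a - η'.pZ z a| ≤ dZA
  pAC : ∀ a c, |η.pAC a c - η'.pAC a c| ≤ dAC
  pC : ∀ c, |η.pC c - η'.pC c| ≤ dC
  pZ : ∀ b ∈ ({a₁, a₀} : Set 𝒜), ∀ z, |η.pZ z b - η'.pZ z b| ≤ dZ b
  pA : ∀ b ∈ ({a₁, a₀} : Set 𝒜), |η.pA b - η'.pA b| ≤ dA b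

/-- The bias is bounded by products of errors. -/
theorem ModelFacts.abs_bias_le (h : ModelFacts a₁ a₀ P θ) [Nonempty 𝒜] [Nonempty 𝒵] [Nonempty 𝒞]
    {K : ℝ} (hK : 1 ≤ K) : ∃ B : ℝ, 0 ≤ B ∧ B = Fintype.card (𝒜 × 𝒵 × 𝒞) * (2 * K ^ 4 *
      Fintype.card (𝒜 × 𝒞)) ∧ ∀ (η : Nuisance 𝒜 𝒵 𝒞) (dE dZA dAC dC : ℝ) (dZ dA : 𝒜 → ℝ),
      NuisanceBound a₁ a₀ η K → NuisanceDist a₁ a₀ η (trueNuisance P) dE dZA dAC dC dZ dA →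
      |∫ x, mFun a₁ a₀ η x ∂P - θ| ≤ B * (dE * dZA + dZ a₁ * (dE + dAC + dC + dA a₁) +
        dZ a₀ * (dE + dAC + dC + dA a₀)) := by
  haveI := h.prob
  -- The constant depends on K and the cardinalities only, not on P, so one constant serves a whole
  -- sequence of laws.
  refine ⟨_, by positivity, rfl, fun η dE dZA dAC dC dZ dA hB hD => ?_⟩
  obtain ⟨a⟩ := ‹Nonempty 𝒜›
  obtain ⟨z₀⟩ := ‹Nonempty 𝒵›
  obtain ⟨c⟩ := ‹Nonempty 𝒞›
  have hdE : 0 ≤ dE := (abs_nonneg _).trans (hD.EY (a, z₀, c))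
  have hdZA : 0 ≤ dZA := (abs_nonneg _).trans (hD.pZA z₀ a)
  have hdAC : 0 ≤ dAC := (abs_nonneg _).trans (hD.pAC a c)
  have hdC : 0 ≤ dC := (abs_nonneg _).trans (hD.pC c)
  have hdZ : ∀ b ∈ ({a₁, a₀} : Set 𝒜), 0 ≤ dZ b := fun b hb => (abs_nonneg _).trans (hD.pZ b hb z₀)
  have hdA : ∀ b ∈ ({a₁, a₀} : Set 𝒜), 0 ≤ dA b := fun b hb => (abs_nonneg _).trans (hD.pA b hb)
  have hK0 : 0 ≤ K := zero_le_one.trans hK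
  have hρ1 : ∀ a c, probAC P a c ≤ 1 := fun a c => measureReal_le_one
  have hρ0 : ∀ a c, 0 ≤ probAC P a c := fun a c => measureReal_nonneg
  have hC1 : ∀ c, (trueNuisance P).pC c ≤ 1 := fun c => measureReal_le_one
  have hC0 : ∀ c, 0 ≤ (trueNuisance P).pC c := fun c => measureReal_nonneg
  have hnAC : (1 : ℝ) ≤ Fintype.card (𝒜 × 𝒞) := by
    haveI : Nonempty (𝒜 × 𝒞) := ⟨(a, c)⟩
    exact_mod_cast Fintype.card_pos
  have hslope : ∀ a z, |mSlope a₁ a₀ η a z| ≤ 2 * K * K := fun a z => by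
    rw [mSlope, div_eq_mul_inv, abs_mul, abs_of_pos (inv_pos.2 (hB.pZ_pos z a))]
    refine mul_le_mul ?_ (hB.pZ_inv z a) (inv_pos.2 (hB.pZ_pos z a)).le (by positivity)
    exact (abs_sub _ _).trans (by linarith [hB.pZ a₁ (by simp) z, hB.pZ a₀ (by simp) z])
  have hg : ∀ z, |gReg η z| ≤ Fintype.card (𝒜 × 𝒞) * K ^ 3 := fun z => by
    rw [gReg, tsum_fintype]
    refine (Finset.abs_sum_le_sum_abs _ _).trans ?_
    rw [← nsmul_eq_mul, ← Finset.card_univ]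
    refine Finset.sum_le_card_nsmul _ _ _ fun p _ => ?_
    rw [abs_mul, abs_mul, pow_succ, pow_two]
    gcongr
    exacts [hB.EY (p.1, z, p.2), hB.pAC _ _, hB.pC _]
  have hgd : ∀ z, |outcomeReg P z - gReg η z| ≤
      Fintype.card (𝒜 × 𝒞) * (K ^ 2 * (dE + dAC + dC)) := fun z => by
    rw [gReg, tsum_fintype, outcomeReg, ← Finset.sum_sub_distrib]
    refine (Finset.abs_sum_le_sum_abs _ _).trans ?_
    rw [← nsmul_eq_mul, ← Finset.card_univ]
    refine Finset.sum_le_card_nsmul _ _ _ fun p _ => ?_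
    -- Since p(a,c) = p(a|c) p(c), this is a difference of triple products; it telescopes by
    -- changing one factor at a time.
    have e : (trueNuisance P).EY p.1 z p.2 * probAC P p.1 p.2 -
        η.EY p.1 z p.2 * η.pAC p.1 p.2 * η.pC p.2 =
        -((η.EY p.1 z p.2 - (trueNuisance P).EY p.1 z p.2) * probAC P p.1 p.2 +
          η.EY p.1 z p.2 * (η.pAC p.1 p.2 - (trueNuisance P).pAC p.1 p.2) *
            (trueNuisance P).pC p.2 +
          η.EY p.1 z p.2 * η.pAC p.1 p.2 * (η.pC p.2 - (trueNuisance P).pC p.2)) := by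
      rw [← h.pAC_mul_pC]
      ring
    rw [e, abs_neg]
    refine (abs_add_le _ _).trans ((add_le_add_left (abs_add_le _ _) _).trans ?_)
    rw [abs_mul, abs_mul, abs_mul, abs_mul, abs_mul, abs_of_nonneg (hρ0 _ _),
      abs_of_nonneg (hC0 _)]
    have t1 : |η.EY p.1 z p.2 - (trueNuisance P).EY p.1 z p.2| * probAC P p.1 p.2 ≤ dE * 1 :=
      mul_le_mul (hD.EY (p.1, z, p.2)) (hρ1 _ _) (hρ0 _ _) hdE
    have t2 : |η.EY p.1 z p.2| * |η.pAC p.1 p.2 - (trueNuisance P).pAC p.1 p.2| *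
        (trueNuisance P).pC p.2 ≤ K * dAC * 1 :=
      mul_le_mul (mul_le_mul (hB.EY (p.1, z, p.2)) (hD.pAC _ _) (abs_nonneg _) hK0) (hC1 _)
        (hC0 _) (by positivity)
    have t3 : |η.EY p.1 z p.2| * |η.pAC p.1 p.2| * |η.pC p.2 - (trueNuisance P).pC p.2| ≤
        K * K * dC :=
      mul_le_mul (mul_le_mul (hB.EY (p.1, z, p.2)) (hB.pAC _ _) (abs_nonneg _) hK0) (hD.pC _)
        (abs_nonneg _) (by positivity)
    have k1 : dE * 1 ≤ K ^ 2 * dE := by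
      rw [mul_comm]; exact mul_le_mul_of_nonneg_right (one_le_pow₀ hK) hdE
    have k2 : K * dAC * 1 ≤ K ^ 2 * dAC := by
      rw [mul_one]; exact mul_le_mul_of_nonneg_right (by nlinarith) hdAC
    calc _ ≤ dE * 1 + K * dAC * 1 + K * K * dC := by linarith
      _ ≤ K ^ 2 * dE + K ^ 2 * dAC + K ^ 2 * dC := by linarith [sq K]
      _ = _ := by ring
  have hterm : ∀ b ∈ ({a₁, a₀} : Set 𝒜), |∑ z, (η.pZ z b - (trueNuisance P).pZ z b) *
      (outcomeReg P z - gReg η z - gReg η z * ((trueNuisance P).pA b - η.pA b) / η.pA b)| ≤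
      Fintype.card (𝒜 × 𝒵 × 𝒞) * (2 * K ^ 4 * Fintype.card (𝒜 × 𝒞)) *
        (dZ b * (dE + dAC + dC + dA b)) := by
    intro b hb
    have hcard : (Fintype.card 𝒵 : ℝ) ≤ Fintype.card (𝒜 × 𝒵 × 𝒞) := by
      have : Function.Injective fun z : 𝒵 => (a, z, c) := fun z z' hz => by simpa using hz
      exact_mod_cast Fintype.card_le_of_injective _ this
    refine (Finset.abs_sum_le_sum_abs _ _).trans ?_
    have hz : ∀ z ∈ (Finset.univ : Finset 𝒵), |(η.pZ z b - (trueNuisance P).pZ z b) *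
        (outcomeReg P z - gReg η z - gReg η z * ((trueNuisance P).pA b - η.pA b) / η.pA b)| ≤
        2 * K ^ 4 * Fintype.card (𝒜 × 𝒞) * (dZ b * (dE + dAC + dC + dA b)) := by
      intro z _
      have hsecond : |gReg η z * ((trueNuisance P).pA b - η.pA b) / η.pA b| ≤
          Fintype.card (𝒜 × 𝒞) * K ^ 3 * dA b * K := by
        rw [div_eq_mul_inv, abs_mul, abs_mul, abs_of_pos (inv_pos.2 (hB.pA_pos b hb)), abs_sub_comm]
        exact mul_le_mul (mul_le_mul (hg z) (hD.pA b hb) (abs_nonneg _) (by positivity))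
          (hB.pA_inv b hb) (inv_pos.2 (hB.pA_pos b hb)).le
          (mul_nonneg (by positivity) (hdA b hb))
      -- The factor 2 is slack here; it comes from the residual term, where the slope is bounded by
      -- 2K², and lets both bounds share one constant.
      have hin : |outcomeReg P z - gReg η z -
          gReg η z * ((trueNuisance P).pA b - η.pA b) / η.pA b| ≤
          2 * K ^ 4 * Fintype.card (𝒜 × 𝒞) * (dE + dAC + dC + dA b) := by
        refine (abs_sub _ _).trans ((add_le_add (hgd z) hsecond).trans ?_)
        have hK24 : K ^ 2 ≤ K ^ 4 := pow_le_pow_right₀ hK (by norm_num)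
        have hdab := hdA b hb
        have : (0 : ℝ) ≤ dE + dAC + dC := by positivity
        calc _ ≤ Fintype.card (𝒜 × 𝒞) * (K ^ 4 * (dE + dAC + dC)) +
              Fintype.card (𝒜 × 𝒞) * K ^ 3 * dA b * K := by gcongr
          _ = Fintype.card (𝒜 × 𝒞) * K ^ 4 * (dE + dAC + dC + dA b) := by ring
          _ ≤ 2 * (Fintype.card (𝒜 × 𝒞) * K ^ 4 * (dE + dAC + dC + dA b)) := by
              have : 0 ≤ Fintype.card (𝒜 × 𝒞) * K ^ 4 * (dE + dAC + dC + dA b) := by positivity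
              linarith
          _ = _ := by ring
      rw [abs_mul]
      calc _ ≤ dZ b * (2 * K ^ 4 * Fintype.card (𝒜 × 𝒞) * (dE + dAC + dC + dA b)) :=
            mul_le_mul (hD.pZ b hb z) hin (abs_nonneg _) (hdZ b hb)
        _ = _ := by ring
    refine (Finset.sum_le_card_nsmul _ _ _ hz).trans ?_
    rw [nsmul_eq_mul, Finset.card_univ, mul_assoc (Fintype.card (𝒜 × 𝒵 × 𝒞) : ℝ)]
    refine mul_le_mul_of_nonneg_right hcard ?_
    have := hdA b hb
    have := hdZ b hb
    positivity
  have hfirst : |∑ q : 𝒜 × 𝒵 × 𝒞, ((trueNuisance P).EY q.1 q.2.1 q.2.2 - η.EY q.1 q.2.1 q.2.2) *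
        mSlope a₁ a₀ η q.1 q.2.1 * probAC P q.1 q.2.2 *
        ((trueNuisance P).pZ q.2.1 q.1 - η.pZ q.2.1 q.1)| ≤
      Fintype.card (𝒜 × 𝒵 × 𝒞) * (2 * K ^ 4 * Fintype.card (𝒜 × 𝒞)) * (dE * dZA) := by
    refine (Finset.abs_sum_le_sum_abs _ _).trans ?_
    refine (Finset.sum_le_card_nsmul _ _ (2 * K ^ 4 * Fintype.card (𝒜 × 𝒞) * (dE * dZA))
      fun q _ => ?_).trans ?_
    · rw [abs_mul, abs_mul, abs_mul, abs_of_nonneg (hρ0 _ _), abs_sub_comm,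
        abs_sub_comm ((trueNuisance P).pZ q.2.1 q.1)]
      have h24 : K * K ≤ K ^ 4 := by
        rw [← sq]; exact pow_le_pow_right₀ hK (by norm_num)
      calc _ ≤ dE * (2 * K * K) * 1 * dZA := by
            refine mul_le_mul (mul_le_mul (mul_le_mul (hD.EY q) (hslope _ _) (abs_nonneg _) hdE)
              (hρ1 _ _) (hρ0 _ _) (by positivity)) (hD.pZA _ _) (abs_nonneg _) (by positivity)
        _ = 2 * (K * K) * 1 * (dE * dZA) := by ring
        _ ≤ 2 * K ^ 4 * Fintype.card (𝒜 × 𝒞) * (dE * dZA) := by gcongr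
    · rw [nsmul_eq_mul, Finset.card_univ, mul_assoc (Fintype.card (𝒜 × 𝒵 × 𝒞) : ℝ)]
  rw [h.integral_mFun_sub η (fun z a => (hB.pZ_pos z a).ne') (fun b hb => (hB.pA_pos b hb).ne')]
  refine (abs_sub _ _).trans ((add_le_add_left (abs_add_le _ _) _).trans ?_)
  have u1 := hterm a₁ (by simp)
  have u0 := hterm a₀ (by simp)
  rw [mul_add, mul_add]
  linarith

end Finite

end FDTD

namespace FDTD

/-! ### Convergence to zero in probability -/

section InProb
variable {S : ℕ → Type*} [∀ n, MeasurableSpace (S n)] {Q : ∀ n, Measure (S n)}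

/-- `f n → 0` in probability. -/
def TendsZero (Q : ∀ n, Measure (S n)) (f : ∀ n, S n → ℝ) : Prop :=
  ∀ ε : ℝ, 0 < ε → Tendsto (fun n => Q n {s | ε ≤ |f n s|}) atTop (𝓝 0)

theorem TendsZero.of_le_whp {f g : ∀ n, S n → ℝ} (hg : TendsZero Q g) {E : ∀ n, S n → Prop}
    (hE : WithHighProb Q E) (h : ∀ᶠ n in atTop, ∀ᵐ s ∂(Q n), E n s → |f n s| ≤ |g n s|) :
    TendsZero Q f := by
  intro ε hε
  refine tendsto_measure_zero_of_ae_imp (ι := Fin 2)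
    (F := ![fun n s => ε ≤ |g n s|, fun n s => ¬ E n s]) ?_ ?_
  · intro i
    fin_cases i
    exacts [hg ε hε, hE]
  · filter_upwards [h] with n hn
    filter_upwards [hn] with s hs hf
    by_cases hEs : E n s
    · exact ⟨0, hf.trans (hs hEs)⟩
    · exact ⟨1, hEs⟩

theorem TendsZero.of_le {f g : ∀ n, S n → ℝ} (hg : TendsZero Q g)
    (h : ∀ᶠ n in atTop, ∀ᵐ s ∂(Q n), |f n s| ≤ |g n s|) : TendsZero Q f :=
  hg.of_le_whp (E := fun _ _ => True) (by simp [WithHighProb])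
    (h.mono fun _ hn => hn.mono fun _ hs _ => hs)

theorem TendsZero.add {f g : ∀ n, S n → ℝ} (hf : TendsZero Q f) (hg : TendsZero Q g) :
    TendsZero Q fun n s => f n s + g n s := by
  intro ε hε
  refine tendsto_measure_zero_of_ae_imp (ι := Fin 2)
    (F := ![fun n s => ε / 2 ≤ |f n s|, fun n s => ε / 2 ≤ |g n s|]) ?_ ?_
  · intro i
    fin_cases i
    exacts [hf _ (half_pos hε), hg _ (half_pos hε)]
  · refine Eventually.of_forall fun n => Eventually.of_forall fun s hs => ?_
    by_contra hcon
    push Not at hcon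
    have c0 : |f n s| < ε / 2 := not_le.1 (hcon 0)
    have c1 : |g n s| < ε / 2 := not_le.1 (hcon 1)
    linarith [abs_add_le (f n s) (g n s)]

theorem TendsZero.zero : TendsZero Q fun _ _ => 0 := by
  intro ε hε
  simp [not_le.2 hε]

theorem TendsZero.sum {J : Type*} (t : Finset J) {f : J → ∀ n, S n → ℝ}
    (hf : ∀ j, TendsZero Q (f j)) : TendsZero Q fun n s => ∑ j ∈ t, f j n s := by
  classical
  induction t using Finset.induction_on with
  | empty => simpa using TendsZero.zero
  | insert a t ha ih =>
    simp only [Finset.sum_insert ha]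
    exact (hf a).add ih

theorem TendsZero.const_mul {f : ∀ n, S n → ℝ} (hf : TendsZero Q f) (C : ℝ) :
    TendsZero Q fun n s => C * f n s := by
  intro ε hε
  rcases eq_or_ne C 0 with rfl | hC
  · simp [not_le.2 hε]
  · refine (hf (ε / |C|) (by positivity)).congr fun n => ?_
    simp_rw [abs_mul, div_le_iff₀' (abs_pos.2 hC)]

/-- o_p(1) · O_p(1) = o_p(1): choose a level M exceeded by g with small probability, uniformly in n,
and compare f with ε/M. -/
theorem TendsZero.mul_tight {f g : ∀ n, S n → ℝ} (hf : TendsZero Q f)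
    (hg : ∀ δ : ℝ≥0∞, δ ≠ 0 → ∃ M : ℝ, 0 < M ∧ ∀ n, Q n {s | M ≤ |g n s|} ≤ δ) :
    TendsZero Q fun n s => f n s * g n s := by
  intro ε hε
  rw [ENNReal.tendsto_nhds_zero]
  intro δ hδ
  obtain ⟨M, hM, hgM⟩ := hg (δ / 2) (ENNReal.half_pos hδ.ne').ne'
  filter_upwards [(ENNReal.tendsto_nhds_zero.1 (hf (ε / M) (by positivity))) (δ / 2)
    (ENNReal.half_pos hδ.ne')] with n hn
  calc Q n {s | ε ≤ |f n s * g n s|} ≤ Q n ({s | ε / M ≤ |f n s|} ∪ {s | M ≤ |g n s|}) := by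
        refine measure_mono fun s hs => ?_
        by_contra hcon
        simp only [Set.mem_union, Set.mem_ofPred_eq, not_or, not_le] at hcon hs
        rw [abs_mul] at hs
        have := mul_lt_mul'' hcon.1 hcon.2 (abs_nonneg _) (abs_nonneg _)
        rw [div_mul_cancel₀ _ hM.ne'] at this
        linarith
    _ ≤ δ / 2 + δ / 2 := (measure_union_le _ _).trans (add_le_add hn (hgM n))
    _ = δ := ENNReal.add_halves δ

theorem WithHighProb.and {E F : ∀ n, S n → Prop} (hE : WithHighProb Q E) (hF : WithHighProb Q F) :
    WithHighProb Q fun n s => E n s ∧ F n s := by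
  refine tendsto_measure_zero_of_ae_imp (ι := Fin 2)
    (F := ![fun n s => ¬ E n s, fun n s => ¬ F n s]) ?_ ?_
  · intro i
    fin_cases i
    exacts [hE, hF]
  · refine Eventually.of_forall fun n => Eventually.of_forall fun s hs => ?_
    by_cases h : E n s
    · exact ⟨1, fun hF => hs ⟨h, hF⟩⟩
    · exact ⟨0, h⟩

theorem WithHighProb.mono {E F : ∀ n, S n → Prop} (hE : WithHighProb Q E)
    (h : ∀ n s, E n s → F n s) : WithHighProb Q F :=
  tendsto_of_tendsto_of_tendsto_of_le_of_le tendsto_const_nhds hE (fun _ => zero_le)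
    fun n => measure_mono fun s hs hE' => hs (h n s hE')

end InProb

theorem eLpNorm_two_sq {𝒳 : Type*} [MeasurableSpace 𝒳] {P : Measure 𝒳} {f : 𝒳 → ℝ}
    (hf : MemLp f 2 P) : eLpNorm f 2 P ^ 2 = ENNReal.ofReal (∫ x, f x ^ 2 ∂P) := by
  rw [hf.eLpNorm_eq_integral_rpow_norm (by norm_num) (by norm_num),
    ← ENNReal.ofReal_pow (by positivity)]
  congr 1
  have hn : 0 ≤ ∫ x, f x ^ 2 ∂P := integral_nonneg fun x => sq_nonneg _
  simp only [ENNReal.toReal_ofNat, Real.rpow_ofNat, Real.norm_eq_abs, sq_abs]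
  rw [← Real.rpow_natCast, ← Real.rpow_mul hn]
  norm_num

/-! ### Empirical process terms -/

section Empirical
variable {𝒜 𝒵 𝒞 : Type u} [MeasurableSpace 𝒜] [MeasurableSpace 𝒵] [MeasurableSpace 𝒞]
  {P : Measure (Obs 𝒜 𝒵 𝒞)} [IsProbabilityMeasure P]

/-- `√n (Pₙ - P) g` -/
noncomputable def centredAverage (P : Measure (Obs 𝒜 𝒵 𝒞)) {n : ℕ} (g : Obs 𝒜 𝒵 𝒞 → ℝ)
    (x : Fin n → Obs 𝒜 𝒵 𝒞) : ℝ :=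
  √(n : ℝ) * (1 / (n : ℝ) * ∑ i, g (x i) - ∫ y, g y ∂P)

/-- Chebyshev's inequality: the variance of the sum is n Var g, and the factor √n leaves a bound
free of n, which is the tightness needed below. -/
theorem measure_centredAverage_ge_le {g : Obs 𝒜 𝒵 𝒞 → ℝ} (hg : MemLp g 2 P) {M : ℝ} (hM : 0 < M)
    (n r : ℕ) : sampleLaw P n r {s | M ≤ |centredAverage P g s.1|} ≤
      ENNReal.ofReal (Var[g; P] / M ^ 2) := by
  change sampleLaw P n r {s | s.1 ∈ {x | M ≤ |centredAverage P g x|}} ≤ _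
  rw [sampleLaw_fst]
  rcases Nat.eq_zero_or_pos n with rfl | hn
  · have : {x : Fin 0 → Obs 𝒜 𝒵 𝒞 | M ≤ |centredAverage P g x|} = ∅ := by
      ext x
      simp [centredAverage, hM]
    rw [this]
    simp
  have hn' : (0 : ℝ) < n := by exact_mod_cast hn
  have hev : ∀ i : Fin n, MeasurePreserving (Function.eval i) (Measure.pi fun _ : Fin n => P) P :=
    fun i => measurePreserving_eval (fun _ : Fin n => P) i
  have hmem : MemLp (∑ i : Fin n, fun x : Fin n → Obs 𝒜 𝒵 𝒞 => g (x i)) 2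
      (Measure.pi fun _ : Fin n => P) :=
    memLp_finsetSum' _ fun i _ => hg.comp_measurePreserving (hev i)
  have hvar : Var[∑ i : Fin n, fun x : Fin n → Obs 𝒜 𝒵 𝒞 => g (x i);
      Measure.pi fun _ : Fin n => P] = n * Var[g; P] := by
    rw [variance_sum_pi fun _ => hg]
    simp
  have hmean : ∫ x, (∑ i : Fin n, fun x : Fin n → Obs 𝒜 𝒵 𝒞 => g (x i)) x
      ∂(Measure.pi fun _ : Fin n => P) = n * ∫ y, g y ∂P := by
    simp only [Finset.sum_apply]
    rw [integral_finsetSum]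
    · have : ∀ i : Fin n, ∫ x, g (x i) ∂(Measure.pi fun _ : Fin n => P) = ∫ y, g y ∂P := fun i => by
        rw [← (hev i).map_eq, integral_map (hev i).measurable.aemeasurable
          (by rw [(hev i).map_eq]; exact hg.aestronglyMeasurable)]
        simp [(hev i).map_eq]
      simp [this]
    · exact fun i _ => (hg.comp_measurePreserving (hev i)).integrable one_le_two
  have h := meas_ge_le_variance_div_sq hmem (c := √(n : ℝ) * M) (by positivity)
  rw [hmean, hvar] at h
  have hs : √(n : ℝ) ^ 2 = n := Real.sq_sqrt hn'.le
  convert h using 2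
  · ext x
    have hs0 : 0 < √(n : ℝ) := Real.sqrt_pos.2 hn'
    have e : |∑ i : Fin n, g (x i) - n * ∫ y, g y ∂P| = √(n : ℝ) * |centredAverage P g x| := by
      have : ∑ i : Fin n, g (x i) - n * ∫ y, g y ∂P = √(n : ℝ) * centredAverage P g x := by
        rw [centredAverage, ← mul_assoc, ← sq, hs]
        field_simp
      rw [this, abs_mul, abs_of_pos hs0]
    simp only [Set.mem_ofPred_eq, Finset.sum_apply]
    rw [e, mul_le_mul_iff_right₀ hs0]
  · rw [mul_pow, hs]
    field_simp

theorem centredAverage_sum {J : Type*} [Fintype J] {g : J → Obs 𝒜 𝒵 𝒞 → ℝ}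
    (hg : ∀ j, Integrable (g j) P) (c : J → ℝ) {n : ℕ} (x : Fin n → Obs 𝒜 𝒵 𝒞) :
    centredAverage P (fun y => ∑ j, c j * g j y) x = ∑ j, c j * centredAverage P (g j) x := by
  simp only [centredAverage]
  rw [integral_finsetSum _ fun j _ => (hg j).const_mul _, Finset.sum_comm, Finset.mul_sum,
    ← Finset.sum_sub_distrib, Finset.mul_sum]
  refine Finset.sum_congr rfl fun j _ => ?_
  rw [integral_const_mul, ← Finset.mul_sum]
  ring

/-- Random linear combinations of finitely many square-integrable functions whose terms tend to
zero in `L²(P)` have vanishing centred averages. -/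
theorem tendsZero_centredAverage_sum {r : ℕ → ℕ} {J : Type*} [Fintype J]
    {g : J → Obs 𝒜 𝒵 𝒞 → ℝ} (hg : ∀ j, MemLp (g j) 2 P)
    {c : ∀ n, Sample 𝒜 𝒵 𝒞 n (r n) → J → ℝ} {v : ∀ n, Sample 𝒜 𝒵 𝒞 n (r n) → ℝ}
    (hv : TendsZero (fun n => sampleLaw P n (r n)) v)
    (hc : ∀ n s j, c n s j ^ 2 * ∫ y, g j y ^ 2 ∂P ≤ v n s) :
    TendsZero (fun n => sampleLaw P n (r n))
      fun n s => centredAverage P (fun y => ∑ j, c n s j * g j y) s.1 := by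
  simp_rw [centredAverage_sum fun j => (hg j).integrable one_le_two]
  refine TendsZero.sum _ fun j => ?_
  -- If g j has zero norm, the hypothesis does not constrain its coefficient, but the centred
  -- average vanishes almost surely.
  rcases (integral_nonneg fun y => sq_nonneg (g j y) :
    0 ≤ ∫ y, g j y ^ 2 ∂P).eq_or_lt with h0 | hpos
  · have hae : g j =ᵐ[P] 0 := by
      have := (integral_eq_zero_iff_of_nonneg (fun y => sq_nonneg (g j y))
        (hg j).integrable_sq).1 h0.symm
      filter_upwards [this] with y hy
      simpa using hy
    refine TendsZero.zero.of_le (Eventually.of_forall fun n => ?_)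
    filter_upwards [ae_sampleLaw_forall hae n (r n)] with s hs
    have hi : ∫ y, g j y ∂P = 0 := by rw [integral_congr_ae hae]; simp
    simp [centredAverage, hs, hi]
  · refine TendsZero.mul_tight ?_ fun δ hδ => ?_
    · intro ε hε
      refine tendsto_of_tendsto_of_tendsto_of_le_of_le tendsto_const_nhds
        (hv (ε ^ 2 * ∫ y, g j y ^ 2 ∂P) (by positivity)) (fun _ => zero_le)
        fun n => measure_mono fun s hs => ?_
      simp only [Set.mem_ofPred_eq] at hs ⊢
      refine le_trans ?_ ((hc n s j).trans (le_abs_self _))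
      have : ε ^ 2 ≤ c n s j ^ 2 := by
        rw [← sq_abs (c n s j)]; gcongr
      gcongr
    · obtain ⟨M, hM0, hM⟩ : ∃ M : ℝ, 0 < M ∧ ENNReal.ofReal (Var[g j; P] / M ^ 2) ≤ δ := by
        have ht : Tendsto (fun M : ℝ => ENNReal.ofReal (Var[g j; P] / M ^ 2)) atTop (𝓝 0) := by
          have : Tendsto (fun M : ℝ => Var[g j; P] / M ^ 2) atTop (𝓝 0) :=
            tendsto_const_nhds.div_atTop (tendsto_pow_atTop two_ne_zero)
          simpa using ENNReal.tendsto_ofReal this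
        obtain ⟨M, hM⟩ := ((ENNReal.tendsto_nhds_zero.1 ht δ (pos_iff_ne_zero.2 hδ)).and
          (eventually_gt_atTop 0)).exists
        exact ⟨M, hM.2, hM.1⟩
      exact ⟨M, hM0, fun n => (measure_centredAverage_ge_le (hg j) hM0 n (r n)).trans hM⟩

end Empirical

/-! ### The empirical process term for cellwise affine functions on finite supports -/

section Finite
variable {𝒜 𝒵 𝒞 : Type u} [MeasurableSpace 𝒜] [MeasurableSpace 𝒵] [MeasurableSpace 𝒞]
  [DiscreteMeasurableSpace 𝒜] [DiscreteMeasurableSpace 𝒵] [DiscreteMeasurableSpace 𝒞]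
  [Fintype 𝒜] [Fintype 𝒵] [Fintype 𝒞]
  {a₁ a₀ : 𝒜} {P : Measure (Obs 𝒜 𝒵 𝒞)} {θ : ℝ}

/-- The residual of the outcome in a cell. -/
noncomputable def cellResidual (P : Measure (Obs 𝒜 𝒵 𝒞)) (q : 𝒜 × 𝒵 × 𝒞) : Obs 𝒜 𝒵 𝒞 → ℝ :=
  (cell q).indicator fun x => x.out - (trueNuisance P).EY q.1 q.2.1 q.2.2

/-- On a cell, UY + W = U(Y - E(Y|cell)) + (U E(Y|cell) + W). The functions involved are fixed and
mutually orthogonal in L²(P), so a random choice of U and W affects the coefficients only. -/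
theorem affine_eq_sum_cells (U W : 𝒜 × 𝒵 × 𝒞 → ℝ) (x : Obs 𝒜 𝒵 𝒞) :
    U (cellOf x) * x.out + W (cellOf x) = (∑ q, U q * cellResidual P q x) +
      ∑ q, (U q * (trueNuisance P).EY q.1 q.2.1 q.2.2 + W q) *
        (cell q).indicator (fun _ => (1 : ℝ)) x := by
  classical
  have hind : ∀ (f : Obs 𝒜 𝒵 𝒞 → ℝ) q, (cell q).indicator f x = if q = cellOf x then f x else 0 := by
    intro f q
    rw [cell_eq_preimage, Set.indicator_apply]
    simp [eq_comm]
  simp only [cellResidual, hind, mul_ite, mul_zero, Finset.sum_ite_eq', Finset.mem_univ, if_true]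
  ring

/-- Pythagoras on one cell: the residual integrates to zero there, which kills the cross term, and
the remaining cells only add to the right-hand side. Thus every coefficient is controlled by the
L²(P) norm. -/
theorem ModelFacts.sq_add_sq_le (h : ModelFacts a₁ a₀ P θ) (hY : MemLp Obs.out 2 P)
    (U W : 𝒜 × 𝒵 × 𝒞 → ℝ) (q : 𝒜 × 𝒵 × 𝒞) :
    U q ^ 2 * (∫ y, cellResidual P q y ^ 2 ∂P) +
      (U q * (trueNuisance P).EY q.1 q.2.1 q.2.2 + W q) ^ 2 *
        (∫ y, (cell q).indicator (fun _ => (1 : ℝ)) y ^ 2 ∂P) ≤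
      ∫ x, (U (cellOf x) * x.out + W (cellOf x)) ^ 2 ∂P := by
  haveI := h.prob
  have hmc := measurableSet_cell (𝒜 := 𝒜) (𝒵 := 𝒵) (𝒞 := 𝒞) q
  set e := (trueNuisance P).EY q.1 q.2.1 q.2.2 with he
  have hsq : Integrable (fun x : Obs 𝒜 𝒵 𝒞 => (U (cellOf x) * x.out + W (cellOf x)) ^ 2) P :=
    (memLp_affine hY U W).integrable_sq
  have h1 : ∫ x in cell q, (U (cellOf x) * x.out + W (cellOf x)) ^ 2 ∂P ≤
      ∫ x, (U (cellOf x) * x.out + W (cellOf x)) ^ 2 ∂P :=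
    setIntegral_le_integral hsq (Eventually.of_forall fun x => sq_nonneg _)
  refine le_trans (le_of_eq ?_) h1
  have hr : ∫ y, cellResidual P q y ^ 2 ∂P = ∫ x in cell q, (x.out - e) ^ 2 ∂P := by
    rw [← integral_indicator hmc]
    refine integral_congr_ae (Eventually.of_forall fun x => ?_)
    by_cases hx : x ∈ cell q <;> simp [cellResidual, hx, he]
  have hi : ∫ y, (cell q).indicator (fun _ => (1 : ℝ)) y ^ 2 ∂P = ∫ x in cell q, (1 : ℝ) ∂P := by
    rw [← integral_indicator hmc]
    refine integral_congr_ae (Eventually.of_forall fun x => ?_)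
    by_cases hx : x ∈ cell q <;> simp [hx]
  have hres : MemLp (fun x : Obs 𝒜 𝒵 𝒞 => x.out - e) 2 P := hY.sub (memLp_const e)
  have hint0 : ∫ x in cell q, (x.out - e) ∂P = 0 := by
    rw [integral_sub h.integrable_out.integrableOn (integrable_const _), setIntegral_const,
      smul_eq_mul, ← h.EY_mul_cell]
    ring
  have hD : ∫ x in cell q, (U (cellOf x) * x.out + W (cellOf x)) ^ 2 ∂P =
      ∫ x in cell q, (U q ^ 2 * (x.out - e) ^ 2 + 2 * U q * (U q * e + W q) * (x.out - e) +
        (U q * e + W q) ^ 2 * 1) ∂P := by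
    refine setIntegral_congr_fun hmc fun x hx => ?_
    rw [cell_eq_preimage] at hx
    simp only [show cellOf x = q from hx]
    ring
  have i1 : Integrable (fun x : Obs 𝒜 𝒵 𝒞 => U q ^ 2 * (x.out - e) ^ 2) (P.restrict (cell q)) :=
    (hres.integrable_sq.const_mul _).integrableOn
  have i2 : Integrable (fun x : Obs 𝒜 𝒵 𝒞 => 2 * U q * (U q * e + W q) * (x.out - e))
      (P.restrict (cell q)) := ((hres.integrable one_le_two).const_mul _).integrableOn
  have i12 : Integrable (fun x : Obs 𝒜 𝒵 𝒞 => U q ^ 2 * (x.out - e) ^ 2 +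
      2 * U q * (U q * e + W q) * (x.out - e)) (P.restrict (cell q)) := i1.add i2
  rw [hD, integral_add i12 (integrable_const _), integral_add i1 i2, integral_const_mul,
    integral_const_mul, integral_const_mul, hint0, hr, hi]
  ring

/-- In a finite-dimensional class, L²(P) convergence to zero forces each term of the orthogonal
expansion to zero. The random coefficients then multiply tight averages of fixed functions, however
they depend on the sample. -/
theorem ModelFacts.tendsZero_centredAverage_affine (h : ModelFacts a₁ a₀ P θ)
    (hY : MemLp Obs.out 2 P) {r : ℕ → ℕ} (U W : ∀ n, Sample 𝒜 𝒵 𝒞 n (r n) → 𝒜 × 𝒵 × 𝒞 → ℝ)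
    (hv : TendsZero (fun n => sampleLaw P n (r n)) fun n s =>
      ∫ x, (U n s (cellOf x) * x.out + W n s (cellOf x)) ^ 2 ∂P) :
    TendsZero (fun n => sampleLaw P n (r n)) fun n s =>
      centredAverage P (fun x => U n s (cellOf x) * x.out + W n s (cellOf x)) s.1 := by
  haveI := h.prob
  have m1 : ∀ q, MemLp (cellResidual P q) 2 P := fun q =>
    (hY.sub (memLp_const _)).indicator (measurableSet_cell q)
  have m2 : ∀ q : 𝒜 × 𝒵 × 𝒞, MemLp ((cell q).indicator fun _ => (1 : ℝ)) 2 P := fun q =>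
    (memLp_const 1).indicator (measurableSet_cell q)
  have t1 := tendsZero_centredAverage_sum (c := U) m1 hv fun n s q =>
    le_trans (le_add_of_nonneg_right (by positivity)) (h.sq_add_sq_le hY (U n s) (W n s) q)
  have t2 := tendsZero_centredAverage_sum
    (c := fun n s q => U n s q * (trueNuisance P).EY q.1 q.2.1 q.2.2 + W n s q) m2 hv fun n s q =>
    le_trans (le_add_of_nonneg_left (by positivity)) (h.sq_add_sq_le hY (U n s) (W n s) q)
  refine (t1.add t2).of_le (Eventually.of_forall fun n => Eventually.of_forall fun s => le_of_eq ?_)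
  congr 1
  simp_rw [affine_eq_sum_cells (P := P) (U n s) (W n s)]
  simp only [centredAverage]
  rw [integral_add, Finset.sum_add_distrib]
  · ring
  · exact integrable_finsetSum _ fun q _ => ((m1 q).integrable one_le_two).const_mul _
  · exact integrable_finsetSum _ fun q _ => ((m2 q).integrable one_le_two).const_mul _

end Finite

end FDTD

namespace FDTD

/-! ### Asymptotic linearity -/

section Finite
variable {𝒜 𝒵 𝒞 : Type u} [MeasurableSpace 𝒜] [MeasurableSpace 𝒵] [MeasurableSpace 𝒞]
  [DiscreteMeasurableSpace 𝒜] [DiscreteMeasurableSpace 𝒵] [DiscreteMeasurableSpace 𝒞]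
  [Fintype 𝒜] [Fintype 𝒵] [Fintype 𝒞]
  {a₁ a₀ : 𝒜} {P : Measure (Obs 𝒜 𝒵 𝒞)} {θ : ℝ}

theorem memLp_cellwise [IsFiniteMeasure P] {p : ℝ≥0∞} (f : 𝒜 × 𝒵 × 𝒞 → ℝ) :
    MemLp (fun x : Obs 𝒜 𝒵 𝒞 => f (cellOf x)) p P := by
  obtain ⟨C, hC⟩ := exists_bound_cellwise f
  exact MemLp.of_bound (measurable_cellwise f).aestronglyMeasurable C
      (Eventually.of_forall fun x => hC _)

/-- Cellwise values are controlled by the `L²(P)` norm. -/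
theorem ModelFacts.exists_cell_bound (h : ModelFacts a₁ a₀ P θ) : ∃ κ : ℝ, 0 ≤ κ ∧
    ∀ (f : 𝒜 × 𝒵 × 𝒞 → ℝ) (q : 𝒜 × 𝒵 × 𝒞),
      |f q| ≤ κ * (eLpNorm (fun x : Obs 𝒜 𝒵 𝒞 => f (cellOf x)) 2 P).toReal := by
  haveI := h.prob
  refine ⟨∑ q : 𝒜 × 𝒵 × 𝒞, (√(P.real (cell q)))⁻¹, by positivity, fun f q => ?_⟩
  set t := (eLpNorm (fun x : Obs 𝒜 𝒵 𝒞 => f (cellOf x)) 2 P).toReal with ht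
  have hq := h.pos q
  have hsq : f q ^ 2 * P.real (cell q) ≤ t ^ 2 := by
    have e : t ^ 2 = ∫ x, f (cellOf x) ^ 2 ∂P := by
      rw [ht, ← ENNReal.toReal_pow, eLpNorm_two_sq (memLp_cellwise f),
        ENNReal.toReal_ofReal (integral_nonneg fun x => sq_nonneg _)]
    rw [e]
    refine le_trans (le_of_eq ?_) (setIntegral_le_integral (s := cell q)
      (memLp_cellwise f).integrable_sq (Eventually.of_forall fun x => sq_nonneg _))
    rw [setIntegral_congr_fun (g := fun _ => f q ^ 2) (measurableSet_cell q), setIntegral_const,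
      smul_eq_mul, mul_comm]
    intro x hx
    rw [cell_eq_preimage] at hx
    simp only [show cellOf x = q from hx]
  have h1 : |f q| * √(P.real (cell q)) ≤ t := by
    refine abs_le_of_sq_le_sq' ?_ ENNReal.toReal_nonneg |>.2
    rw [mul_pow, sq_abs, Real.sq_sqrt hq.le]
    exact hsq
  have h2 : |f q| ≤ (√(P.real (cell q)))⁻¹ * t := by
    rw [inv_mul_eq_div, le_div_iff₀ (Real.sqrt_pos.2 hq)]
    exact h1
  refine h2.trans (mul_le_mul_of_nonneg_right ?_ ENNReal.toReal_nonneg)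
  exact Finset.single_le_sum (f := fun q : 𝒜 × 𝒵 × 𝒞 => (√(P.real (cell q)))⁻¹)
    (fun _ _ => by positivity) (Finset.mem_univ q)

/-- Almost sure bounds in X hold on every cell because no cell is null. A single K then dominates
all upper bounds and the reciprocals of all lower bounds. -/
theorem ModelFacts.eventually_nuisanceBound (h : ModelFacts a₁ a₀ P θ) [Nonempty 𝒜] [Nonempty 𝒵]
    [Nonempty 𝒞] {r : ℕ → ℕ} {ηhat : ∀ n, Sample 𝒜 𝒵 𝒞 n (r n) → Nuisance 𝒜 𝒵 𝒞}
    (hb : Boundedness a₁ a₀ P r ηhat) : ∃ K : ℝ, 1 ≤ K ∧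
      WithHighProb (fun n => sampleLaw P n (r n)) fun n s => NuisanceBound a₁ a₀ (ηhat n s) K := by
  obtain ⟨a⟩ := ‹Nonempty 𝒜›
  obtain ⟨z₀⟩ := ‹Nonempty 𝒵›
  obtain ⟨c⟩ := ‹Nonempty 𝒞›
  obtain ⟨e1, h1⟩ := hb.EY_hat
  obtain ⟨e3, he3, h3⟩ := hb.pZ_hat_lower
  obtain ⟨e4, h4⟩ := hb.pZ_hat_upper
  obtain ⟨e6, he6, h6⟩ := hb.pA_hat_lower
  obtain ⟨e7, h7⟩ := hb.pAC_hat
  obtain ⟨e9, h9⟩ := hb.pC_hat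
  have p3 := inv_pos.2 he3
  have p6 := inv_pos.2 he6
  refine ⟨1 + |e1| + |e4| + |e7| + |e9| + e3⁻¹ + e6⁻¹, ?_, ?_⟩
  · have := abs_nonneg e1
    have := abs_nonneg e4
    have := abs_nonneg e7
    have := abs_nonneg e9
    linarith
  refine WithHighProb.mono (h1.and (h3.and ((h4 a₁ (by simp)).and ((h4 a₀ (by simp)).and
    ((h6 a₁ (by simp)).and ((h6 a₀ (by simp)).and (h7.and h9))))))) ?_
  rintro n s ⟨k1, k3, k41, k40, k61, k60, k7, k9⟩
  have n1 := abs_nonneg e1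
  have n4 := abs_nonneg e4
  have n7 := abs_nonneg e7
  have n9 := abs_nonneg e9
  have g1 : ∀ q : 𝒜 × 𝒵 × 𝒞, |(ηhat n s).EY q.1 q.2.1 q.2.2| < e1 :=
    fun q => h.forall_of_ae (p := fun q => |(ηhat n s).EY q.1 q.2.1 q.2.2| < e1) k1 q
  have g3 : ∀ z a, e3 < (ηhat n s).pZ z a := fun z a =>
    h.forall_of_ae (p := fun q => e3 < (ηhat n s).pZ q.2.1 q.1) k3 (a, z, c)
  have g4 : ∀ b ∈ ({a₁, a₀} : Set 𝒜), ∀ z, |(ηhat n s).pZ z b| < e4 := by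
    rintro b (rfl | rfl) z
    · exact h.forall_of_ae (p := fun q => |(ηhat n s).pZ q.2.1 _| < e4) k41 (a, z, c)
    · exact h.forall_of_ae (p := fun q => |(ηhat n s).pZ q.2.1 _| < e4) k40 (a, z, c)
  have g6 : ∀ b ∈ ({a₁, a₀} : Set 𝒜), e6 < (ηhat n s).pA b := by
    rintro b (rfl | rfl)
    exacts [k61, k60]
  have g7 : ∀ a c, |(ηhat n s).pAC a c| < e7 := fun a' c' =>
    h.forall_of_ae (p := fun q => |(ηhat n s).pAC q.1 q.2.2| < e7) k7 (a', z₀, c')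
  have g9 : ∀ c, |(ηhat n s).pC c| < e9 := fun c' =>
    h.forall_of_ae (p := fun q => |(ηhat n s).pC q.2.2| < e9) k9 (a, z₀, c')
  refine ⟨fun q => ?_, fun b hb z => ?_, fun z a => he3.trans (g3 z a), fun z a => ?_,
    fun b hb => he6.trans (g6 b hb), fun b hb => ?_, fun a c => ?_, fun c => ?_⟩
  · linarith [g1 q, le_abs_self e1]
  · linarith [g4 b hb z, le_abs_self e4]
  · have := inv_anti₀ he3 (g3 z a).le
    linarith
  · have := inv_anti₀ he6 (g6 b hb).le
    linarith
  · linarith [g7 a c, le_abs_self e7]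
  · linarith [g9 c, le_abs_self e9]

theorem tendsZero_of_root {r : ℕ → ℕ} {e e' : ∀ n, Sample 𝒜 𝒵 𝒞 n (r n) → ℝ≥0∞}
    (h : IsLittleOPRoot (fun n => sampleLaw P n (r n)) fun n s => e n s * e' n s)
    (he : ∀ n s, e n s ≠ ∞) (he' : ∀ n s, e' n s ≠ ∞) :
    TendsZero (fun n => sampleLaw P n (r n))
      fun n s => √(n : ℝ) * ((e n s).toReal * (e' n s).toReal) := by
  refine isLittleOP_iff_real.1 ?_
  unfold IsLittleOPRoot at h
  convert h using 3 with n s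
  rw [Real.enorm_of_nonneg (by positivity), ENNReal.ofReal_mul (by positivity),
    ENNReal.ofReal_mul (by positivity), ENNReal.ofReal_toReal (he n s),
    ENNReal.ofReal_toReal (he' n s)]

/-- On finite supports uniform errors are at most κ times L²(P) errors. Each product in the bias
bound therefore matches one of the assumed rates, up to the constant B κ². -/
theorem ModelFacts.tendsZero_bias (h : ModelFacts a₁ a₀ P θ) [Nonempty 𝒜] [Nonempty 𝒵]
    [Nonempty 𝒞] {r : ℕ → ℕ} {ηhat : ∀ n, Sample 𝒜 𝒵 𝒞 n (r n) → Nuisance 𝒜 𝒵 𝒞}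
    (hb : Boundedness a₁ a₀ P r ηhat) (hp : ProductRates a₁ a₀ P r ηhat) :
    TendsZero (fun n => sampleLaw P n (r n))
      fun n s => √(n : ℝ) * (∫ x, mFun a₁ a₀ (ηhat n s) x ∂P - θ) := by
  haveI := h.prob
  obtain ⟨K, hK, hwhp⟩ := h.eventually_nuisanceBound hb
  obtain ⟨κ, hκ, hcell⟩ := h.exists_cell_bound
  obtain ⟨B, hB0, -, hB⟩ := h.abs_bias_le (K := K) hK
  obtain ⟨a⟩ := ‹Nonempty 𝒜›
  obtain ⟨z₀⟩ := ‹Nonempty 𝒵›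
  obtain ⟨c⟩ := ‹Nonempty 𝒞›
  have fE : ∀ η : Nuisance 𝒜 𝒵 𝒞, errEY P η ≠ ∞ := fun η => (memLp_cellwise
    fun q => η.EY q.1 q.2.1 q.2.2 - (trueNuisance P).EY q.1 q.2.1 q.2.2).eLpNorm_lt_top.ne
  have fZA : ∀ η : Nuisance 𝒜 𝒵 𝒞, errZA P η ≠ ∞ := fun η => (memLp_cellwise
    fun q => η.pZ q.2.1 q.1 - (trueNuisance P).pZ q.2.1 q.1).eLpNorm_lt_top.ne
  have fZ : ∀ b (η : Nuisance 𝒜 𝒵 𝒞), errZ P b η ≠ ∞ := fun b η => (memLp_cellwise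
    fun q => η.pZ q.2.1 b - (trueNuisance P).pZ q.2.1 b).eLpNorm_lt_top.ne
  have fA : ∀ b (η : Nuisance 𝒜 𝒵 𝒞), errA P b η ≠ ∞ := fun b η => (memLp_cellwise
    fun _ => η.pA b - (trueNuisance P).pA b).eLpNorm_lt_top.ne
  have fAC : ∀ η : Nuisance 𝒜 𝒵 𝒞, errAC P η ≠ ∞ := fun η => (memLp_cellwise
    fun q => η.pAC q.1 q.2.2 - (trueNuisance P).pAC q.1 q.2.2).eLpNorm_lt_top.ne
  have fC : ∀ η : Nuisance 𝒜 𝒵 𝒞, errC P η ≠ ∞ := fun η => (memLp_cellwise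
    fun q => η.pC q.2.2 - (trueNuisance P).pC q.2.2).eLpNorm_lt_top.ne
  have hdist : ∀ η : Nuisance 𝒜 𝒵 𝒞, NuisanceDist a₁ a₀ η (trueNuisance P)
      (κ * (errEY P η).toReal) (κ * (errZA P η).toReal) (κ * (errAC P η).toReal)
      (κ * (errC P η).toReal) (fun b => κ * (errZ P b η).toReal)
      (fun b => κ * (errA P b η).toReal) := fun η =>
    { EY := fun q => hcell
        (fun q => η.EY q.1 q.2.1 q.2.2 - (trueNuisance P).EY q.1 q.2.1 q.2.2) q
      pZA := fun z a => hcell (fun q => η.pZ q.2.1 q.1 - (trueNuisance P).pZ q.2.1 q.1) (a, z, c)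
      pAC := fun a c => hcell
        (fun q => η.pAC q.1 q.2.2 - (trueNuisance P).pAC q.1 q.2.2) (a, z₀, c)
      pC := fun c => hcell (fun q => η.pC q.2.2 - (trueNuisance P).pC q.2.2) (a, z₀, c)
      pZ := fun b _ z => hcell (fun q => η.pZ q.2.1 b - (trueNuisance P).pZ q.2.1 b) (a, z, c)
      pA := fun b _ => hcell (fun _ => η.pA b - (trueNuisance P).pA b) (a, z₀, c) }
  have tEZA := tendsZero_of_root hp.EY_ZA (fun n s => fE _) (fun n s => fZA _)
  have tb : ∀ b ∈ ({a₁, a₀} : Set 𝒜), TendsZero (fun n => sampleLaw P n (r n)) fun n s =>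
      √(n : ℝ) * ((errEY P (ηhat n s)).toReal * (errZ P b (ηhat n s)).toReal) +
      √(n : ℝ) * ((errZ P b (ηhat n s)).toReal * (errAC P (ηhat n s)).toReal) +
      √(n : ℝ) * ((errZ P b (ηhat n s)).toReal * (errC P (ηhat n s)).toReal) +
      √(n : ℝ) * ((errZ P b (ηhat n s)).toReal * (errA P b (ηhat n s)).toReal) := fun b hb =>
    (((tendsZero_of_root (hp.EY_Z b hb) (fun n s => fE _) (fun n s => fZ _ _)).add
      (tendsZero_of_root (hp.Z_AC b hb) (fun n s => fZ _ _) (fun n s => fAC _))).add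
      (tendsZero_of_root (hp.Z_C b hb) (fun n s => fZ _ _) (fun n s => fC _))).add
      (tendsZero_of_root (hp.Z_A b hb) (fun n s => fZ _ _) (fun n s => fA _ _))
  refine TendsZero.of_le_whp (((tEZA.add (tb a₁ (by simp))).add (tb a₀ (by simp))).const_mul
    (B * κ ^ 2)) hwhp (Eventually.of_forall fun n => Eventually.of_forall fun s hs => ?_)
  rw [abs_mul, abs_of_nonneg (Real.sqrt_nonneg _)]
  refine le_trans ?_ (le_abs_self _)
  refine (mul_le_mul_of_nonneg_left (hB _ _ _ _ _ _ _ hs (hdist _)) (Real.sqrt_nonneg _)).trans ?_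
  refine le_of_eq ?_
  ring

theorem ModelFacts.integral_mFun_trueNuisance (h : ModelFacts a₁ a₀ P θ) [Nonempty 𝒵]
    [Nonempty 𝒞] : ∫ x, mFun a₁ a₀ (trueNuisance P) x ∂P = θ :=
  h.integral_mFun_of_mediator (seriesConverge_of_finite _) (h.integrable_mFun _) rfl

theorem ModelFacts.memLp_phi (h : ModelFacts a₁ a₀ P θ) (hY : MemLp Obs.out 2 P)
    (η : Nuisance 𝒜 𝒵 𝒞) : MemLp (phi a₁ a₀ η θ) 2 P := by
  haveI := h.prob
  have e : phi a₁ a₀ η θ = fun x => (fun q => mSlope a₁ a₀ η q.1 q.2.1) (cellOf x) * x.out +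
      (fun q => mIntercept a₁ a₀ η q - θ) (cellOf x) := by
    funext x
    rw [phi, mFun_eq]
    ring
  rw [e]
  exact memLp_affine hY (fun q => mSlope a₁ a₀ η q.1 q.2.1) (fun q => mIntercept a₁ a₀ η q - θ)

theorem ModelFacts.integral_phi (h : ModelFacts a₁ a₀ P θ) [Nonempty 𝒵] [Nonempty 𝒞] :
    ∫ x, phi a₁ a₀ (trueNuisance P) θ x ∂P = 0 := by
  haveI := h.prob
  simp only [phi]
  rw [integral_sub (h.integrable_mFun _) (integrable_const _), h.integral_mFun_trueNuisance]
  simp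

/-- Since P m(·,η₀) = θ, for n ≠ 0 the error of the linearization is exactly √n(Pₙ - P)(m(·,η̂) -
m(·,η₀)) + √n(P m(·,η̂) - θ), an empirical process term plus a bias, and both tend to zero in
probability. -/
theorem ModelFacts.isAsymptoticallyLinear (h : ModelFacts a₁ a₀ P θ) [Nonempty 𝒜] [Nonempty 𝒵]
    [Nonempty 𝒞] (hY : MemLp Obs.out 2 P) {r : ℕ → ℕ}
    {ηhat : ∀ n, Sample 𝒜 𝒵 𝒞 n (r n) → Nuisance 𝒜 𝒵 𝒞}
    {θhat : ∀ n, Sample 𝒜 𝒵 𝒞 n (r n) → ℝ}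
    (hθhat : ∀ n (s : Sample 𝒜 𝒵 𝒞 n (r n)), n ≠ 0 →
      θhat n s = 1 / (n : ℝ) * ∑ i, mFun a₁ a₀ (ηhat n s) (s.1 i))
    (hl2 : IsLittleOP (fun n => sampleLaw P n (r n)) fun n s =>
      eLpNorm (fun x => mFun a₁ a₀ (ηhat n s) x - mFun a₁ a₀ (trueNuisance P) x) 2 P ^ 2)
    (hb : Boundedness a₁ a₀ P r ηhat) (hp : ProductRates a₁ a₀ P r ηhat) :
    IsAsymptoticallyLinear P r θhat θ (phi a₁ a₀ (trueNuisance P) θ) := by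
  haveI := h.prob
  refine ⟨h.memLp_phi hY _, h.integral_phi, isLittleOP_iff_real.2 ?_⟩
  set U : ∀ n, Sample 𝒜 𝒵 𝒞 n (r n) → 𝒜 × 𝒵 × 𝒞 → ℝ := fun n s q =>
    mSlope a₁ a₀ (ηhat n s) q.1 q.2.1 - mSlope a₁ a₀ (trueNuisance P) q.1 q.2.1 with hU
  set W : ∀ n, Sample 𝒜 𝒵 𝒞 n (r n) → 𝒜 × 𝒵 × 𝒞 → ℝ := fun n s q =>
    mIntercept a₁ a₀ (ηhat n s) q - mIntercept a₁ a₀ (trueNuisance P) q with hW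
  have hD : ∀ n s x, mFun a₁ a₀ (ηhat n s) x - mFun a₁ a₀ (trueNuisance P) x =
      U n s (cellOf x) * x.out + W n s (cellOf x) := fun n s x => by
    rw [mFun_eq, mFun_eq]
    ring
  have hv : TendsZero (fun n => sampleLaw P n (r n)) fun n s =>
      ∫ x, (U n s (cellOf x) * x.out + W n s (cellOf x)) ^ 2 ∂P := by
    refine isLittleOP_iff_real.1 ?_
    convert hl2 using 3 with n s
    simp_rw [hD]
    rw [eLpNorm_two_sq (memLp_affine hY _ _),
      Real.enorm_of_nonneg (integral_nonneg fun x => sq_nonneg _)]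
  have ht := (h.tendsZero_centredAverage_affine hY U W hv).add (h.tendsZero_bias hb hp)
  refine TendsZero.of_le ht ?_
  filter_upwards [eventually_ne_atTop 0] with n hn
  refine Eventually.of_forall fun s => le_of_eq ?_
  congr 1
  have hn0 : (0 : ℝ) < n := by exact_mod_cast Nat.pos_of_ne_zero hn
  have hs : √(n : ℝ) ^ 2 = n := Real.sq_sqrt hn0.le
  have hs0 : 0 < √(n : ℝ) := Real.sqrt_pos.2 hn0
  rw [hθhat n s hn]
  simp_rw [← hD, centredAverage, phi]
  rw [integral_sub (h.integrable_mFun _) (h.integrable_mFun _), h.integral_mFun_trueNuisance,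
    Finset.sum_sub_distrib, Finset.sum_sub_distrib, Finset.sum_const, Finset.card_univ,
    Fintype.card_fin, nsmul_eq_mul]
  have e : ∀ t : ℝ, 1 / √(n : ℝ) * t = √(n : ℝ) * (1 / (n : ℝ) * t) := fun t => by
    rw [← mul_assoc]
    congr 1
    rw [mul_one_div, eq_div_iff hn0.ne', one_div, inv_mul_eq_div, div_eq_iff hs0.ne', ← sq, hs]
  rw [e]
  field_simp
  ring

end Finite

end FDTD

namespace FDTD

/-! ### Laws given by real densities -/

section Densities
variable {𝒳 : Type*} [MeasurableSpace 𝒳] {ν : Measure 𝒳}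

/-- The law with density `p` with respect to `ν`. -/
noncomputable def lawOf (ν : Measure 𝒳) (p : 𝒳 → ℝ) : Measure 𝒳 :=
  ν.withDensity fun x => ENNReal.ofReal (p x)

theorem integral_abs_mul_le_sqrt {f g : 𝒳 → ℝ} (hf : MemLp f 2 ν) (hg : MemLp g 2 ν) :
    ∫ x, |f x * g x| ∂ν ≤ √(∫ x, f x ^ 2 ∂ν) * √(∫ x, g x ^ 2 ∂ν) := by
  have h := integral_mul_norm_le_Lp_mul_Lq (μ := ν) (f := f) (g := g) Real.HolderConjugate.two_two
    (by simpa using hf) (by simpa using hg)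
  simp only [Real.norm_eq_abs, ← abs_mul, Real.rpow_ofNat, sq_abs] at h
  rwa [← Real.sqrt_eq_rpow, ← Real.sqrt_eq_rpow] at h

variable {p : 𝒳 → ℝ}

theorem integral_lawOf {F : Type*} [NormedAddCommGroup F] [NormedSpace ℝ F] (hp : Measurable p)
    (hp0 : ∀ x, 0 ≤ p x) (f : 𝒳 → F) : ∫ x, f x ∂(lawOf ν p) = ∫ x, p x • f x ∂ν := by
  rw [lawOf, integral_withDensity_eq_integral_toReal_smul hp.ennreal_ofReal
    (Eventually.of_forall fun _ => ENNReal.ofReal_lt_top)]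
  simp_rw [ENNReal.toReal_ofReal (hp0 _)]

theorem integrable_lawOf_iff {F : Type*} [NormedAddCommGroup F] [NormedSpace ℝ F]
    (hp : Measurable p) (hp0 : ∀ x, 0 ≤ p x) {f : 𝒳 → F} :
    Integrable f (lawOf ν p) ↔ Integrable (fun x => p x • f x) ν := by
  rw [lawOf, integrable_withDensity_iff_integrable_smul' hp.ennreal_ofReal
    (Eventually.of_forall fun _ => ENNReal.ofReal_lt_top)]
  simp_rw [ENNReal.toReal_ofReal (hp0 _)]

theorem integrable_density (hp : Measurable p) (hp0 : ∀ x, 0 ≤ p x) [IsFiniteMeasure (lawOf ν p)] :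
    Integrable p ν := by
  have := (integrable_lawOf_iff (ν := ν) hp hp0).1 (integrable_const (1 : ℝ))
  simpa using this

theorem measureReal_lawOf (hp : Measurable p) (hp0 : ∀ x, 0 ≤ p x) {S : Set 𝒳}
    (hS : MeasurableSet S) : (lawOf ν p).real S = ∫ x in S, p x ∂ν := by
  rw [← integral_indicator_one hS, integral_lawOf hp hp0, ← integral_indicator hS]
  refine integral_congr_ae (Eventually.of_forall fun x => ?_)
  by_cases hx : x ∈ S <;> simp [hx]

theorem memLp_sqrt_density (hp : Measurable p) (hp0 : ∀ x, 0 ≤ p x)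
    [IsFiniteMeasure (lawOf ν p)] : MemLp (fun x => √(p x)) 2 ν := by
  rw [memLp_two_iff_integrable_sq hp.sqrt.aestronglyMeasurable]
  simp_rw [Real.sq_sqrt (hp0 _)]
  exact integrable_density hp hp0

theorem memLp_mul_sqrt_density (hp : Measurable p) (hp0 : ∀ x, 0 ≤ p x) {g : 𝒳 → ℝ}
    (hgm : Measurable g) (hg : MemLp g 2 (lawOf ν p)) : MemLp (fun x => g x * √(p x)) 2 ν := by
  have hm : Measurable fun x => g x * √(p x) := hgm.mul hp.sqrt
  rw [memLp_two_iff_integrable_sq hm.aestronglyMeasurable]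
  have := (integrable_lawOf_iff (ν := ν) hp hp0).1 hg.integrable_sq
  refine this.congr (Eventually.of_forall fun x => ?_)
  simp only [smul_eq_mul]
  rw [mul_pow, Real.sq_sqrt (hp0 _), mul_comm]

theorem integral_sq_mul_sqrt_density (hp : Measurable p) (hp0 : ∀ x, 0 ≤ p x) (g : 𝒳 → ℝ) :
    ∫ x, (g x * √(p x)) ^ 2 ∂ν = ∫ x, g x ^ 2 ∂(lawOf ν p) := by
  rw [integral_lawOf hp hp0]
  refine integral_congr_ae (Eventually.of_forall fun x => ?_)
  simp only [smul_eq_mul]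
  rw [mul_pow, Real.sq_sqrt (hp0 _), mul_comm]

end Densities

/-! ### Local sequences differentiable in quadratic mean -/

/-- A sequence of densities `p n` approaching `p₀` at rate `n^{-1/2}` in quadratic mean, with
score contributions `ℓ n` dominated by `n^{-1/2} σ`. -/
structure LocalSeq {𝒳 : Type*} [MeasurableSpace 𝒳] (ν : Measure 𝒳) (p₀ : 𝒳 → ℝ) (p : ℕ → 𝒳 → ℝ)
    (ℓ : ℕ → 𝒳 → ℝ) (σ : 𝒳 → ℝ) : Prop where
  measurable_base : Measurable p₀
  measurable_dens : ∀ n, Measurable (p n)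
  base_nonneg : ∀ x, 0 ≤ p₀ x
  dens_nonneg : ∀ n x, 0 ≤ p n x
  prob_base : IsProbabilityMeasure (lawOf ν p₀)
  prob : ∀ n, IsProbabilityMeasure (lawOf ν (p n))
  measurable_score : ∀ n, Measurable (ℓ n)
  measurable_bound : Measurable σ
  memLp_bound : MemLp σ 2 (lawOf ν p₀)
  bound_nonneg : ∀ x, 0 ≤ σ x
  score_le : ∀ (n : ℕ) x, √(n : ℝ) * |ℓ n x| ≤ σ x
  memLp_score : ∀ n, MemLp (ℓ n) 2 (lawOf ν p₀)
  qmd : Tendsto (fun n : ℕ => (n : ℝ) *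
    ∫ x, (√(p n x) - √(p₀ x) - 1 / 2 * ℓ n x * √(p₀ x)) ^ 2 ∂ν) atTop (𝓝 0)

namespace LocalSeq

variable {𝒳 : Type*} [MeasurableSpace 𝒳] {ν : Measure 𝒳} {p₀ : 𝒳 → ℝ} {p : ℕ → 𝒳 → ℝ}
  {ℓ : ℕ → 𝒳 → ℝ} {σ : 𝒳 → ℝ}

/-- The difference of the root densities. -/
noncomputable def rootDiff (p₀ : 𝒳 → ℝ) (p : ℕ → 𝒳 → ℝ) (n : ℕ) (x : 𝒳) : ℝ := √(p n x) - √(p₀ x)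

/-- The remainder in the expansion of the root densities. -/
noncomputable def remainder (p₀ : 𝒳 → ℝ) (p : ℕ → 𝒳 → ℝ) (ℓ : ℕ → 𝒳 → ℝ) (n : ℕ) (x : 𝒳) : ℝ :=
  √(p n x) - √(p₀ x) - 1 / 2 * ℓ n x * √(p₀ x)

theorem memLp_rootDiff (h : LocalSeq ν p₀ p ℓ σ) (n : ℕ) : MemLp (rootDiff p₀ p n) 2 ν := by
  haveI := h.prob_base
  haveI := h.prob n
  exact (memLp_sqrt_density (h.measurable_dens n) (h.dens_nonneg n)).sub
    (memLp_sqrt_density h.measurable_base h.base_nonneg)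

theorem memLp_score_mul (h : LocalSeq ν p₀ p ℓ σ) (n : ℕ) :
    MemLp (fun x => ℓ n x * √(p₀ x)) 2 ν :=
  memLp_mul_sqrt_density h.measurable_base h.base_nonneg (h.measurable_score n) (h.memLp_score n)

theorem memLp_bound_mul (h : LocalSeq ν p₀ p ℓ σ) : MemLp (fun x => σ x * √(p₀ x)) 2 ν :=
  memLp_mul_sqrt_density h.measurable_base h.base_nonneg h.measurable_bound h.memLp_bound

theorem memLp_remainder (h : LocalSeq ν p₀ p ℓ σ) (n : ℕ) : MemLp (remainder p₀ p ℓ n) 2 ν := by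
  have := (h.memLp_rootDiff n).sub ((h.memLp_score_mul n).const_mul (1 / 2))
  refine this.ae_eq (Eventually.of_forall fun x => ?_)
  simp only [remainder, rootDiff, Pi.sub_apply]
  ring

theorem tendsto_remainder (h : LocalSeq ν p₀ p ℓ σ) :
    Tendsto (fun n : ℕ => (n : ℝ) * ∫ x, remainder p₀ p ℓ n x ^ 2 ∂ν) atTop (𝓝 0) := h.qmd

/-- The root difference is the remainder plus ½ℓ√p₀; now (x + y)² ≤ 2x² + 2y² and nℓ² ≤ σ². So n(√pₙ
- √p₀)² is dominated by a fixed integrable function up to a term vanishing in L¹, which is the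
uniform integrability behind contiguity. -/
theorem nat_mul_rootDiff_sq_le (h : LocalSeq ν p₀ p ℓ σ) (n : ℕ) (x : 𝒳) :
    (n : ℝ) * rootDiff p₀ p n x ^ 2 ≤
      1 / 2 * (σ x * √(p₀ x)) ^ 2 + 2 * ((n : ℝ) * remainder p₀ p ℓ n x ^ 2) := by
  have e : rootDiff p₀ p n x = remainder p₀ p ℓ n x + 1 / 2 * ℓ n x * √(p₀ x) := by
    rw [rootDiff, remainder]; ring
  have h1 : (n : ℝ) * ℓ n x ^ 2 ≤ σ x ^ 2 := by
    have := pow_le_pow_left₀ (by positivity) (h.score_le n x) 2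
    rwa [mul_pow, Real.sq_sqrt (by positivity), sq_abs] at this
  have h2 : (n : ℝ) * ℓ n x ^ 2 * p₀ x ≤ σ x ^ 2 * p₀ x :=
    mul_le_mul_of_nonneg_right h1 (h.base_nonneg x)
  rw [e, mul_pow, Real.sq_sqrt (h.base_nonneg x)]
  have h3 : (remainder p₀ p ℓ n x + 1 / 2 * ℓ n x * √(p₀ x)) ^ 2 ≤
      2 * remainder p₀ p ℓ n x ^ 2 + 1 / 2 * (ℓ n x ^ 2 * p₀ x) := by
    have hs := Real.sq_sqrt (h.base_nonneg x)
    nlinarith [sq_nonneg (remainder p₀ p ℓ n x - 1 / 2 * ℓ n x * √(p₀ x))]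
  have h4 := mul_le_mul_of_nonneg_left h3 (Nat.cast_nonneg (α := ℝ) n)
  linarith

theorem integrable_bound_sq (h : LocalSeq ν p₀ p ℓ σ) :
    Integrable (fun x => (σ x * √(p₀ x)) ^ 2) ν := h.memLp_bound_mul.integrable_sq

/-- The squared Hellinger distance is O(1/n), the rate that n-fold products tolerate. -/
theorem exists_rootDiff_bound (h : LocalSeq ν p₀ p ℓ σ) :
    ∃ C : ℝ, 0 ≤ C ∧ ∀ n : ℕ, (n : ℝ) * ∫ x, rootDiff p₀ p n x ^ 2 ∂ν ≤ C := by
  obtain ⟨C, hC⟩ := h.tendsto_remainder.bddAbove_range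
  refine ⟨1 / 2 * ∫ x, (σ x * √(p₀ x)) ^ 2 ∂ν + 2 * max C 0, ?_, fun n => ?_⟩
  · have : 0 ≤ ∫ x, (σ x * √(p₀ x)) ^ 2 ∂ν := integral_nonneg fun x => sq_nonneg _
    have := le_max_right C 0
    positivity
  have hr : (n : ℝ) * ∫ x, remainder p₀ p ℓ n x ^ 2 ∂ν ≤ max C 0 :=
    (hC ⟨n, rfl⟩).trans (le_max_left _ _)
  rw [← integral_const_mul]
  have i1 := h.integrable_bound_sq.const_mul (1 / 2)
  have i2 := ((h.memLp_remainder n).integrable_sq.const_mul (n : ℝ)).const_mul 2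
  refine (integral_mono ((h.memLp_rootDiff n).integrable_sq.const_mul _) (i1.add i2)
    (h.nat_mul_rootDiff_sq_le n)).trans ?_
  simp only [Pi.add_apply]
  rw [integral_add i1 i2, integral_const_mul, integral_const_mul, integral_const_mul]
  linarith

theorem tendsto_rootDiff (h : LocalSeq ν p₀ p ℓ σ) :
    Tendsto (fun n => ∫ x, rootDiff p₀ p n x ^ 2 ∂ν) atTop (𝓝 0) := by
  obtain ⟨C, -, hC⟩ := h.exists_rootDiff_bound
  have ht : Tendsto (fun n : ℕ => C / (n : ℝ)) atTop (𝓝 0) :=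
    tendsto_const_nhds.div_atTop tendsto_natCast_atTop_atTop
  refine squeeze_zero' (Eventually.of_forall fun n => integral_nonneg fun x => sq_nonneg _) ?_ ht
  filter_upwards [eventually_gt_atTop 0] with n hn
  rw [le_div_iff₀' (by exact_mod_cast hn)]
  exact hC n

/-! #### Contiguity -/

/-- The set on which the density ratio is at most `4`. -/
def ratioSet (p₀ : 𝒳 → ℝ) (p : ℕ → 𝒳 → ℝ) (n : ℕ) : Set 𝒳 := {x | p n x ≤ 4 * p₀ x}

theorem measurableSet_ratioSet (h : LocalSeq ν p₀ p ℓ σ) (n : ℕ) :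
    MeasurableSet (ratioSet p₀ p n) :=
  measurableSet_le (h.measurable_dens n) (h.measurable_base.const_mul 4)

theorem two_mul_sqrt_lt {x : 𝒳} {n : ℕ} (h : LocalSeq ν p₀ p ℓ σ) (hx : x ∈ (ratioSet p₀ p n)ᶜ) :
    2 * √(p₀ x) < √(p n x) := by
  have h1 : 4 * p₀ x < p n x := not_le.1 hx
  have h2 : 2 * √(p₀ x) = √(4 * p₀ x) := by
    rw [show (4 : ℝ) = 2 ^ 2 by norm_num, Real.sqrt_mul (by positivity), Real.sqrt_sq (by norm_num)]
  rw [h2]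
  exact Real.sqrt_lt_sqrt (mul_nonneg (by norm_num) (h.base_nonneg x)) h1

theorem base_compl_ratioSet_le (h : LocalSeq ν p₀ p ℓ σ) (n : ℕ) :
    (lawOf ν p₀).real (ratioSet p₀ p n)ᶜ ≤ ∫ x, rootDiff p₀ p n x ^ 2 ∂ν := by
  haveI := h.prob_base
  have hS := (h.measurableSet_ratioSet n).compl
  rw [measureReal_lawOf h.measurable_base h.base_nonneg hS]
  refine (setIntegral_mono_on (integrable_density h.measurable_base h.base_nonneg).integrableOn
    (h.memLp_rootDiff n).integrable_sq.integrableOn hS fun x hx => ?_).trans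
    (setIntegral_le_integral (h.memLp_rootDiff n).integrable_sq
      (Eventually.of_forall fun x => sq_nonneg _))
  have h1 := two_mul_sqrt_lt h hx
  have h2 := Real.sqrt_nonneg (p₀ x)
  calc p₀ x = √(p₀ x) ^ 2 := (Real.sq_sqrt (h.base_nonneg x)).symm
    _ ≤ rootDiff p₀ p n x ^ 2 := by
      rw [rootDiff]
      exact pow_le_pow_left₀ h2 (by linarith) 2

/-- Off the ratio set √pₙ ≤ 2(√pₙ - √p₀), so pₙ is at most four times the squared root difference.
Multiplied by n this is dominated as above, on sets of vanishing base probability. Hence O(n)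
observations all stay in the ratio set with probability tending to one. -/
theorem tendsto_compl_ratioSet (h : LocalSeq ν p₀ p ℓ σ) :
    Tendsto (fun n : ℕ => (n : ℝ) * (lawOf ν (p n)).real (ratioSet p₀ p n)ᶜ) atTop (𝓝 0) := by
  haveI := h.prob_base
  have hP0 : Tendsto (fun n => lawOf ν p₀ (ratioSet p₀ p n)ᶜ) atTop (𝓝 0) := by
    have : Tendsto (fun n => (lawOf ν p₀).real (ratioSet p₀ p n)ᶜ) atTop (𝓝 0) :=
      squeeze_zero (fun n => measureReal_nonneg) h.base_compl_ratioSet_le h.tendsto_rootDiff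
    have h2 := ENNReal.tendsto_ofReal this
    simpa using h2
  have hσ := h.memLp_bound.integrable_sq.tendsto_setIntegral_nhds_zero hP0
  have hlim : Tendsto (fun n : ℕ => 4 * (1 / 2 * ∫ x in (ratioSet p₀ p n)ᶜ, σ x ^ 2 ∂(lawOf ν p₀) +
      2 * ((n : ℝ) * ∫ x, remainder p₀ p ℓ n x ^ 2 ∂ν))) atTop (𝓝 0) := by
    have := ((hσ.const_mul (1 / 2)).add (h.tendsto_remainder.const_mul 2)).const_mul 4
    simpa only [mul_zero, add_zero] using this
  refine squeeze_zero (fun n => by positivity) (fun n => ?_) hlim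
  haveI := h.prob n
  have hS := (h.measurableSet_ratioSet n).compl
  rw [measureReal_lawOf (h.measurable_dens n) (h.dens_nonneg n) hS]
  have i1 := h.integrable_bound_sq.const_mul (1 / 2)
  have i2 := ((h.memLp_remainder n).integrable_sq.const_mul (n : ℝ)).const_mul 2
  have hle1 : ∫ x in (ratioSet p₀ p n)ᶜ, p n x ∂ν ≤
      ∫ x in (ratioSet p₀ p n)ᶜ, 4 * rootDiff p₀ p n x ^ 2 ∂ν := by
    refine setIntegral_mono_on (integrable_density (h.measurable_dens n)
      (h.dens_nonneg n)).integrableOn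
      ((h.memLp_rootDiff n).integrable_sq.const_mul 4).integrableOn hS fun x hx => ?_
    have h1 := two_mul_sqrt_lt h hx
    have h2 := Real.sqrt_nonneg (p n x)
    calc p n x = √(p n x) ^ 2 := (Real.sq_sqrt (h.dens_nonneg n x)).symm
      _ ≤ (2 * rootDiff p₀ p n x) ^ 2 := by
        rw [rootDiff]
        exact pow_le_pow_left₀ h2 (by linarith) 2
      _ = _ := by ring
  have hle2 : (n : ℝ) * ∫ x in (ratioSet p₀ p n)ᶜ, rootDiff p₀ p n x ^ 2 ∂ν ≤
      1 / 2 * ∫ x in (ratioSet p₀ p n)ᶜ, (σ x * √(p₀ x)) ^ 2 ∂ν +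
      2 * ((n : ℝ) * ∫ x, remainder p₀ p ℓ n x ^ 2 ∂ν) := by
    rw [← integral_const_mul]
    refine (integral_mono ((h.memLp_rootDiff n).integrable_sq.const_mul _).integrableOn
      (i1.integrableOn.add i2.integrableOn) (h.nat_mul_rootDiff_sq_le n)).trans ?_
    simp only [Pi.add_apply]
    rw [integral_add i1.integrableOn i2.integrableOn, integral_const_mul, integral_const_mul,
      integral_const_mul]
    have := setIntegral_le_integral (s := (ratioSet p₀ p n)ᶜ) (h.memLp_remainder n).integrable_sq
      (Eventually.of_forall fun x => sq_nonneg _)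
    gcongr
  have e : ∫ x in (ratioSet p₀ p n)ᶜ, (σ x * √(p₀ x)) ^ 2 ∂ν =
      ∫ x in (ratioSet p₀ p n)ᶜ, σ x ^ 2 ∂(lawOf ν p₀) := by
    rw [← integral_indicator hS, ← integral_indicator hS, integral_lawOf h.measurable_base
      h.base_nonneg]
    refine integral_congr_ae (Eventually.of_forall fun x => ?_)
    by_cases hx : x ∈ (ratioSet p₀ p n)ᶜ
    · simp only [Set.indicator_of_mem hx, smul_eq_mul]
      rw [mul_pow, Real.sq_sqrt (h.base_nonneg _), mul_comm]
    · simp only [Set.indicator_of_notMem hx, smul_zero]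
  rw [← e]
  rw [integral_const_mul] at hle1
  calc (n : ℝ) * ∫ x in (ratioSet p₀ p n)ᶜ, p n x ∂ν ≤
      (n : ℝ) * (4 * ∫ x in (ratioSet p₀ p n)ᶜ, rootDiff p₀ p n x ^ 2 ∂ν) := by gcongr
    _ = 4 * ((n : ℝ) * ∫ x in (ratioSet p₀ p n)ᶜ, rootDiff p₀ p n x ^ 2 ∂ν) := by ring
    _ ≤ _ := by gcongr

/-- The truncated likelihood ratio. -/
noncomputable def ratio (p₀ : 𝒳 → ℝ) (p : ℕ → 𝒳 → ℝ) (n : ℕ) : 𝒳 → ℝ :=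
  (ratioSet p₀ p n).indicator fun x => p n x / p₀ x

theorem measurable_ratio (h : LocalSeq ν p₀ p ℓ σ) (n : ℕ) : Measurable (ratio p₀ p n) :=
  ((h.measurable_dens n).div h.measurable_base).indicator (h.measurableSet_ratioSet n)

theorem ratio_nonneg (h : LocalSeq ν p₀ p ℓ σ) (n : ℕ) (x : 𝒳) : 0 ≤ ratio p₀ p n x :=
  Set.indicator_nonneg (fun x _ => div_nonneg (h.dens_nonneg n x) (h.base_nonneg x)) x

theorem restrict_ratioSet (h : LocalSeq ν p₀ p ℓ σ) (n : ℕ) :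
    (lawOf ν (p n)).restrict (ratioSet p₀ p n) =
      (lawOf ν p₀).withDensity fun x => ENNReal.ofReal (ratio p₀ p n x) := by
  rw [lawOf, restrict_withDensity (h.measurableSet_ratioSet n), ← withDensity_indicator
    (h.measurableSet_ratioSet n), lawOf, ← withDensity_mul _ h.measurable_base.ennreal_ofReal
    (h.measurable_ratio n).ennreal_ofReal]
  congr 1
  funext x
  rw [Pi.mul_apply, ← ENNReal.ofReal_mul (h.base_nonneg x)]
  by_cases hx : x ∈ ratioSet p₀ p n
  · simp only [ratio, Set.indicator_of_mem hx]
    congr 1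
    -- Where p₀ = 0, membership in the ratio set forces pₙ = 0, so the default value 0 of the
    -- quotient is the right one.
    rcases (h.base_nonneg x).eq_or_lt with h0 | h0
    · have : p n x ≤ 4 * p₀ x := hx
      rw [← h0] at this ⊢
      have := h.dens_nonneg n x
      linarith
    · field_simp
  · simp [ratio, hx]

/-- With a = √pₙ, b = √p₀ and d = a - b the claim on the ratio set is a⁴/b² ≤ 2a² - b² + 9d².
Expanding in d, the difference of the sides is d²(5b² - 4bd - d²)/b² = d²(b - d)(5b + d)/b²,
nonnegative because a ≤ 2b gives d ≤ b and a ≥ 0 gives d ≥ -b. -/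
theorem base_mul_ratio_sq_le (h : LocalSeq ν p₀ p ℓ σ) (n : ℕ) (x : 𝒳) :
    p₀ x * ratio p₀ p n x ^ 2 ≤ (ratioSet p₀ p n).indicator (fun x => 2 * p n x - p₀ x) x +
      9 * rootDiff p₀ p n x ^ 2 := by
  by_cases hx : x ∈ ratioSet p₀ p n
  · simp only [ratio, Set.indicator_of_mem hx]
    have hx' : p n x ≤ 4 * p₀ x := hx
    have hp := h.dens_nonneg n x
    rcases (h.base_nonneg x).eq_or_lt with h0 | h0
    · have h00 : p n x = 0 := by linarith
      rw [← h0, h00, rootDiff, h00, ← h0]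
      simp
    · set a := √(p n x) with ha
      set b := √(p₀ x) with hb
      have hb0 : 0 < b := Real.sqrt_pos.2 h0
      have ha0 : 0 ≤ a := Real.sqrt_nonneg _
      have ea : p n x = a ^ 2 := (Real.sq_sqrt hp).symm
      have eb : p₀ x = b ^ 2 := (Real.sq_sqrt h0.le).symm
      have hab : a ≤ 2 * b := by
        rw [ea, eb] at hx'
        nlinarith
      rw [rootDiff, ← ha, ← hb, ea, eb]
      have e : b ^ 2 * (a ^ 2 / b ^ 2) ^ 2 = a ^ 4 / b ^ 2 := by field_simp
      rw [e, div_le_iff₀ (by positivity)]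
      set d := a - b with hd
      have : a = b + d := by rw [hd]; ring
      rw [this]
      have hd1 : d ≤ b := by linarith
      have hd2 : -b ≤ d := by linarith
      nlinarith [mul_nonneg (sq_nonneg d) (by nlinarith : 0 ≤ 5 * b ^ 2 - 4 * b * d - d ^ 2)]
  · simp only [ratio, Set.indicator_of_notMem hx]
    simp only [ne_eq, OfNat.ofNat_ne_zero, not_false_eq_true, zero_pow, mul_zero, zero_add]
    positivity

/-- Integrating the pointwise bound, 2pₙ - p₀ contributes at most 2 - (1 - P₀(Sᶜ)), S being the
ratio set, and P₀(Sᶜ) is at most the squared Hellinger term; with the 9 already present this makes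
10. The excess over 1 is O(1/n), so powers of order n stay bounded. -/
theorem lintegral_ratio_sq_le (h : LocalSeq ν p₀ p ℓ σ) (n : ℕ) :
    ∫⁻ x, ENNReal.ofReal (ratio p₀ p n x) ^ 2 ∂(lawOf ν p₀) ≤
      ENNReal.ofReal (1 + 10 * ∫ x, rootDiff p₀ p n x ^ 2 ∂ν) := by
  haveI := h.prob_base
  haveI := h.prob n
  have hS := h.measurableSet_ratioSet n
  have ip := integrable_density (ν := ν) (h.measurable_dens n) (h.dens_nonneg n)
  have i0 := integrable_density (ν := ν) h.measurable_base h.base_nonneg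
  have iR := (h.memLp_rootDiff n).integrable_sq
  have iI : Integrable (fun x => (ratioSet p₀ p n).indicator (fun x => 2 * p n x - p₀ x) x) ν :=
    ((ip.const_mul 2).sub i0).indicator hS
  have iB : Integrable (fun x => (ratioSet p₀ p n).indicator (fun x => 2 * p n x - p₀ x) x +
      9 * rootDiff p₀ p n x ^ 2) ν := iI.add (iR.const_mul 9)
  have e1 : ∫⁻ x, ENNReal.ofReal (ratio p₀ p n x) ^ 2 ∂(lawOf ν p₀) =
      ∫⁻ x, ENNReal.ofReal (p₀ x * ratio p₀ p n x ^ 2) ∂ν := by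
    rw [lawOf, lintegral_withDensity_eq_lintegral_mul _ h.measurable_base.ennreal_ofReal
      ((h.measurable_ratio n).ennreal_ofReal.pow_const 2)]
    refine lintegral_congr fun x => ?_
    rw [Pi.mul_apply, ENNReal.ofReal_mul (h.base_nonneg x), ENNReal.ofReal_pow (h.ratio_nonneg n x)]
  rw [e1]
  refine (lintegral_mono fun x => ENNReal.ofReal_le_ofReal (h.base_mul_ratio_sq_le n x)).trans ?_
  rw [← ofReal_integral_eq_lintegral_ofReal iB (Eventually.of_forall fun x =>
    (mul_nonneg (h.base_nonneg x) (sq_nonneg _)).trans (h.base_mul_ratio_sq_le n x))]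
  refine ENNReal.ofReal_le_ofReal ?_
  rw [integral_add iI (iR.const_mul 9), integral_indicator hS, integral_sub
    (ip.const_mul 2).integrableOn i0.integrableOn, integral_const_mul, integral_const_mul,
    ← measureReal_lawOf (h.measurable_dens n) (h.dens_nonneg n) hS,
    ← measureReal_lawOf h.measurable_base h.base_nonneg hS]
  have h1 : (lawOf ν (p n)).real (ratioSet p₀ p n) ≤ 1 := measureReal_le_one
  have h2 := probReal_compl_eq_one_sub (μ := lawOf ν p₀) hS
  have h3 := h.base_compl_ratioSet_le n
  linarith

end LocalSeq

end FDTD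

namespace FDTD

/-! ### Contiguity of product laws -/

section Products
variable {𝒳 : Type*} [MeasurableSpace 𝒳] {P P₀ : Measure 𝒳} [IsProbabilityMeasure P]
  [IsProbabilityMeasure P₀]

theorem lintegral_pi_prod {ι : Type*} [Fintype ι] {g : 𝒳 → ℝ≥0∞} (hg : Measurable g) :
    ∫⁻ x : ι → 𝒳, ∏ i, g (x i) ∂(Measure.pi fun _ => P₀) =
      (∫⁻ x, g x ∂P₀) ^ Fintype.card ι := by
  have h := lintegral_prod_eq_prod_lintegral_of_indepFun Finset.univ
    (fun i (x : ι → 𝒳) => g (x i))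
    (iIndepFun_pi (μ := fun _ : ι => P₀) (X := fun _ => g) fun _ => hg.aemeasurable)
    (fun i => hg.comp (measurable_pi_apply i))
  rw [h, ← Finset.card_univ, ← Finset.prod_const]
  exact Finset.prod_congr rfl fun i _ =>
    (measurePreserving_eval (fun _ : ι => P₀) i).lintegral_comp hg

theorem pi_withDensity {ι : Type*} [Fintype ι] {g : 𝒳 → ℝ≥0∞} (hg : Measurable g)
    [SigmaFinite (P₀.withDensity g)] :
    (Measure.pi fun _ : ι => P₀.withDensity g) =
      (Measure.pi fun _ : ι => P₀).withDensity fun x => ∏ i, g (x i) := by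
  refine Measure.pi_eq fun s hs => ?_
  have hm : ∀ i, Measurable ((s i).indicator g) := fun i => hg.indicator (hs i)
  have h := lintegral_prod_eq_prod_lintegral_of_indepFun Finset.univ
    (fun i (x : ι → 𝒳) => (s i).indicator g (x i))
    (iIndepFun_pi (μ := fun _ : ι => P₀) (X := fun i => (s i).indicator g)
      fun i => (hm i).aemeasurable)
    (fun i => (hm i).comp (measurable_pi_apply i))
  rw [withDensity_apply _ (MeasurableSet.univ_pi hs), ← lintegral_indicator
    (MeasurableSet.univ_pi hs)]
  have e : ∀ x : ι → 𝒳, (Set.univ.pi s).indicator (fun x => ∏ i, g (x i)) x =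
      ∏ i, (s i).indicator g (x i) := by
    intro x
    by_cases hx : x ∈ Set.univ.pi s
    · rw [Set.indicator_of_mem hx]
      exact Finset.prod_congr rfl fun i _ => (Set.indicator_of_mem (hx i trivial) _).symm
    · rw [Set.indicator_of_notMem hx]
      simp only [Set.mem_univ_pi, not_forall] at hx
      obtain ⟨i, hi⟩ := hx
      exact (Finset.prod_eq_zero (Finset.mem_univ i) (Set.indicator_of_notMem hi _)).symm
  simp_rw [e]
  rw [h]
  refine Finset.prod_congr rfl fun i _ => ?_
  rw [(measurePreserving_eval (fun _ : ι => P₀) i).lintegral_comp (hm i),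
    lintegral_indicator (hs i), withDensity_apply _ (hs i)]

/-- Either some coordinate leaves S, which a union bound controls, or all stay in S, where the
product law has density ∏ g(xᵢ) and Cauchy–Schwarz separates the event from the second moment of the
density. A measurable hull under P₀ handles arbitrary E. -/
theorem pi_measure_le {ι : Type*} [Fintype ι] {g : 𝒳 → ℝ≥0∞} (hg : Measurable g) {S : Set 𝒳}
    (hS : MeasurableSet S) (hr : P.restrict S = P₀.withDensity g) (E : Set (ι → 𝒳)) :
    (Measure.pi fun _ : ι => P) E ≤ Fintype.card ι * P Sᶜ +
      (Measure.pi fun _ : ι => P₀) E ^ (1 / 2 : ℝ) *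
        ((∫⁻ x, g x ^ 2 ∂P₀) ^ Fintype.card ι) ^ (1 / 2 : ℝ) := by
  haveI : IsFiniteMeasure (P₀.withDensity g) := hr ▸ inferInstance
  set F := toMeasurable (Measure.pi fun _ : ι => P₀) E with hF
  have hFm : MeasurableSet F := measurableSet_toMeasurable _ _
  have hsub : E ⊆ (⋃ i, {x : ι → 𝒳 | x i ∈ Sᶜ}) ∪ (F ∩ Set.univ.pi fun _ => S) := by
    intro x hx
    by_cases hxS : ∀ i, x i ∈ S
    · exact Or.inr ⟨subset_toMeasurable _ _ hx, fun i _ => hxS i⟩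
    · push Not at hxS
      exact Or.inl (Set.mem_iUnion.2 hxS)
  refine (measure_mono hsub).trans ((measure_union_le _ _).trans (add_le_add ?_ ?_))
  · refine (measure_iUnion_fintype_le _ _).trans ?_
    have : ∀ i : ι, (Measure.pi fun _ : ι => P) {x | x i ∈ Sᶜ} = P Sᶜ := fun i =>
      (measurePreserving_eval (fun _ : ι => P) i).measure_preimage hS.compl.nullMeasurableSet
    rw [Finset.sum_congr rfl fun i _ => this i]
    simp
  · rw [← Measure.restrict_apply hFm, Measure.restrict_pi_pi]
    simp_rw [hr]
    rw [pi_withDensity hg, withDensity_apply _ hFm, ← lintegral_indicator hFm,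
      ← measure_toMeasurable E, ← hF]
    have hpm : Measurable fun x : ι → 𝒳 => ∏ i, g (x i) :=
      Finset.measurable_fun_prod _ fun i _ => hg.comp (measurable_pi_apply i)
    have h := ENNReal.lintegral_mul_le_Lp_mul_Lq (Measure.pi fun _ : ι => P₀)
      Real.HolderConjugate.two_two (f := F.indicator 1) (g := fun x : ι → 𝒳 => ∏ i, g (x i))
      (measurable_one.indicator hFm).aemeasurable hpm.aemeasurable
    have e1 : ∀ x : ι → 𝒳, F.indicator (fun x => ∏ i, g (x i)) x =
        ((F.indicator 1 : (ι → 𝒳) → ℝ≥0∞) * fun x : ι → 𝒳 => ∏ i, g (x i)) x := by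
      intro x
      by_cases hx : x ∈ F <;> simp [hx]
    have e2 : ∀ x : ι → 𝒳, (F.indicator 1 x : ℝ≥0∞) ^ (2 : ℝ) = F.indicator 1 x := by
      intro x
      by_cases hx : x ∈ F <;> simp [hx]
    simp_rw [e1]
    refine h.trans_eq ?_
    simp_rw [e2, ENNReal.rpow_ofNat, ← Finset.prod_pow]
    rw [lintegral_indicator_one hFm, lintegral_pi_prod (hg.pow_const 2)]

end Products

/-! ### Contiguity of the sample laws -/

section SampleContiguity
variable {𝒜 𝒵 𝒞 : Type u} [MeasurableSpace 𝒜] [MeasurableSpace 𝒵] [MeasurableSpace 𝒞]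

theorem sampleLaw_eq_pi (P : Measure (Obs 𝒜 𝒵 𝒞)) [IsProbabilityMeasure P] (n r : ℕ)
    (E : Set (Sample 𝒜 𝒵 𝒞 n r)) :
    sampleLaw P n r E = (Measure.pi fun _ : Fin n ⊕ Fin r => P)
      (MeasurableEquiv.sumPiEquivProdPi (fun _ : Fin n ⊕ Fin r => Obs 𝒜 𝒵 𝒞) ⁻¹' E) :=
  ((measurePreserving_sumPiEquivProdPi (fun _ : Fin n ⊕ Fin r => P)).measure_preimage_equiv E).symm

variable {ν : Measure (Obs 𝒜 𝒵 𝒞)} {p₀ : Obs 𝒜 𝒵 𝒞 → ℝ} {p : ℕ → Obs 𝒜 𝒵 𝒞 → ℝ}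
  {ℓ : ℕ → Obs 𝒜 𝒵 𝒞 → ℝ} {σ : Obs 𝒜 𝒵 𝒞 → ℝ}

/-- The two blocks of observations form one product of n + r copies; the power of the second moment
is bounded through 1 + x ≤ exp x. -/
theorem LocalSeq.sampleLaw_le (h : LocalSeq ν p₀ p ℓ σ) (n r : ℕ)
    (E : Set (Sample 𝒜 𝒵 𝒞 n r)) :
    sampleLaw (lawOf ν (p n)) n r E ≤
      ENNReal.ofReal ((n + r : ℕ) * (lawOf ν (p n)).real (LocalSeq.ratioSet p₀ p n)ᶜ) +
      sampleLaw (lawOf ν p₀) n r E ^ (1 / 2 : ℝ) *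
        ENNReal.ofReal (Real.exp (10 * ((n + r : ℕ) * ∫ x, LocalSeq.rootDiff p₀ p n x ^ 2 ∂ν)))
          ^ (1 / 2 : ℝ) := by
  haveI := h.prob_base
  haveI := h.prob n
  rw [sampleLaw_eq_pi, sampleLaw_eq_pi]
  refine (pi_measure_le (h.measurable_ratio n).ennreal_ofReal (h.measurableSet_ratioSet n)
    (h.restrict_ratioSet n) _).trans (add_le_add (le_of_eq ?_) ?_)
  · rw [ENNReal.ofReal_mul (Nat.cast_nonneg _), ENNReal.ofReal_natCast, ofReal_measureReal]
    simp
  · refine mul_le_mul_right ?_ _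
    refine ENNReal.rpow_le_rpow ?_ (by norm_num)
    refine (pow_le_pow_left' (h.lintegral_ratio_sq_le n) _).trans ?_
    have hR : 0 ≤ ∫ x, LocalSeq.rootDiff p₀ p n x ^ 2 ∂ν := integral_nonneg fun x => sq_nonneg _
    rw [← ENNReal.ofReal_pow (by positivity)]
    refine ENNReal.ofReal_le_ofReal ?_
    rw [Fintype.card_sum, Fintype.card_fin, Fintype.card_fin,
      show 10 * (((n + r : ℕ) : ℝ) * ∫ x, LocalSeq.rootDiff p₀ p n x ^ 2 ∂ν) =
        ((n + r : ℕ) : ℝ) * (10 * ∫ x, LocalSeq.rootDiff p₀ p n x ^ 2 ∂ν) by ring, Real.exp_nat_mul]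
    refine pow_le_pow_left₀ (by positivity) ?_ _
    rw [add_comm]
    exact Real.add_one_le_exp _

theorem exists_sample_size_bound {r : ℕ → ℕ}
    (hr : (fun n => (r n : ℝ)) =O[atTop] (fun n => (n : ℝ))) :
    ∃ C : ℝ, 0 ≤ C ∧ ∀ᶠ n : ℕ in atTop, ((n + r n : ℕ) : ℝ) ≤ C * n := by
  obtain ⟨C, hC, hb⟩ := hr.exists_pos
  refine ⟨1 + C, by positivity, ?_⟩
  filter_upwards [hb.bound] with n hn
  rw [Real.norm_natCast, Real.norm_natCast] at hn
  push_cast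
  linarith

/-- Since n + r n = O(n), the probability of leaving the ratio set vanishes and the exponential
factor stays bounded, so the base probability, under a square root, decides. -/
theorem LocalSeq.tendsto_measure_zero (h : LocalSeq ν p₀ p ℓ σ) {r : ℕ → ℕ}
    (hr : (fun n => (r n : ℝ)) =O[atTop] (fun n => (n : ℝ)))
    {E : ∀ n, Set (Sample 𝒜 𝒵 𝒞 n (r n))}
    (hE : Tendsto (fun n => sampleLaw (lawOf ν p₀) n (r n) (E n)) atTop (𝓝 0)) :
    Tendsto (fun n => sampleLaw (lawOf ν (p n)) n (r n) (E n)) atTop (𝓝 0) := by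
  obtain ⟨C, hC0, hC⟩ := exists_sample_size_bound hr
  obtain ⟨D, hD0, hD⟩ := h.exists_rootDiff_bound
  have l1 : Tendsto (fun n : ℕ => ENNReal.ofReal (C * ((n : ℝ) *
      (lawOf ν (p n)).real (LocalSeq.ratioSet p₀ p n)ᶜ))) atTop (𝓝 0) := by
    have := ENNReal.tendsto_ofReal (h.tendsto_compl_ratioSet.const_mul C)
    simpa only [mul_zero, ENNReal.ofReal_zero] using this
  have l2 : Tendsto (fun n => sampleLaw (lawOf ν p₀) n (r n) (E n) ^ (1 / 2 : ℝ) *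
      ENNReal.ofReal (Real.exp (10 * (C * D))) ^ (1 / 2 : ℝ)) atTop (𝓝 0) := by
    have h1 := hE.ennrpow_const (1 / 2)
    rw [ENNReal.zero_rpow_of_pos (by norm_num)] at h1
    have := ENNReal.Tendsto.mul_const h1 (b := ENNReal.ofReal (Real.exp (10 * (C * D))) ^ (1 / 2 : ℝ))
      (Or.inr (ENNReal.rpow_ne_top_of_nonneg (by norm_num) ENNReal.ofReal_ne_top))
    rwa [zero_mul] at this
  have l3 := l1.add l2
  rw [add_zero] at l3
  refine tendsto_of_tendsto_of_tendsto_of_le_of_le' tendsto_const_nhds l3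
    (Eventually.of_forall fun _ => zero_le) ?_
  filter_upwards [hC] with n hn
  refine (h.sampleLaw_le n (r n) (E n)).trans (add_le_add ?_ ?_)
  · refine ENNReal.ofReal_le_ofReal ?_
    rw [← mul_assoc]
    exact mul_le_mul_of_nonneg_right hn measureReal_nonneg
  · refine mul_le_mul_right (ENNReal.rpow_le_rpow (ENNReal.ofReal_le_ofReal
      (Real.exp_le_exp.2 ?_)) (by norm_num)) _
    have hR : 0 ≤ ∫ x, LocalSeq.rootDiff p₀ p n x ^ 2 ∂ν := integral_nonneg fun x => sq_nonneg _
    have := mul_le_mul_of_nonneg_right hn hR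
    have h2 := mul_le_mul_of_nonneg_left (hD n) hC0
    nlinarith

theorem LocalSeq.tendsZero (h : LocalSeq ν p₀ p ℓ σ) {r : ℕ → ℕ}
    (hr : (fun n => (r n : ℝ)) =O[atTop] (fun n => (n : ℝ)))
    {f : ∀ n, Sample 𝒜 𝒵 𝒞 n (r n) → ℝ}
    (hf : TendsZero (fun n => sampleLaw (lawOf ν p₀) n (r n)) f) :
    TendsZero (fun n => sampleLaw (lawOf ν (p n)) n (r n)) f :=
  fun ε hε => h.tendsto_measure_zero hr (hf ε hε)

end SampleContiguity

end FDTD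

namespace FDTD

/-! ### Means under local sequences -/

namespace LocalSeq

variable {𝒳 : Type*} [MeasurableSpace 𝒳] {ν : Measure 𝒳} {p₀ : 𝒳 → ℝ} {p : ℕ → 𝒳 → ℝ}
  {ℓ : ℕ → 𝒳 → ℝ} {σ : 𝒳 → ℝ}

theorem tendsto_sqrt_remainder (h : LocalSeq ν p₀ p ℓ σ) :
    Tendsto (fun n : ℕ => √(n : ℝ) * √(∫ x, remainder p₀ p ℓ n x ^ 2 ∂ν)) atTop (𝓝 0) := by
  have := (Real.continuous_sqrt.tendsto 0).comp h.tendsto_remainder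
  rw [Real.sqrt_zero] at this
  refine this.congr fun n => ?_
  simp only [Function.comp_apply]
  rw [Real.sqrt_mul (Nat.cast_nonneg n)]

theorem tendsto_bound_tail (h : LocalSeq ν p₀ p ℓ σ) :
    Tendsto (fun K : ℕ => ∫ x, ({x | (K : ℝ) < σ x}.indicator σ x * √(p₀ x)) ^ 2 ∂ν) atTop
      (𝓝 0) := by
  have hm : ∀ K : ℕ, MeasurableSet {x | (K : ℝ) < σ x} := fun K =>
    measurableSet_lt measurable_const h.measurable_bound
  have := tendsto_integral_of_dominated_convergence (μ := ν)
    (F := fun (K : ℕ) x => ({x | (K : ℝ) < σ x}.indicator σ x * √(p₀ x)) ^ 2) (f := fun _ => 0)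
    (fun x => (σ x * √(p₀ x)) ^ 2)
    (fun K => (((h.measurable_bound.indicator (hm K)).mul
      h.measurable_base.sqrt).pow_const 2).aestronglyMeasurable)
    h.integrable_bound_sq
    (fun K => Eventually.of_forall fun x => by
      by_cases hx : x ∈ {x | (K : ℝ) < σ x}
      · rw [Set.indicator_of_mem hx, Real.norm_of_nonneg (sq_nonneg _)]
      · rw [Set.indicator_of_notMem hx]
        simp only [zero_mul, ne_eq, OfNat.ofNat_ne_zero, not_false_eq_true, zero_pow, norm_zero]
        positivity)
    (Eventually.of_forall fun x => by
      refine tendsto_const_nhds.congr' ?_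
      filter_upwards [eventually_ge_atTop ⌈σ x⌉₊] with K hK
      have hK' : (⌈σ x⌉₊ : ℝ) ≤ K := Nat.cast_le.2 hK
      have : x ∉ {x | (K : ℝ) < σ x} := fun hx : (K : ℝ) < σ x =>
        absurd hx (not_lt.2 ((Nat.le_ceil (σ x)).trans hK'))
      rw [Set.indicator_of_notMem this]
      simp)
  simpa using this

/-- First order expansion of the mean of a function with bounded second moments. -/
theorem tendsto_mean_expansion (h : LocalSeq ν p₀ p ℓ σ) {g : 𝒳 → ℝ} (hg : Measurable g)
    (hg0 : MemLp g 2 (lawOf ν p₀)) (hgn : ∀ n, MemLp g 2 (lawOf ν (p n))) {B : ℝ}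
    (hB : ∀ n, ∫ x, g x ^ 2 ∂(lawOf ν (p n)) ≤ B) :
    Tendsto (fun n : ℕ => √(n : ℝ) * (∫ x, g x ∂(lawOf ν (p n)) - ∫ x, g x ∂(lawOf ν p₀) -
      ∫ x, g x * ℓ n x ∂(lawOf ν p₀))) atTop (𝓝 0) := by
  haveI := h.prob_base
  haveI := h.prob
  set B₀ := ∫ x, g x ^ 2 ∂(lawOf ν p₀) with hB₀
  have m0 : MemLp (fun x => g x * √(p₀ x)) 2 ν :=
    memLp_mul_sqrt_density h.measurable_base h.base_nonneg hg hg0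
  have mn : ∀ n, MemLp (fun x => g x * √(p n x)) 2 ν := fun n =>
    memLp_mul_sqrt_density (h.measurable_dens n) (h.dens_nonneg n) hg (hgn n)
  have e0 : ∫ x, (g x * √(p₀ x)) ^ 2 ∂ν = B₀ :=
    integral_sq_mul_sqrt_density h.measurable_base h.base_nonneg g
  have en : ∀ n, ∫ x, (g x * √(p n x)) ^ 2 ∂ν ≤ B := fun n =>
    (integral_sq_mul_sqrt_density (h.measurable_dens n) (h.dens_nonneg n) g).trans_le (hB n)
  have mΔ := h.memLp_rootDiff
  have mgΔ : ∀ n, MemLp (fun x => g x * rootDiff p₀ p n x) 2 ν := fun n => by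
    refine ((mn n).sub m0).ae_eq (Eventually.of_forall fun x => ?_)
    simp only [rootDiff, Pi.sub_apply]; ring
  have mgs : ∀ n, MemLp (fun x => g x * (√(p n x) + √(p₀ x))) 2 ν := fun n => by
    refine ((mn n).add m0).ae_eq (Eventually.of_forall fun x => ?_)
    simp only [Pi.add_apply]; ring
  have sqb : ∀ n (f : 𝒳 → ℝ), (∀ x, f x ^ 2 ≤ 2 * (g x * √(p n x)) ^ 2 +
      2 * (g x * √(p₀ x)) ^ 2) → MemLp f 2 ν → ∫ x, f x ^ 2 ∂ν ≤ 2 * B + 2 * B₀ := by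
    intro n f hf hfm
    have i1 := (mn n).integrable_sq.const_mul 2
    have i2 := m0.integrable_sq.const_mul 2
    refine (integral_mono hfm.integrable_sq (i1.add i2) hf).trans ?_
    simp only [Pi.add_apply]
    rw [integral_add i1 i2, integral_const_mul, integral_const_mul, e0]
    linarith [en n]
  have bΔ : ∀ n, ∫ x, (g x * rootDiff p₀ p n x) ^ 2 ∂ν ≤ 2 * B + 2 * B₀ := fun n =>
    sqb n _ (fun x => by
      rw [rootDiff]
      nlinarith [sq_nonneg (g x * √(p n x) + g x * √(p₀ x))]) (mgΔ n)
  have bs : ∀ n, ∫ x, (g x * (√(p n x) + √(p₀ x))) ^ 2 ∂ν ≤ 2 * B + 2 * B₀ := fun n =>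
    sqb n _ (fun x => by nlinarith [sq_nonneg (g x * √(p n x) - g x * √(p₀ x))]) (mgs n)
  set D := √(2 * B + 2 * B₀) with hD
  have mtail : ∀ K : ℕ, MemLp (fun x => {x | (K : ℝ) < σ x}.indicator σ x * √(p₀ x)) 2 ν :=
    fun K => memLp_mul_sqrt_density h.measurable_base h.base_nonneg
      (h.measurable_bound.indicator (measurableSet_lt measurable_const h.measurable_bound))
      (h.memLp_bound.indicator (measurableSet_lt measurable_const h.measurable_bound))
  set τ : ℕ → ℝ := fun K =>
    ∫ x, ({x | (K : ℝ) < σ x}.indicator σ x * √(p₀ x)) ^ 2 ∂ν with hτ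
  -- the difference as an integral against `ν`
  have key : ∀ n, ∫ x, g x ∂(lawOf ν (p n)) - ∫ x, g x ∂(lawOf ν p₀) -
      ∫ x, g x * ℓ n x ∂(lawOf ν p₀) =
      ∫ x, (g x * (√(p n x) + √(p₀ x))) * remainder p₀ p ℓ n x ∂ν +
      ∫ x, 1 / 2 * ((ℓ n x * √(p₀ x)) * (g x * rootDiff p₀ p n x)) ∂ν := by
    intro n
    have j1 := (integrable_lawOf_iff (ν := ν) (h.measurable_dens n) (h.dens_nonneg n)).1
      ((hgn n).integrable one_le_two)
    have j2 := (integrable_lawOf_iff (ν := ν) h.measurable_base h.base_nonneg).1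
      (hg0.integrable one_le_two)
    have j3 : Integrable (fun x => p₀ x • (g x * ℓ n x)) ν :=
      (integrable_lawOf_iff (ν := ν) h.measurable_base h.base_nonneg).1
      (hg0.integrable_mul (h.memLp_score n))
    have j4 : Integrable (fun x => g x * (√(p n x) + √(p₀ x)) * remainder p₀ p ℓ n x) ν :=
      (mgs n).integrable_mul (h.memLp_remainder n)
    have j5 : Integrable (fun x => 1 / 2 * ((ℓ n x * √(p₀ x)) * (g x * rootDiff p₀ p n x))) ν :=
      ((h.memLp_score_mul n).integrable_mul (mgΔ n)).const_mul _
    have j12 : Integrable (fun x => p n x • g x - p₀ x • g x) ν := j1.sub j2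
    rw [integral_lawOf (h.measurable_dens n) (h.dens_nonneg n), integral_lawOf h.measurable_base
      h.base_nonneg, integral_lawOf h.measurable_base h.base_nonneg, ← integral_sub j1 j2,
      ← integral_sub j12 j3, ← integral_add j4 j5]
    refine integral_congr_ae (Eventually.of_forall fun x => ?_)
    simp only [smul_eq_mul, remainder, rootDiff]
    have s1 := Real.sq_sqrt (h.base_nonneg x)
    have s2 := Real.sq_sqrt (h.dens_nonneg n x)
    generalize √(p n x) = a at *
    generalize √(p₀ x) = b at *
    rw [← s1, ← s2]
    ring
  -- Truncation σ ≤ K + σ·1{σ > K}: the bounded part meets the root difference, which tends to zero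
  -- in L², while the tail meets g times the root difference, of which only boundedness in L² is
  -- known.
  have bound : ∀ (K n : ℕ), |√(n : ℝ) * (∫ x, g x ∂(lawOf ν (p n)) - ∫ x, g x ∂(lawOf ν p₀) -
      ∫ x, g x * ℓ n x ∂(lawOf ν p₀))| ≤
      D * (√(n : ℝ) * √(∫ x, remainder p₀ p ℓ n x ^ 2 ∂ν)) +
      (K * (√B₀ * √(∫ x, rootDiff p₀ p n x ^ 2 ∂ν)) + √(τ K) * D) := by
    intro K n
    rw [key n, abs_mul, abs_of_nonneg (Real.sqrt_nonneg _), integral_const_mul]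
    have t1 : |∫ x, (g x * (√(p n x) + √(p₀ x))) * remainder p₀ p ℓ n x ∂ν| ≤
        D * √(∫ x, remainder p₀ p ℓ n x ^ 2 ∂ν) := by
      refine (abs_integral_le_integral_abs).trans
        ((integral_abs_mul_le_sqrt (mgs n) (h.memLp_remainder n)).trans ?_)
      gcongr
      exact Real.sqrt_le_sqrt (bs n)
    have i1 : Integrable (fun x => |(g x * √(p₀ x)) * rootDiff p₀ p n x|) ν :=
      (m0.integrable_mul (mΔ n)).abs
    have i2 : Integrable (fun x => |({x | (K : ℝ) < σ x}.indicator σ x * √(p₀ x)) *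
        (g x * rootDiff p₀ p n x)|) ν := ((mtail K).integrable_mul (mgΔ n)).abs
    have i3 := ((h.memLp_score_mul n).integrable_mul (mgΔ n)).abs
    have t2 : √(n : ℝ) * |∫ x, (ℓ n x * √(p₀ x)) * (g x * rootDiff p₀ p n x) ∂ν| ≤
        K * (√B₀ * √(∫ x, rootDiff p₀ p n x ^ 2 ∂ν)) + √(τ K) * D := by
      calc √(n : ℝ) * |∫ x, (ℓ n x * √(p₀ x)) * (g x * rootDiff p₀ p n x) ∂ν|
          ≤ √(n : ℝ) * ∫ x, |(ℓ n x * √(p₀ x)) * (g x * rootDiff p₀ p n x)| ∂ν := by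
            gcongr
            exact abs_integral_le_integral_abs
        _ = ∫ x, √(n : ℝ) * |(ℓ n x * √(p₀ x)) * (g x * rootDiff p₀ p n x)| ∂ν :=
            (integral_const_mul _ _).symm
        _ ≤ ∫ x, (K * |(g x * √(p₀ x)) * rootDiff p₀ p n x| +
            |({x | (K : ℝ) < σ x}.indicator σ x * √(p₀ x)) *
              (g x * rootDiff p₀ p n x)|) ∂ν := by
            refine integral_mono (i3.const_mul _) ((i1.const_mul _).add i2) fun x => ?_
            have hσ := h.score_le n x
            have hs := Real.sqrt_nonneg (p₀ x)
            simp only [abs_mul, abs_of_nonneg hs]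
            have hx : σ x ≤ K + |{x | (K : ℝ) < σ x}.indicator σ x| := by
              by_cases hx : x ∈ {x | (K : ℝ) < σ x}
              · rw [Set.indicator_of_mem hx, abs_of_nonneg (h.bound_nonneg x)]
                linarith [Nat.cast_nonneg (α := ℝ) K]
              · rw [Set.indicator_of_notMem hx, abs_zero, add_zero]
                exact not_lt.1 hx
            have := mul_le_mul_of_nonneg_right (hσ.trans hx)
              (by positivity : 0 ≤ √(p₀ x) * (|g x| * |rootDiff p₀ p n x|))
            linarith
        _ = K * ∫ x, |(g x * √(p₀ x)) * rootDiff p₀ p n x| ∂ν +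
            ∫ x, |({x | (K : ℝ) < σ x}.indicator σ x * √(p₀ x)) *
              (g x * rootDiff p₀ p n x)| ∂ν := by
            rw [integral_add (i1.const_mul _) i2, integral_const_mul]
        _ ≤ _ := by
            gcongr
            · exact (integral_abs_mul_le_sqrt m0 (mΔ n)).trans_eq (by rw [e0])
            · refine (integral_abs_mul_le_sqrt (mtail K) (mgΔ n)).trans ?_
              gcongr
              exact Real.sqrt_le_sqrt (bΔ n)
    have hs := Real.sqrt_nonneg (n : ℝ)
    have t3 := mul_le_mul_of_nonneg_left t1 hs
    set I1 := ∫ x, (g x * (√(p n x) + √(p₀ x))) * remainder p₀ p ℓ n x ∂ν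
    set I2 := ∫ x, (ℓ n x * √(p₀ x)) * (g x * rootDiff p₀ p n x) ∂ν
    have t4 : |I1 + 1 / 2 * I2| ≤ |I1| + |I2| := by
      refine (abs_add_le _ _).trans ?_
      rw [abs_mul, abs_of_nonneg (by norm_num : (0 : ℝ) ≤ 1 / 2)]
      linarith [abs_nonneg I2]
    have t5 := mul_le_mul_of_nonneg_left t4 hs
    linarith
  rw [Metric.tendsto_atTop']
  intro ε hε
  have hτ0 : Tendsto (fun K => √(τ K) * D) atTop (𝓝 0) := by
    have := ((Real.continuous_sqrt.tendsto 0).comp h.tendsto_bound_tail).mul_const D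
    simpa using this
  -- K is fixed first, making the tail smaller than ε/2 uniformly in n; the other terms vanish for
  -- this K.
  obtain ⟨K, hK⟩ := (hτ0.eventually_lt_const (half_pos hε)).exists
  have hlim : Tendsto (fun n : ℕ => D * (√(n : ℝ) * √(∫ x, remainder p₀ p ℓ n x ^ 2 ∂ν)) +
      (K * (√B₀ * √(∫ x, rootDiff p₀ p n x ^ 2 ∂ν)))) atTop (𝓝 0) := by
    have r0 := (Real.continuous_sqrt.tendsto 0).comp h.tendsto_rootDiff
    rw [Real.sqrt_zero] at r0
    have := (h.tendsto_sqrt_remainder.const_mul D).add ((r0.const_mul (√B₀)).const_mul (K : ℝ))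
    simpa only [mul_zero, add_zero, Function.comp_def] using this
  obtain ⟨n₀, hn₀⟩ := eventually_atTop.1 (hlim.eventually_lt_const (half_pos hε))
  refine ⟨n₀, fun n hn => ?_⟩
  rw [Real.dist_0_eq_abs]
  have := bound K n
  have := hn₀ n hn.le
  linarith

end LocalSeq

end FDTD

namespace FDTD

/-! ### Characteristic functions under local sequences -/

/-- `exp (i y) - 1`. -/
noncomputable def expSubOne (y : ℝ) : ℂ := Complex.exp (Complex.I * y) - 1

theorem measurable_expSubOne : Measurable expSubOne := by
  unfold expSubOne
  fun_prop

theorem norm_expSubOne_le (y : ℝ) : ‖expSubOne y‖ ≤ |y| :=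
  Real.norm_exp_I_mul_ofReal_sub_one_le

theorem norm_expSubOne_le_two (y : ℝ) : ‖expSubOne y‖ ≤ 2 := by
  refine (norm_sub_le _ _).trans ?_
  rw [Complex.norm_exp_I_mul_ofReal, norm_one]
  norm_num

theorem norm_expSubOne_sub_le (y : ℝ) : ‖expSubOne y - Complex.I * y‖ ≤ 2 * y ^ 2 := by
  have hy : ‖Complex.I * (y : ℂ)‖ = |y| := by simp
  rcases le_total |y| 1 with h | h
  · have := Complex.norm_exp_sub_one_sub_id_le (x := Complex.I * y) (by rwa [hy])
    rw [hy, sq_abs] at this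
    exact this.trans (by nlinarith [sq_nonneg y])
  · refine (norm_sub_le _ _).trans ?_
    rw [hy]
    have := norm_expSubOne_le y
    nlinarith [sq_abs y]

theorem norm_expSubOne_taylor_le (y : ℝ) :
    ‖expSubOne y - Complex.I * y + (y : ℂ) ^ 2 / 2‖ ≤ |y| ^ 3 * Real.exp |y| := by
  have h := Complex.norm_exp_sub_sum_le_norm_mul_exp (Complex.I * y) 3
  have hy : ‖Complex.I * (y : ℂ)‖ = |y| := by simp
  rw [hy] at h
  refine le_of_eq_of_le ?_ h
  congr 1
  simp only [Finset.sum_range_succ, Finset.sum_range_zero, expSubOne, mul_pow, Complex.I_sq]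
  norm_num
  ring

theorem nat_mul_div_sqrt_sq_le (n : ℕ) (y : ℝ) : (n : ℝ) * (y / √(n : ℝ)) ^ 2 ≤ y ^ 2 := by
  rcases Nat.eq_zero_or_pos n with rfl | hn
  · simpa using sq_nonneg y
  · have : (0 : ℝ) < n := by exact_mod_cast hn
    rw [div_pow, Real.sq_sqrt this.le, mul_div_cancel₀ _ this.ne']

theorem sqrt_mul_abs_div_sqrt_le (n : ℕ) (y : ℝ) : √(n : ℝ) * |y / √(n : ℝ)| ≤ |y| := by
  have := Real.sqrt_le_sqrt (nat_mul_div_sqrt_sq_le n y)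
  rwa [Real.sqrt_mul (Nat.cast_nonneg n), Real.sqrt_sq_eq_abs, Real.sqrt_sq_eq_abs] at this

theorem tendsto_div_sqrt_nat (y : ℝ) : Tendsto (fun n : ℕ => y / √(n : ℝ)) atTop (𝓝 0) :=
  tendsto_const_nhds.div_atTop (Real.tendsto_sqrt_atTop.comp tendsto_natCast_atTop_atTop)

theorem tendsto_nat_mul_expSubOne_sub (y : ℝ) :
    Tendsto (fun n : ℕ => (n : ℂ) * (expSubOne (y / √(n : ℝ)) - Complex.I * (y / √(n : ℝ) : ℝ)))
      atTop (𝓝 (-(y : ℂ) ^ 2 / 2)) := by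
  have hb : Tendsto (fun n : ℕ => y ^ 2 * (|y / √(n : ℝ)| * Real.exp |y / √(n : ℝ)|)) atTop
      (𝓝 0) := by
    have h0 := (tendsto_div_sqrt_nat y).abs
    rw [abs_zero] at h0
    have := (h0.mul ((Real.continuous_exp.tendsto 0).comp h0)).const_mul (y ^ 2)
    simpa only [zero_mul, mul_zero, Function.comp_def] using this
  rw [tendsto_iff_norm_sub_tendsto_zero]
  refine squeeze_zero' (Eventually.of_forall fun _ => norm_nonneg _) ?_ hb
  filter_upwards [eventually_gt_atTop 0] with n hn
  have hn' : (0 : ℝ) < n := by exact_mod_cast hn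
  set s := y / √(n : ℝ) with hs
  have hs2 : (n : ℝ) * s ^ 2 = y ^ 2 := by
    rw [hs, div_pow, Real.sq_sqrt hn'.le, mul_div_cancel₀ _ hn'.ne']
  have e : (n : ℂ) * (expSubOne s - Complex.I * s) - -(y : ℂ) ^ 2 / 2 =
      n * (expSubOne s - Complex.I * s + (s : ℂ) ^ 2 / 2) := by
    have : (n : ℂ) * (s : ℂ) ^ 2 = (y : ℂ) ^ 2 := by exact_mod_cast hs2
    linear_combination (-1 / 2 : ℂ) * this
  rw [e, norm_mul, Complex.norm_natCast]
  refine (mul_le_mul_of_nonneg_left (norm_expSubOne_taylor_le s) hn'.le).trans_eq ?_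
  rw [← hs2, ← sq_abs s]
  ring

theorem tendsto_sqrt_mul_expSubOne_sub (y : ℝ) :
    Tendsto (fun n : ℕ => √(n : ℝ) * ‖expSubOne (y / √(n : ℝ)) - Complex.I * (y / √(n : ℝ) : ℝ)‖)
      atTop (𝓝 0) := by
  refine squeeze_zero (fun n => by positivity) (fun n => ?_) (tendsto_div_sqrt_nat (2 * y ^ 2))
  rcases Nat.eq_zero_or_pos n with rfl | hn
  · simp
  · have hn' : (0 : ℝ) < √(n : ℝ) := Real.sqrt_pos.2 (by exact_mod_cast hn)
    rw [le_div_iff₀ hn']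
    have h1 := mul_le_mul_of_nonneg_left (norm_expSubOne_sub_le (y / √(n : ℝ)))
      (Nat.cast_nonneg (α := ℝ) n)
    have h2 := nat_mul_div_sqrt_sq_le n y
    have h3 := Real.mul_self_sqrt (Nat.cast_nonneg (α := ℝ) n)
    calc _ = (√(n : ℝ) * √(n : ℝ)) * ‖expSubOne (y / √(n : ℝ)) - Complex.I * (y / √(n : ℝ) : ℝ)‖ := by
          ring
      _ ≤ _ := by rw [h3]; linarith

namespace LocalSeq

variable {𝒳 : Type*} [MeasurableSpace 𝒳] {ν : Measure 𝒳} {p₀ : 𝒳 → ℝ} {p : ℕ → 𝒳 → ℝ}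
  {ℓ : ℕ → 𝒳 → ℝ} {σ : 𝒳 → ℝ} {φ : 𝒳 → ℝ}

/-- The central limit part under a fixed law: n(exp(iy/√n) - 1 - iy/√n) tends to -y²/2 and is
dominated by 2y². -/
theorem tendsto_charFun_base {P : Measure 𝒳} (hφ : Measurable φ) (hφ2 : MemLp φ 2 P) (u : ℝ) :
    Tendsto (fun n : ℕ => ∫ x, (n : ℂ) * (expSubOne (u * φ x / √(n : ℝ)) -
      Complex.I * (u * φ x / √(n : ℝ) : ℝ)) ∂P) atTop
      (𝓝 (-((u ^ 2 * ∫ x, φ x ^ 2 ∂P : ℝ) : ℂ) / 2)) := by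
  have e : -((u ^ 2 * ∫ x, φ x ^ 2 ∂P : ℝ) : ℂ) / 2 =
      ∫ x, (-((u * φ x : ℝ) : ℂ) ^ 2 / 2) ∂P := by
    rw [← integral_const_mul, ← integral_complex_ofReal, ← integral_neg, ← integral_div]
    refine integral_congr_ae (Eventually.of_forall fun x => ?_)
    push_cast; ring
  rw [e]
  refine tendsto_integral_of_dominated_convergence (fun x => 2 * (u * φ x) ^ 2) (fun n => ?_)
    ((hφ2.const_mul u).integrable_sq.const_mul 2)
    (fun n => Eventually.of_forall fun x => ?_)
    (Eventually.of_forall fun x => tendsto_nat_mul_expSubOne_sub _)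
  · have := measurable_expSubOne
    exact Measurable.aestronglyMeasurable (by fun_prop)
  · rw [norm_mul, Complex.norm_natCast]
    have := mul_le_mul_of_nonneg_left (norm_expSubOne_sub_le (u * φ x / √(n : ℝ)))
      (Nat.cast_nonneg (α := ℝ) n)
    have h2 := nat_mul_div_sqrt_sq_le n (u * φ x)
    linarith

theorem integrable_bound_mul (h : LocalSeq ν p₀ p ℓ σ) (hφ2 : MemLp φ 2 (lawOf ν p₀)) :
    Integrable (fun x => σ x * |φ x|) (lawOf ν p₀) := by
  refine ((h.memLp_bound.integrable_mul hφ2).abs).congr (Eventually.of_forall fun x => ?_)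
  simp only [Pi.mul_apply]
  rw [abs_mul, abs_of_nonneg (h.bound_nonneg x)]

/-- √n|ℓₙ| is dominated by σ, and √n times the second-order remainder of the exponential tends to
zero pointwise and is at most 2|uφ|. So the score acts to first order through the linear term only.
-/
theorem tendsto_charFun_score (h : LocalSeq ν p₀ p ℓ σ) (hφ : Measurable φ)
    (hφ2 : MemLp φ 2 (lawOf ν p₀)) (u : ℝ) :
    Tendsto (fun n : ℕ => ∫ x, (n : ℂ) * ℓ n x * (expSubOne (u * φ x / √(n : ℝ)) -
      Complex.I * (u * φ x / √(n : ℝ) : ℝ)) ∂(lawOf ν p₀)) atTop (𝓝 0) := by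
  have hle : ∀ (n : ℕ) x, ‖(n : ℂ) * ℓ n x * (expSubOne (u * φ x / √(n : ℝ)) -
      Complex.I * (u * φ x / √(n : ℝ) : ℝ))‖ ≤ σ x * (√(n : ℝ) *
      ‖expSubOne (u * φ x / √(n : ℝ)) - Complex.I * (u * φ x / √(n : ℝ) : ℝ)‖) := by
    intro n x
    rw [norm_mul, norm_mul, Complex.norm_natCast, Complex.norm_real, Real.norm_eq_abs]
    have hnn := Real.mul_self_sqrt (Nat.cast_nonneg (α := ℝ) n)
    have := mul_le_mul_of_nonneg_right (h.score_le n x) (by positivity : 0 ≤ √(n : ℝ) *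
      ‖expSubOne (u * φ x / √(n : ℝ)) - Complex.I * (u * φ x / √(n : ℝ) : ℝ)‖)
    refine le_of_eq_of_le ?_ this
    linear_combination (-|ℓ n x| * ‖expSubOne (u * φ x / √(n : ℝ)) -
      Complex.I * (u * φ x / √(n : ℝ) : ℝ)‖) * hnn
  have := tendsto_integral_of_dominated_convergence (μ := lawOf ν p₀)
    (F := fun (n : ℕ) x => (n : ℂ) * ℓ n x * (expSubOne (u * φ x / √(n : ℝ)) -
      Complex.I * (u * φ x / √(n : ℝ) : ℝ))) (f := fun _ => 0) (fun x => 2 * |u| * (σ x * |φ x|))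
    (fun n => ?_) ((h.integrable_bound_mul hφ2).const_mul _)
    (fun n => Eventually.of_forall fun x => ?_) (Eventually.of_forall fun x => ?_)
  · simpa using this
  · have := measurable_expSubOne
    have := h.measurable_score n
    exact Measurable.aestronglyMeasurable (by fun_prop)
  · refine (hle n x).trans ?_
    have h1 : ‖expSubOne (u * φ x / √(n : ℝ)) - Complex.I * (u * φ x / √(n : ℝ) : ℝ)‖ ≤
        2 * |u * φ x / √(n : ℝ)| := by
      refine (norm_sub_le _ _).trans ?_
      have := norm_expSubOne_le (u * φ x / √(n : ℝ))
      rw [norm_mul, Complex.norm_I, one_mul, Complex.norm_real, Real.norm_eq_abs]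
      linarith
    have h2 := sqrt_mul_abs_div_sqrt_le n (u * φ x)
    have h3 := mul_le_mul_of_nonneg_left h1 (Real.sqrt_nonneg (n : ℝ))
    have h4 : √(n : ℝ) * ‖expSubOne (u * φ x / √(n : ℝ)) -
        Complex.I * (u * φ x / √(n : ℝ) : ℝ)‖ ≤ 2 * (|u| * |φ x|) := by
      rw [← abs_mul]; linarith
    have := mul_le_mul_of_nonneg_left h4 (h.bound_nonneg x)
    linarith
  · refine squeeze_zero_norm (fun n => hle n x) ?_
    simpa using (tendsto_sqrt_mul_expSubOne_sub (u * φ x)).const_mul (σ x)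

/-- The density remainder equals (√pₙ - √p₀)² + 2√p₀ R with R the remainder of the root densities.
The first part is dominated at rate 1/n against a factor tending to zero; in the second √n R → 0 in
L² while √n|exp(iuφ/√n) - 1| ≤ |uφ|. -/
theorem tendsto_charFun_remainder (h : LocalSeq ν p₀ p ℓ σ) (hφ : Measurable φ)
    (hφ2 : MemLp φ 2 (lawOf ν p₀)) (u : ℝ) :
    Tendsto (fun n : ℕ => ∫ x, (n : ℂ) * ((p n x - p₀ x - ℓ n x * p₀ x : ℝ) : ℂ) *
      expSubOne (u * φ x / √(n : ℝ)) ∂ν) atTop (𝓝 0) := by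
  have hm := measurable_expSubOne
  have mφ : MemLp (fun x => φ x * √(p₀ x)) 2 ν :=
    memLp_mul_sqrt_density h.measurable_base h.base_nonneg hφ hφ2
  have d1 : Tendsto (fun n : ℕ => ∫ x, ‖expSubOne (u * φ x / √(n : ℝ))‖ *
      (σ x * √(p₀ x)) ^ 2 ∂ν) atTop (𝓝 0) := by
    have hbm : Measurable fun x => (σ x * √(p₀ x)) ^ 2 :=
      (h.measurable_bound.mul h.measurable_base.sqrt).pow_const 2
    have := tendsto_integral_of_dominated_convergence (μ := ν)
      (F := fun (n : ℕ) x => ‖expSubOne (u * φ x / √(n : ℝ))‖ * (σ x * √(p₀ x)) ^ 2)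
      (f := fun _ => 0) (fun x => 2 * (σ x * √(p₀ x)) ^ 2)
      (fun n => Measurable.aestronglyMeasurable (by fun_prop))
      (h.integrable_bound_sq.const_mul 2)
      (fun n => Eventually.of_forall fun x => by
        rw [Real.norm_of_nonneg (by positivity)]
        exact mul_le_mul_of_nonneg_right (norm_expSubOne_le_two _) (sq_nonneg _))
      (Eventually.of_forall fun x => by
        have := (tendsto_div_sqrt_nat (u * φ x)).abs
        rw [abs_zero] at this
        have := (squeeze_zero (fun n => norm_nonneg _) (fun n : ℕ => norm_expSubOne_le _)
          this).mul_const ((σ x * √(p₀ x)) ^ 2)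
        rwa [zero_mul] at this)
    simpa using this
  have i1 : ∀ n : ℕ, Integrable (fun x => 1 / 2 * (‖expSubOne (u * φ x / √(n : ℝ))‖ *
      (σ x * √(p₀ x)) ^ 2)) ν := fun n => by
    refine Integrable.const_mul ?_ _
    refine h.integrable_bound_sq.bdd_mul (c := 2) (Measurable.aestronglyMeasurable (by fun_prop)) ?_
    exact Eventually.of_forall fun x => by
      rw [norm_norm]; exact norm_expSubOne_le_two _
  have i2 : ∀ n : ℕ, Integrable (fun x => 4 * ((n : ℝ) * remainder p₀ p ℓ n x ^ 2)) ν := fun n =>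
    ((h.memLp_remainder n).integrable_sq.const_mul _).const_mul _
  have i3 : ∀ n : ℕ, Integrable (fun x => 2 * |u| * √(n : ℝ) *
      |(φ x * √(p₀ x)) * remainder p₀ p ℓ n x|) ν := fun n =>
    ((mφ.integrable_mul (h.memLp_remainder n)).abs).const_mul _
  have i12 : ∀ n : ℕ, Integrable (fun x => 1 / 2 * (‖expSubOne (u * φ x / √(n : ℝ))‖ *
      (σ x * √(p₀ x)) ^ 2) + 4 * ((n : ℝ) * remainder p₀ p ℓ n x ^ 2)) ν := fun n =>
    (i1 n).add (i2 n)
  have hb : ∀ (n : ℕ) x, ‖(n : ℂ) * ((p n x - p₀ x - ℓ n x * p₀ x : ℝ) : ℂ) *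
      expSubOne (u * φ x / √(n : ℝ))‖ ≤ 1 / 2 * (‖expSubOne (u * φ x / √(n : ℝ))‖ *
      (σ x * √(p₀ x)) ^ 2) + 4 * ((n : ℝ) * remainder p₀ p ℓ n x ^ 2) +
      2 * |u| * √(n : ℝ) * |(φ x * √(p₀ x)) * remainder p₀ p ℓ n x| := by
    intro n x
    have e : p n x - p₀ x - ℓ n x * p₀ x =
        rootDiff p₀ p n x ^ 2 + 2 * √(p₀ x) * remainder p₀ p ℓ n x := by
      have s1 := Real.sq_sqrt (h.base_nonneg x)
      have s2 := Real.sq_sqrt (h.dens_nonneg n x)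
      simp only [rootDiff, remainder]
      generalize √(p n x) = a at *
      generalize √(p₀ x) = b at *
      rw [← s1, ← s2]
      ring
    rw [norm_mul, norm_mul, Complex.norm_natCast, Complex.norm_real, Real.norm_eq_abs, e]
    have h1 := h.nat_mul_rootDiff_sq_le n x
    have h2 : |rootDiff p₀ p n x ^ 2 + 2 * √(p₀ x) * remainder p₀ p ℓ n x| ≤
        rootDiff p₀ p n x ^ 2 + 2 * (√(p₀ x) * |remainder p₀ p ℓ n x|) := by
      refine (abs_add_le _ _).trans_eq ?_
      rw [abs_of_nonneg (sq_nonneg (rootDiff p₀ p n x)), abs_mul, abs_mul,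
        abs_of_nonneg (Real.sqrt_nonneg _), abs_two, mul_assoc]
    have h3 := norm_expSubOne_le_two (u * φ x / √(n : ℝ))
    have h4 : √(n : ℝ) * ‖expSubOne (u * φ x / √(n : ℝ))‖ ≤ |u| * |φ x| := by
      rw [← abs_mul]
      exact (mul_le_mul_of_nonneg_left (norm_expSubOne_le _) (Real.sqrt_nonneg _)).trans
        (sqrt_mul_abs_div_sqrt_le n _)
    set E := ‖expSubOne (u * φ x / √(n : ℝ))‖ with hE
    have hE0 : 0 ≤ E := norm_nonneg _
    set R := remainder p₀ p ℓ n x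
    have hn0 := Nat.cast_nonneg (α := ℝ) n
    have hnn := Real.mul_self_sqrt hn0
    rw [abs_mul (φ x * _), abs_mul (φ x), abs_of_nonneg (Real.sqrt_nonneg (p₀ x))]
    calc (n : ℝ) * |rootDiff p₀ p n x ^ 2 + 2 * √(p₀ x) * R| * E
        ≤ (n : ℝ) * (rootDiff p₀ p n x ^ 2 + 2 * (√(p₀ x) * |R|)) * E := by gcongr
      _ = ((n : ℝ) * rootDiff p₀ p n x ^ 2) * E +
          2 * √(n : ℝ) * (√(p₀ x) * |R|) * (√(n : ℝ) * E) := by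
          rw [← hnn, Real.sqrt_mul_self (Real.sqrt_nonneg _)]; ring
      _ ≤ (1 / 2 * (σ x * √(p₀ x)) ^ 2 + 2 * ((n : ℝ) * R ^ 2)) * E +
          2 * √(n : ℝ) * (√(p₀ x) * |R|) * (|u| * |φ x|) := by gcongr
      _ ≤ _ := by
          have : 2 * ((n : ℝ) * R ^ 2) * E ≤ 2 * ((n : ℝ) * R ^ 2) * 2 := by gcongr
          linarith
  have hlim : Tendsto (fun n : ℕ => 1 / 2 * ∫ x, ‖expSubOne (u * φ x / √(n : ℝ))‖ *
      (σ x * √(p₀ x)) ^ 2 ∂ν + 4 * ((n : ℝ) * ∫ x, remainder p₀ p ℓ n x ^ 2 ∂ν) +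
      2 * |u| * √(∫ x, (φ x * √(p₀ x)) ^ 2 ∂ν) *
        (√(n : ℝ) * √(∫ x, remainder p₀ p ℓ n x ^ 2 ∂ν))) atTop (𝓝 0) := by
    have := ((d1.const_mul (1 / 2)).add (h.tendsto_remainder.const_mul 4)).add
      (h.tendsto_sqrt_remainder.const_mul (2 * |u| * √(∫ x, (φ x * √(p₀ x)) ^ 2 ∂ν)))
    simpa only [mul_zero, add_zero] using this
  refine squeeze_zero_norm (fun n => ?_) hlim
  refine (norm_integral_le_of_norm_le ((i12 n).add (i3 n))
    (Eventually.of_forall (hb n))).trans ?_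
  simp only [Pi.add_apply]
  rw [integral_add (i12 n) (i3 n), integral_add (i1 n) (i2 n), integral_const_mul,
    integral_const_mul, integral_const_mul, integral_const_mul]
  have := integral_abs_mul_le_sqrt mφ (h.memLp_remainder n)
  have := mul_le_mul_of_nonneg_left this (by positivity : 0 ≤ 2 * |u| * √(n : ℝ))
  linarith

/-- Second order expansion of the characteristic function of `φ / √n`. -/
theorem tendsto_nat_mul_charFun_sub_one (h : LocalSeq ν p₀ p ℓ σ) (hφ : Measurable φ)
    (hφ2 : MemLp φ 2 (lawOf ν p₀)) (hφ0 : ∫ x, φ x ∂(lawOf ν p₀) = 0) (u : ℝ) :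
    Tendsto (fun n : ℕ => (n : ℂ) * ∫ x, expSubOne (u * φ x / √(n : ℝ)) ∂(lawOf ν (p n)) -
      Complex.I * (u * (√(n : ℝ) * ∫ x, φ x * ℓ n x ∂(lawOf ν p₀)) : ℝ)) atTop
      (𝓝 (-((u ^ 2 * ∫ x, φ x ^ 2 ∂(lawOf ν p₀) : ℝ) : ℂ) / 2)) := by
  -- The three limits match the splitting of pₙ into p₀, ℓₙp₀ and a remainder. The subtracted linear
  -- terms integrate to zero against p₀, as φ is centred, and to i u √n E φℓₙ after scaling against
  -- ℓₙp₀.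
  have hlim := ((tendsto_charFun_base hφ hφ2 u).add (h.tendsto_charFun_score hφ hφ2 u)).add
    (h.tendsto_charFun_remainder hφ hφ2 u)
  rw [add_zero, add_zero] at hlim
  refine hlim.congr fun n => ?_
  haveI := h.prob_base
  haveI := h.prob n
  have hm := measurable_expSubOne
  have hbd : ∀ x, ‖expSubOne (u * φ x / √(n : ℝ))‖ ≤ 2 := fun x => norm_expSubOne_le_two _
  have hem : Measurable fun x => expSubOne (u * φ x / √(n : ℝ)) := by fun_prop
  have hae := hem.aestronglyMeasurable (μ := ν)
  have ip := (integrable_density (ν := ν) (h.measurable_dens n) (h.dens_nonneg n)).ofReal (𝕜 := ℂ)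
  have i0 := (integrable_density (ν := ν) h.measurable_base h.base_nonneg).ofReal (𝕜 := ℂ)
  have iφ : Integrable (fun x => ((p₀ x * φ x : ℝ) : ℂ)) ν :=
    ((integrable_lawOf_iff (ν := ν) h.measurable_base h.base_nonneg).1
      (hφ2.integrable one_le_two)).ofReal
  have iℓ : Integrable (fun x => ((p₀ x * ℓ n x : ℝ) : ℂ)) ν :=
    ((integrable_lawOf_iff (ν := ν) h.measurable_base h.base_nonneg).1
      ((h.memLp_score n).integrable one_le_two)).ofReal
  have iφℓ : Integrable (fun x => ((p₀ x * (φ x * ℓ n x) : ℝ) : ℂ)) ν :=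
    ((integrable_lawOf_iff (ν := ν) h.measurable_base h.base_nonneg).1
      (hφ2.integrable_mul (h.memLp_score n))).ofReal
  have k1 : Integrable (fun x => (p n x : ℂ) * expSubOne (u * φ x / √(n : ℝ))) ν :=
    ip.mul_bdd (c := 2) hae (Eventually.of_forall hbd)
  have k2 : Integrable (fun x => (p₀ x : ℂ) * expSubOne (u * φ x / √(n : ℝ))) ν :=
    i0.mul_bdd (c := 2) hae (Eventually.of_forall hbd)
  have k3 : Integrable (fun x => ((p₀ x * ℓ n x : ℝ) : ℂ) * expSubOne (u * φ x / √(n : ℝ))) ν :=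
    iℓ.mul_bdd (c := 2) hae (Eventually.of_forall hbd)
  have e1 : ∫ x, (n : ℂ) * (expSubOne (u * φ x / √(n : ℝ)) -
      Complex.I * (u * φ x / √(n : ℝ) : ℝ)) ∂(lawOf ν p₀) =
      n * ∫ x, (p₀ x : ℂ) * expSubOne (u * φ x / √(n : ℝ)) ∂ν -
        (n * Complex.I * (u / √(n : ℝ) : ℝ)) * ∫ x, ((p₀ x * φ x : ℝ) : ℂ) ∂ν := by
    rw [integral_lawOf h.measurable_base h.base_nonneg, ← integral_const_mul, ← integral_const_mul,
      ← integral_sub (k2.const_mul _) (iφ.const_mul _)]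
    refine integral_congr_ae (Eventually.of_forall fun x => ?_)
    simp only [Complex.real_smul]
    push_cast; ring
  have e2 : ∫ x, (n : ℂ) * ℓ n x * (expSubOne (u * φ x / √(n : ℝ)) -
      Complex.I * (u * φ x / √(n : ℝ) : ℝ)) ∂(lawOf ν p₀) =
      n * ∫ x, ((p₀ x * ℓ n x : ℝ) : ℂ) * expSubOne (u * φ x / √(n : ℝ)) ∂ν -
        (n * Complex.I * (u / √(n : ℝ) : ℝ)) * ∫ x, ((p₀ x * (φ x * ℓ n x) : ℝ) : ℂ) ∂ν := by
    rw [integral_lawOf h.measurable_base h.base_nonneg, ← integral_const_mul, ← integral_const_mul,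
      ← integral_sub (k3.const_mul _) (iφℓ.const_mul _)]
    refine integral_congr_ae (Eventually.of_forall fun x => ?_)
    simp only [Complex.real_smul]
    push_cast; ring
  have k12 : Integrable (fun x => (p n x : ℂ) * expSubOne (u * φ x / √(n : ℝ)) -
      (p₀ x : ℂ) * expSubOne (u * φ x / √(n : ℝ))) ν := k1.sub k2
  have e3 : ∫ x, (n : ℂ) * ((p n x - p₀ x - ℓ n x * p₀ x : ℝ) : ℂ) *
      expSubOne (u * φ x / √(n : ℝ)) ∂ν =
      n * (∫ x, (p n x : ℂ) * expSubOne (u * φ x / √(n : ℝ)) ∂ν -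
        ∫ x, (p₀ x : ℂ) * expSubOne (u * φ x / √(n : ℝ)) ∂ν -
        ∫ x, ((p₀ x * ℓ n x : ℝ) : ℂ) * expSubOne (u * φ x / √(n : ℝ)) ∂ν) := by
    rw [← integral_sub k1 k2, ← integral_sub k12 k3, ← integral_const_mul]
    refine integral_congr_ae (Eventually.of_forall fun x => ?_)
    push_cast; ring
  have e4 : ∫ x, expSubOne (u * φ x / √(n : ℝ)) ∂(lawOf ν (p n)) =
      ∫ x, (p n x : ℂ) * expSubOne (u * φ x / √(n : ℝ)) ∂ν := by
    rw [integral_lawOf (h.measurable_dens n) (h.dens_nonneg n)]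
    simp only [Complex.real_smul]
  have e5 : ∫ x, ((p₀ x * φ x : ℝ) : ℂ) ∂ν = 0 := by
    rw [integral_complex_ofReal]
    have := integral_lawOf (ν := ν) h.measurable_base h.base_nonneg φ
    simp only [smul_eq_mul] at this
    rw [← this, hφ0, Complex.ofReal_zero]
  have e6 : ∫ x, ((p₀ x * (φ x * ℓ n x) : ℝ) : ℂ) ∂ν =
      ((∫ x, φ x * ℓ n x ∂(lawOf ν p₀) : ℝ) : ℂ) := by
    rw [integral_complex_ofReal, integral_lawOf h.measurable_base h.base_nonneg]
    rfl
  rw [e1, e2, e3, e4, e5, e6]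
  have e7 : (n : ℂ) * (u / √(n : ℝ) : ℝ) = (u * √(n : ℝ) : ℝ) := by
    have : (n : ℝ) * (u / √(n : ℝ)) = u * √(n : ℝ) := by
      rcases Nat.eq_zero_or_pos n with rfl | hn
      · simp
      · have hs : √(n : ℝ) ≠ 0 := (Real.sqrt_pos.2 (by exact_mod_cast hn)).ne'
        field_simp
        rw [Real.sq_sqrt (Nat.cast_nonneg n)]
        ring
    exact_mod_cast this
  rw [← mul_assoc u, Complex.ofReal_mul (u * √(n : ℝ)), ← e7]
  ring

end LocalSeq

end FDTD

namespace FDTD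

/-! ### Limit of the characteristic function of normalized sums -/

namespace LocalSeq

variable {𝒳 : Type*} [MeasurableSpace 𝒳] {ν : Measure 𝒳} {p₀ : 𝒳 → ℝ} {p : ℕ → 𝒳 → ℝ}
  {ℓ : ℕ → 𝒳 → ℝ} {σ : 𝒳 → ℝ} {φ : 𝒳 → ℝ}

theorem exists_sqrt_mul_integral_score_le (h : LocalSeq ν p₀ p ℓ σ)
    (hφ2 : MemLp φ 2 (lawOf ν p₀)) :
    ∃ C : ℝ, 0 ≤ C ∧ ∀ n : ℕ, |√(n : ℝ) * ∫ x, φ x * ℓ n x ∂(lawOf ν p₀)| ≤ C := by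
  refine ⟨∫ x, σ x * |φ x| ∂(lawOf ν p₀), integral_nonneg fun x =>
    mul_nonneg (h.bound_nonneg x) (abs_nonneg _), fun n => ?_⟩
  rw [← integral_const_mul]
  refine abs_integral_le_integral_abs.trans (integral_mono_of_nonneg
    (Eventually.of_forall fun x => abs_nonneg _) (h.integrable_bound_mul hφ2)
    (Eventually.of_forall fun x => ?_))
  simp only [abs_mul, abs_of_nonneg (Real.sqrt_nonneg _)]
  have := mul_le_mul_of_nonneg_right (h.score_le n x) (abs_nonneg (φ x))
  linarith

/-- The characteristic function of a normalized sum under a local sequence, recentred. -/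
theorem tendsto_charFun_pow (h : LocalSeq ν p₀ p ℓ σ) (hφ : Measurable φ)
    (hφ2 : MemLp φ 2 (lawOf ν p₀)) (hφ0 : ∫ x, φ x ∂(lawOf ν p₀) = 0) {d : ℕ → ℝ}
    (hd : Tendsto (fun n : ℕ => d n - √(n : ℝ) * ∫ x, φ x * ℓ n x ∂(lawOf ν p₀)) atTop (𝓝 0))
    (u : ℝ) :
    Tendsto (fun n : ℕ => Complex.exp (Complex.I * (-(u * d n) : ℝ)) *
      (∫ x, Complex.exp (Complex.I * (u * φ x / √(n : ℝ) : ℝ)) ∂(lawOf ν (p n))) ^ n) atTop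
      (𝓝 (Complex.exp (-((u ^ 2 * ∫ x, φ x ^ 2 ∂(lawOf ν p₀) : ℝ) : ℂ) / 2))) := by
  obtain ⟨C, hC0, hC⟩ := h.exists_sqrt_mul_integral_score_le hφ2
  set c : ℕ → ℝ := fun n => √(n : ℝ) * ∫ x, φ x * ℓ n x ∂(lawOf ν p₀) with hc
  set G : ℕ → ℂ := fun n => ∫ x, expSubOne (u * φ x / √(n : ℝ)) ∂(lawOf ν (p n)) with hG
  -- nGₙ need not converge, since the shift c n is merely bounded. As 1 + bₙ = exp(-iu cₙ/n), the
  -- recentring is moved inside the n-th power, where the sum with nGₙ does converge.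
  set b : ℕ → ℂ := fun n => expSubOne (-(u * c n) / n) with hb
  have hnG : Tendsto (fun n : ℕ => (n : ℂ) * G n - Complex.I * (u * c n : ℝ)) atTop _ :=
    h.tendsto_nat_mul_charFun_sub_one hφ hφ2 hφ0 u
  have hn0 : Tendsto (fun n : ℕ => 2 * (|u| * C) ^ 2 / (n : ℝ)) atTop (𝓝 0) :=
    tendsto_const_nhds.div_atTop tendsto_natCast_atTop_atTop
  have hn1 : Tendsto (fun n : ℕ => (|u| * C) / (n : ℝ)) atTop (𝓝 0) :=
    tendsto_const_nhds.div_atTop tendsto_natCast_atTop_atTop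
  have huc : ∀ n, |u * c n| ≤ |u| * C := fun n => by
    rw [abs_mul]; exact mul_le_mul_of_nonneg_left (hC n) (abs_nonneg u)
  have hb0 : Tendsto b atTop (𝓝 0) := by
    refine squeeze_zero_norm (fun n => ?_) hn1
    refine (norm_expSubOne_le _).trans ?_
    rw [abs_div, abs_neg, Nat.abs_cast]
    gcongr
    exact huc n
  have hnb : Tendsto (fun n : ℕ => (n : ℂ) * b n + Complex.I * (u * c n : ℝ)) atTop (𝓝 0) := by
    refine squeeze_zero_norm' ?_ hn0
    filter_upwards [eventually_gt_atTop 0] with n hn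
    have hn' : (0 : ℝ) < n := by exact_mod_cast hn
    have e : (n : ℂ) * b n + Complex.I * (u * c n : ℝ) =
        n * (b n - Complex.I * (-(u * c n) / n : ℝ)) := by
      have : (n : ℂ) ≠ 0 := by exact_mod_cast hn.ne'
      push_cast
      field_simp
      ring
    rw [e, norm_mul, Complex.norm_natCast]
    refine (mul_le_mul_of_nonneg_left (norm_expSubOne_sub_le _) hn'.le).trans ?_
    have h2 : (u * c n) ^ 2 ≤ (|u| * C) ^ 2 := sq_le_sq.2 ((huc n).trans (le_abs_self _))
    rw [le_div_iff₀ hn']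
    have : (n : ℝ) * (2 * (-(u * c n) / n) ^ 2) * n = 2 * (u * c n) ^ 2 := by
      field_simp
    rw [this]
    linarith
  have hbc : Tendsto (fun n : ℕ => b n * (Complex.I * (u * c n : ℝ))) atTop (𝓝 0) := by
    have := hb0.norm.mul_const (|u| * C)
    rw [norm_zero, zero_mul] at this
    refine squeeze_zero_norm (fun n => ?_) this
    rw [norm_mul, norm_mul, Complex.norm_I, one_mul, Complex.norm_real, Real.norm_eq_abs]
    exact mul_le_mul_of_nonneg_left (huc n) (norm_nonneg _)
  have hH : Tendsto (fun n : ℕ => (n : ℂ) * (G n + b n + b n * G n)) atTop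
      (𝓝 (-((u ^ 2 * ∫ x, φ x ^ 2 ∂(lawOf ν p₀) : ℝ) : ℂ) / 2)) := by
    have := ((hnG.add hnb).add (hb0.mul hnG)).add hbc
    rw [zero_mul, add_zero, add_zero, add_zero] at this
    refine this.congr fun n => ?_
    ring
  have hpow := Complex.tendsto_one_add_pow_exp_of_tendsto hH
  have hexp : Tendsto (fun n : ℕ => Complex.exp (Complex.I * (-(u * (d n - c n)) : ℝ))) atTop
      (𝓝 1) := by
    have hcont : Continuous fun y : ℝ => Complex.exp (Complex.I * (-(u * y) : ℝ)) := by fun_prop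
    have := (hcont.tendsto 0).comp hd
    simpa only [Function.comp_def, mul_zero, neg_zero, Complex.ofReal_zero, Complex.exp_zero]
      using this
  have := hexp.mul hpow
  rw [one_mul] at this
  refine this.congr' ?_
  filter_upwards [eventually_gt_atTop 0] with n hn
  haveI := h.prob n
  have hne : (n : ℂ) ≠ 0 := by exact_mod_cast hn.ne'
  have e1 : 1 + (G n + b n + b n * G n) = (1 + b n) * (1 + G n) := by ring
  have e2 : (1 + b n) ^ n = Complex.exp (Complex.I * (-(u * c n) : ℝ)) := by
    rw [hb]
    simp only [expSubOne, add_sub_cancel]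
    rw [← Complex.exp_nat_mul]
    congr 1
    push_cast
    field_simp
  have e3 : 1 + G n = ∫ x, Complex.exp (Complex.I * (u * φ x / √(n : ℝ) : ℝ)) ∂(lawOf ν (p n)) := by
    have hi : Integrable (fun x => expSubOne (u * φ x / √(n : ℝ))) (lawOf ν (p n)) := by
      have := measurable_expSubOne
      exact Integrable.of_bound (Measurable.aestronglyMeasurable (by fun_prop)) 2
        (Eventually.of_forall fun x => norm_expSubOne_le_two _)
    have : (1 : ℂ) = ∫ _, 1 ∂(lawOf ν (p n)) := by simp
    rw [hG]
    simp only
    rw [this, ← integral_add (integrable_const _) hi]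
    refine integral_congr_ae (Eventually.of_forall fun x => ?_)
    simp only [expSubOne]
    ring
  rw [e1, mul_pow, e2, e3, ← mul_assoc, ← Complex.exp_add]
  congr 2
  push_cast
  ring

end LocalSeq

/-! ### Weak convergence -/

/-- Convergence of characteristic functions up to a remainder that tends to zero in probability
gives weak convergence. -/
theorem tendsto_integral_of_charFun {S : ℕ → Type*} [∀ n, MeasurableSpace (S n)]
    {Q : ∀ n, Measure (S n)} [∀ n, IsProbabilityMeasure (Q n)] {T W : ∀ n, S n → ℝ}
    (hT : ∀ n, Measurable (T n)) (hW : ∀ n, Measurable (W n))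
    (hTW : TendsZero Q fun n s => T n s - W n s) {L : Measure ℝ} [IsProbabilityMeasure L]
    (hchar : ∀ u : ℝ, Tendsto (fun n => ∫ s, Complex.exp (Complex.I * (u * W n s : ℝ)) ∂(Q n)) atTop
      (𝓝 (charFun L u))) (f : ℝ →ᵇ ℝ) :
    Tendsto (fun n => ∫ s, f (T n s) ∂(Q n)) atTop (𝓝 (∫ y, f y ∂L)) := by
  have hprob : ∀ n, IsProbabilityMeasure ((Q n).map (T n)) := fun n =>
    Measure.isProbabilityMeasure_map (hT n).aemeasurable
  let M : ℕ → ProbabilityMeasure ℝ := fun n => ⟨(Q n).map (T n), hprob n⟩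
  let M₀ : ProbabilityMeasure ℝ := ⟨L, inferInstance⟩
  have hweak : Tendsto M atTop (𝓝 M₀) := by
    refine ProbabilityMeasure.tendsto_iff_tendsto_charFun.2 fun u => ?_
    change Tendsto (fun n => charFun ((Q n).map (T n)) u) atTop (𝓝 (charFun L u))
    have eT : ∀ n, charFun ((Q n).map (T n)) u =
        ∫ s, Complex.exp (Complex.I * (u * T n s : ℝ)) ∂(Q n) := fun n => by
      rw [charFun_apply_real, integral_map (hT n).aemeasurable
        (Measurable.aestronglyMeasurable (by fun_prop))]
      refine integral_congr_ae (Eventually.of_forall fun s => ?_)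
      simp only
      congr 1
      push_cast
      ring
    simp_rw [eT]
    have iT : ∀ n (X : S n → ℝ), Measurable X →
        Integrable (fun s => Complex.exp (Complex.I * (u * X s : ℝ))) (Q n) := fun n X hX =>
      Integrable.of_bound (Measurable.aestronglyMeasurable (by fun_prop)) 1
        (Eventually.of_forall fun s => (Complex.norm_exp_I_mul_ofReal _).le)
    have hdiff : Tendsto (fun n => ∫ s, Complex.exp (Complex.I * (u * T n s : ℝ)) ∂(Q n) -
        ∫ s, Complex.exp (Complex.I * (u * W n s : ℝ)) ∂(Q n)) atTop (𝓝 0) := by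
      have hbound : ∀ n (ε : ℝ), 0 ≤ ε → ‖∫ s, Complex.exp (Complex.I * (u * T n s : ℝ)) ∂(Q n) -
          ∫ s, Complex.exp (Complex.I * (u * W n s : ℝ)) ∂(Q n)‖ ≤
          |u| * ε + 2 * (Q n).real {s | ε ≤ |T n s - W n s|} := by
        intro n ε hε
        have hTm := hT n
        have hWm := hW n
        have hE : MeasurableSet {s | ε ≤ |T n s - W n s|} :=
          measurableSet_le measurable_const (by fun_prop)
        rw [← integral_sub (iT n _ hTm) (iT n _ hWm)]
        have hI : Integrable ({s | ε ≤ |T n s - W n s|}.indicator fun _ => (2 : ℝ)) (Q n) :=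
          (integrable_const _).indicator hE
        refine (norm_integral_le_of_norm_le ((integrable_const (|u| * ε)).add hI)
          (Eventually.of_forall fun s => ?_)).trans ?_
        · have e : Complex.exp (Complex.I * (u * T n s : ℝ)) -
              Complex.exp (Complex.I * (u * W n s : ℝ)) =
              Complex.exp (Complex.I * (u * W n s : ℝ)) * expSubOne (u * (T n s - W n s)) := by
            rw [expSubOne, mul_sub, mul_one, ← Complex.exp_add]
            congr 2
            push_cast
            ring
          rw [e, norm_mul, Complex.norm_exp_I_mul_ofReal, one_mul, Pi.add_apply]
          by_cases hs : s ∈ {s | ε ≤ |T n s - W n s|}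
          · rw [Set.indicator_of_mem hs]
            have := norm_expSubOne_le_two (u * (T n s - W n s))
            have := mul_nonneg (abs_nonneg u) hε
            linarith
          · rw [Set.indicator_of_notMem hs, add_zero]
            refine (norm_expSubOne_le _).trans ?_
            rw [abs_mul]
            exact mul_le_mul_of_nonneg_left (not_le.1 hs).le (abs_nonneg u)
        · simp only [Pi.add_apply]
          rw [integral_add (integrable_const _) hI, integral_indicator hE]
          simp [mul_comm]
      rw [Metric.tendsto_atTop]
      intro ε hε
      have hq : Tendsto (fun n => (Q n).real {s | ε / (4 * (|u| + 1)) ≤ |T n s - W n s|}) atTop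
          (𝓝 0) := by
        have := (ENNReal.tendsto_toReal ENNReal.zero_ne_top).comp
          (hTW (ε / (4 * (|u| + 1))) (by positivity))
        simpa [Function.comp_def, Measure.real] using this
      obtain ⟨n₀, hn₀⟩ := eventually_atTop.1
        (hq.eventually_lt_const (by positivity : (0 : ℝ) < ε / 4))
      refine ⟨n₀, fun n hn => ?_⟩
      rw [dist_zero_right]
      have h1 := hbound n (ε / (4 * (|u| + 1))) (by positivity)
      have h2 := hn₀ n hn
      have h3 : |u| * (ε / (4 * (|u| + 1))) ≤ ε / 4 := by
        rw [mul_div_assoc', div_le_div_iff₀ (by positivity) (by norm_num)]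
        nlinarith [abs_nonneg u]
      linarith
    have := hdiff.add (hchar u)
    simpa using this
  have h2 := (ProbabilityMeasure.tendsto_iff_forall_integral_tendsto.1 hweak) f
  refine h2.congr fun n => ?_
  change ∫ y, f y ∂((Q n).map (T n)) = _
  exact integral_map (hT n).aemeasurable f.continuous.measurable.aestronglyMeasurable

section Sampling
variable {𝒜 𝒵 𝒞 : Type u} [MeasurableSpace 𝒜] [MeasurableSpace 𝒵] [MeasurableSpace 𝒞]

theorem integral_exp_sum_sampleLaw (P : Measure (Obs 𝒜 𝒵 𝒞)) [IsProbabilityMeasure P] (n r : ℕ)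
    (φ : Obs 𝒜 𝒵 𝒞 → ℝ) (u d : ℝ) :
    ∫ s, Complex.exp (Complex.I * (u * (1 / √(n : ℝ) * ∑ i, φ (s.1 i) - d) : ℝ))
      ∂(sampleLaw P n r) = Complex.exp (Complex.I * (-(u * d) : ℝ)) *
      (∫ x, Complex.exp (Complex.I * (u * φ x / √(n : ℝ) : ℝ)) ∂P) ^ n := by
  have e : ∀ s : Sample 𝒜 𝒵 𝒞 n r,
      Complex.exp (Complex.I * (u * (1 / √(n : ℝ) * ∑ i, φ (s.1 i) - d) : ℝ)) =
      (fun x : Fin n → Obs 𝒜 𝒵 𝒞 => Complex.exp (Complex.I * (-(u * d) : ℝ)) *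
        ∏ i, Complex.exp (Complex.I * (u * φ (x i) / √(n : ℝ) : ℝ))) s.1 := by
    intro s
    simp only
    rw [← Complex.exp_sum, ← Complex.exp_add, ← Finset.mul_sum, ← mul_add]
    congr 2
    rw [← Complex.ofReal_sum, ← Complex.ofReal_add, ← Finset.sum_div, ← Finset.mul_sum]
    congr 1
    ring
  simp_rw [e]
  rw [sampleLaw, integral_fun_fst (fun x : Fin n → Obs 𝒜 𝒵 𝒞 =>
    Complex.exp (Complex.I * (-(u * d) : ℝ)) *
        ∏ i, Complex.exp (Complex.I * (u * φ (x i) / √(n : ℝ) : ℝ))), integral_const_mul,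
    integral_fintype_prod_eq_pow (ι := Fin n) (fun x : Obs 𝒜 𝒵 𝒞 =>
      Complex.exp (Complex.I * (u * φ x / √(n : ℝ) : ℝ)))]
  simp

end Sampling

end FDTD

namespace FDTD

/-! ### The nuisance functions under local sequences -/

section Rate

/-- `x n = x₀ + O(n^{-1/2})`. -/
def RootClose (x : ℕ → ℝ) (x₀ : ℝ) : Prop :=
  (fun n => x n - x₀) =O[atTop] fun n : ℕ => (√(n : ℝ))⁻¹

theorem tendsto_inv_sqrt_nat : Tendsto (fun n : ℕ => (√(n : ℝ))⁻¹) atTop (𝓝 0) :=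
  (Real.tendsto_sqrt_atTop.comp tendsto_natCast_atTop_atTop).inv_tendsto_atTop

theorem RootClose.tendsto {x : ℕ → ℝ} {x₀ : ℝ} (h : RootClose x x₀) : Tendsto x atTop (𝓝 x₀) := by
  have := (h.trans_tendsto tendsto_inv_sqrt_nat).add_const x₀
  simpa using this

theorem RootClose.div {x y : ℕ → ℝ} {x₀ y₀ : ℝ} (hx : RootClose x x₀) (hy : RootClose y y₀)
    (hy₀ : y₀ ≠ 0) (hyn : ∀ n, y n ≠ 0) : RootClose (fun n => x n / y n) (x₀ / y₀) := by
  have hnum : (fun n => (x n - x₀) * y₀ - x₀ * (y n - y₀)) =O[atTop]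
      fun n : ℕ => (√(n : ℝ))⁻¹ := by
    refine Asymptotics.IsBigO.sub ?_ (hy.const_mul_left x₀)
    simp_rw [mul_comm _ y₀]
    exact hx.const_mul_left y₀
  have hden : (fun n => (y n * y₀)⁻¹) =O[atTop] fun _ : ℕ => (1 : ℝ) :=
    ((hy.tendsto.mul_const y₀).inv₀ (mul_ne_zero hy₀ hy₀)).isBigO_one ℝ
  have := hnum.mul hden
  simp only [mul_one] at this
  refine this.congr_left fun n => ?_
  have := hyn n
  field_simp
  ring

theorem RootClose.of_tendsto {x c : ℕ → ℝ} {x₀ C : ℝ}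
    (h : Tendsto (fun n : ℕ => √(n : ℝ) * (x n - x₀ - c n)) atTop (𝓝 0))
    (hc : ∀ n : ℕ, |√(n : ℝ) * c n| ≤ C) : RootClose x x₀ := by
  refine Asymptotics.IsBigO.of_bound (1 + C) ?_
  have h1 := h.abs
  rw [abs_zero] at h1
  filter_upwards [h1.eventually_lt_const one_pos, eventually_gt_atTop 0] with n hn hn0
  have hs : 0 < √(n : ℝ) := Real.sqrt_pos.2 (by exact_mod_cast hn0)
  rw [Real.norm_eq_abs, norm_inv, Real.norm_of_nonneg hs.le, ← div_eq_mul_inv, le_div_iff₀ hs,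
    mul_comm, ← abs_of_pos hs, ← abs_mul]
  have e : √(n : ℝ) * (x n - x₀) = √(n : ℝ) * (x n - x₀ - c n) + √(n : ℝ) * c n := by ring
  rw [e]
  exact (abs_add_le _ _).trans (add_le_add hn.le (hc n))

end Rate

/-! ### Nuisance functions and the causal effect along local sequences -/

section Finite
variable {𝒜 𝒵 𝒞 : Type u} [MeasurableSpace 𝒜] [MeasurableSpace 𝒵] [MeasurableSpace 𝒞]
  [DiscreteMeasurableSpace 𝒜] [DiscreteMeasurableSpace 𝒵] [DiscreteMeasurableSpace 𝒞]
  [Fintype 𝒜] [Fintype 𝒵] [Fintype 𝒞]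
  {a₁ a₀ : 𝒜} {θ : ℝ}

theorem ModelFacts.exists_nuisanceBound {P : Measure (Obs 𝒜 𝒵 𝒞)} (h : ModelFacts a₁ a₀ P θ)
    [Nonempty 𝒵] [Nonempty 𝒞] :
    ∃ K : ℝ, 1 ≤ K ∧ NuisanceBound a₁ a₀ (trueNuisance P) K := by
  set η := trueNuisance P
  have hs : ∀ {ι : Type u} [Fintype ι] (f : ι → ℝ) i, |f i| ≤ ∑ j, |f j| := fun f i =>
    Finset.single_le_sum (f := fun j => |f j|) (fun _ _ => abs_nonneg _) (Finset.mem_univ i)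
  have h0 : ∀ {ι : Type u} [Fintype ι] (f : ι → ℝ), 0 ≤ ∑ j, |f j| := fun f =>
    Finset.sum_nonneg fun _ _ => abs_nonneg _
  set fE : 𝒜 × 𝒵 × 𝒞 → ℝ := fun q => η.EY q.1 q.2.1 q.2.2
  set fZ : 𝒵 × 𝒜 → ℝ := fun q => η.pZ q.1 q.2
  set fI : 𝒵 × 𝒜 → ℝ := fun q => (η.pZ q.1 q.2)⁻¹
  set fA : 𝒜 → ℝ := fun q => (η.pA q)⁻¹
  set fAC : 𝒜 × 𝒞 → ℝ := fun q => η.pAC q.1 q.2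
  set fC : 𝒞 → ℝ := fun q => η.pC q
  have e1 := h0 fE
  have e2 := h0 fZ
  have e3 := h0 fI
  have e4 := h0 fA
  have e5 := h0 fAC
  have e6 := h0 fC
  refine ⟨1 + (∑ j, |fE j|) + (∑ j, |fZ j|) + (∑ j, |fI j|) + (∑ j, |fA j|) + (∑ j, |fAC j|) +
    ∑ j, |fC j|, by linarith, fun q => ?_, fun b _ z => ?_, h.pZ_pos, fun z a => ?_,
    fun b _ => h.pA_pos b, fun b _ => ?_, fun a c => ?_, fun c => ?_⟩
  · linarith [hs fE q]
  · linarith [hs fZ (z, b)]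
  · linarith [hs fI (z, a), le_abs_self (η.pZ z a)⁻¹]
  · linarith [hs fA b, le_abs_self (η.pA b)⁻¹]
  · linarith [hs fAC (a, c)]
  · linarith [hs fC c]

namespace LocalSeq
variable {ν : Measure (Obs 𝒜 𝒵 𝒞)} {p₀ : Obs 𝒜 𝒵 𝒞 → ℝ} {p : ℕ → Obs 𝒜 𝒵 𝒞 → ℝ}
  {ℓ : ℕ → Obs 𝒜 𝒵 𝒞 → ℝ} {σ : Obs 𝒜 𝒵 𝒞 → ℝ}

theorem rootClose_integral (h : LocalSeq ν p₀ p ℓ σ) {g : Obs 𝒜 𝒵 𝒞 → ℝ} (hg : Measurable g)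
    (hg0 : MemLp g 2 (lawOf ν p₀)) (hgn : ∀ n, MemLp g 2 (lawOf ν (p n))) {B : ℝ}
    (hB : ∀ n, ∫ x, g x ^ 2 ∂(lawOf ν (p n)) ≤ B) :
    RootClose (fun n => ∫ x, g x ∂(lawOf ν (p n))) (∫ x, g x ∂(lawOf ν p₀)) := by
  obtain ⟨C, -, hC⟩ := h.exists_sqrt_mul_integral_score_le hg0
  exact RootClose.of_tendsto (h.tendsto_mean_expansion hg hg0 hgn hB) hC

theorem rootClose_measureReal (h : LocalSeq ν p₀ p ℓ σ) {E : Set (Obs 𝒜 𝒵 𝒞)}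
    (hE : MeasurableSet E) :
    RootClose (fun n => (lawOf ν (p n)).real E) ((lawOf ν p₀).real E) := by
  haveI := h.prob_base
  haveI := h.prob
  simp_rw [← integral_indicator_one hE]
  refine h.rootClose_integral (measurable_one.indicator hE) ((memLp_const 1).indicator hE)
    (fun n => (memLp_const 1).indicator hE) (B := 1) fun n => ?_
  have e : ∀ x : Obs 𝒜 𝒵 𝒞, E.indicator (1 : Obs 𝒜 𝒵 𝒞 → ℝ) x ^ 2 =
      E.indicator (1 : Obs 𝒜 𝒵 𝒞 → ℝ) x := fun x => by
    by_cases hx : x ∈ E <;> simp [hx]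
  simp_rw [e]
  rw [integral_indicator_one hE]
  exact measureReal_le_one

theorem rootClose_setIntegral_out (h : LocalSeq ν p₀ p ℓ σ)
    (hY : MemLp Obs.out 2 (lawOf ν p₀)) (hYn : ∀ n, MemLp Obs.out 2 (lawOf ν (p n))) {B : ℝ}
    (hB : ∀ n, ∫ x : Obs 𝒜 𝒵 𝒞, x.out ^ 2 ∂(lawOf ν (p n)) ≤ B) {E : Set (Obs 𝒜 𝒵 𝒞)}
    (hE : MeasurableSet E) :
    RootClose (fun n => ∫ x in E, x.out ∂(lawOf ν (p n))) (∫ x in E, x.out ∂(lawOf ν p₀)) := by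
  simp_rw [← integral_indicator hE]
  refine h.rootClose_integral (measurable_out.indicator hE) (hY.indicator hE)
    (fun n => (hYn n).indicator hE) (B := B) fun n => ?_
  refine (integral_mono ((hYn n).indicator hE).integrable_sq (hYn n).integrable_sq
    fun x => ?_).trans (hB n)
  by_cases hx : x ∈ E
  · simp [hx]
  · simp only [Set.indicator_of_notMem hx, zero_pow two_ne_zero]
    exact sq_nonneg _

variable [Nonempty 𝒜] [Nonempty 𝒵] [Nonempty 𝒞] {θn : ℕ → ℝ}

/-- The bias of the true nuisance functions at the base law is negligible along local sequences. -/
theorem tendsto_bias (h : LocalSeq ν p₀ p ℓ σ) (h₀ : ModelFacts a₁ a₀ (lawOf ν p₀) θ)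
    (hn : ∀ n, ModelFacts a₁ a₀ (lawOf ν (p n)) (θn n)) (hY : MemLp Obs.out 2 (lawOf ν p₀))
    (hYn : ∀ n, MemLp Obs.out 2 (lawOf ν (p n))) {B : ℝ}
    (hB : ∀ n, ∫ x : Obs 𝒜 𝒵 𝒞, x.out ^ 2 ∂(lawOf ν (p n)) ≤ B) :
    Tendsto (fun n : ℕ => √(n : ℝ) * (∫ x, mFun a₁ a₀ (trueNuisance (lawOf ν p₀)) x
      ∂(lawOf ν (p n)) - θn n)) atTop (𝓝 0) := by
  obtain ⟨K, hK1, hK⟩ := h₀.exists_nuisanceBound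
  have cA : ∀ a, RootClose (fun n => (trueNuisance (lawOf ν (p n))).pA a)
      ((trueNuisance (lawOf ν p₀)).pA a) := fun a => h.rootClose_measureReal (measurableSet_trt a)
  have cC : ∀ c, RootClose (fun n => (trueNuisance (lawOf ν (p n))).pC c)
      ((trueNuisance (lawOf ν p₀)).pC c) := fun c => h.rootClose_measureReal (measurableSet_cov c)
  have cAC : ∀ q : 𝒜 × 𝒞, RootClose (fun n => (trueNuisance (lawOf ν (p n))).pAC q.1 q.2)
      ((trueNuisance (lawOf ν p₀)).pAC q.1 q.2) := fun q =>
    (h.rootClose_measureReal ((measurableSet_trt q.1).inter (measurableSet_cov q.2))).div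
      (cC q.2) (h₀.pC_pos q.2).ne' fun n => ((hn n).pC_pos q.2).ne'
  have cZ : ∀ q : 𝒵 × 𝒜, RootClose (fun n => (trueNuisance (lawOf ν (p n))).pZ q.1 q.2)
      ((trueNuisance (lawOf ν p₀)).pZ q.1 q.2) := fun q =>
    (h.rootClose_measureReal ((measurableSet_med q.1).inter (measurableSet_trt q.2))).div
      (cA q.2) (h₀.pA_pos q.2).ne' fun n => ((hn n).pA_pos q.2).ne'
  have cE : ∀ q : 𝒜 × 𝒵 × 𝒞, RootClose
      (fun n => (trueNuisance (lawOf ν (p n))).EY q.1 q.2.1 q.2.2)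
      ((trueNuisance (lawOf ν p₀)).EY q.1 q.2.1 q.2.2) := fun q =>
    (h.rootClose_setIntegral_out hY hYn hB (measurableSet_cell q)).div
      (h.rootClose_measureReal (measurableSet_cell q)) (h₀.pos q).ne' fun n => ((hn n).pos q).ne'
  have hO : ∀ {ι : Type u} [Fintype ι] {x : ι → ℕ → ℝ} {x₀ : ι → ℝ},
      (∀ i, RootClose (x i) (x₀ i)) →
      (fun n => ∑ i, |x i n - x₀ i|) =O[atTop] fun n : ℕ => (√(n : ℝ))⁻¹ := fun hx =>
    Asymptotics.IsBigO.fun_sum fun i _ => (hx i).abs_left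
  set D : ℕ → ℝ := fun n =>
    (∑ q : 𝒜 × 𝒵 × 𝒞, |(trueNuisance (lawOf ν (p n))).EY q.1 q.2.1 q.2.2 -
      (trueNuisance (lawOf ν p₀)).EY q.1 q.2.1 q.2.2|) +
    (∑ q : 𝒵 × 𝒜, |(trueNuisance (lawOf ν (p n))).pZ q.1 q.2 -
      (trueNuisance (lawOf ν p₀)).pZ q.1 q.2|) +
    (∑ q : 𝒜 × 𝒞, |(trueNuisance (lawOf ν (p n))).pAC q.1 q.2 -
      (trueNuisance (lawOf ν p₀)).pAC q.1 q.2|) +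
    (∑ c, |(trueNuisance (lawOf ν (p n))).pC c - (trueNuisance (lawOf ν p₀)).pC c|) +
    ∑ a, |(trueNuisance (lawOf ν (p n))).pA a - (trueNuisance (lawOf ν p₀)).pA a| with hDdef
  have hD : D =O[atTop] fun n : ℕ => (√(n : ℝ))⁻¹ :=
    ((((hO cE).add (hO cZ)).add (hO cAC)).add (hO cC)).add (hO cA)
  have hbias : ∀ n, |∫ x, mFun a₁ a₀ (trueNuisance (lawOf ν p₀)) x ∂(lawOf ν (p n)) - θn n| ≤
      Fintype.card (𝒜 × 𝒵 × 𝒞) * (2 * K ^ 4 * Fintype.card (𝒜 × 𝒞)) * (9 * (D n * D n)) := by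
    intro n
    -- Here the local law is the truth and the base nuisance functions are the estimate. With all
    -- errors bounded by D n, the products number 1 + 4 + 4 = 9.
    obtain ⟨B', -, rfl, hB'⟩ := (hn n).abs_bias_le hK1
    have hs : ∀ {ι : Type u} [Fintype ι] (f f' : ι → ℝ) i, |f' i - f i| ≤ ∑ j, |f j - f' j| :=
      fun f f' i => by
        rw [abs_sub_comm]
        exact Finset.single_le_sum (f := fun j => |f j - f' j|) (fun _ _ => abs_nonneg _)
          (Finset.mem_univ i)
    have s1 : 0 ≤ ∑ q : 𝒜 × 𝒵 × 𝒞, |(trueNuisance (lawOf ν (p n))).EY q.1 q.2.1 q.2.2 -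
      (trueNuisance (lawOf ν p₀)).EY q.1 q.2.1 q.2.2| := Finset.sum_nonneg fun _ _ => abs_nonneg _
    have s2 : 0 ≤ ∑ q : 𝒵 × 𝒜, |(trueNuisance (lawOf ν (p n))).pZ q.1 q.2 -
      (trueNuisance (lawOf ν p₀)).pZ q.1 q.2| := Finset.sum_nonneg fun _ _ => abs_nonneg _
    have s3 : 0 ≤ ∑ q : 𝒜 × 𝒞, |(trueNuisance (lawOf ν (p n))).pAC q.1 q.2 -
      (trueNuisance (lawOf ν p₀)).pAC q.1 q.2| := Finset.sum_nonneg fun _ _ => abs_nonneg _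
    have s4 : 0 ≤ ∑ c, |(trueNuisance (lawOf ν (p n))).pC c - (trueNuisance (lawOf ν p₀)).pC c| :=
      Finset.sum_nonneg fun _ _ => abs_nonneg _
    have s5 : 0 ≤ ∑ a, |(trueNuisance (lawOf ν (p n))).pA a - (trueNuisance (lawOf ν p₀)).pA a| :=
      Finset.sum_nonneg fun _ _ => abs_nonneg _
    have hZ : ∀ z a, |(trueNuisance (lawOf ν p₀)).pZ z a - (trueNuisance (lawOf ν (p n))).pZ z a| ≤
        D n := fun z a => by
      have := hs (fun q : 𝒵 × 𝒜 => (trueNuisance (lawOf ν (p n))).pZ q.1 q.2)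
        (fun q => (trueNuisance (lawOf ν p₀)).pZ q.1 q.2) (z, a)
      simp only [hDdef]
      linarith
    refine (hB' _ (D n) (D n) (D n) (D n) (fun _ => D n) (fun _ => D n) hK
      ⟨fun q => ?_, hZ, fun a c => ?_, fun c => ?_, fun b _ z => hZ z b, fun b _ => ?_⟩).trans_eq
      (by ring)
    · have := hs (fun q : 𝒜 × 𝒵 × 𝒞 => (trueNuisance (lawOf ν (p n))).EY q.1 q.2.1 q.2.2)
        (fun q => (trueNuisance (lawOf ν p₀)).EY q.1 q.2.1 q.2.2) q
      simp only [hDdef]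
      linarith
    · have := hs (fun q : 𝒜 × 𝒞 => (trueNuisance (lawOf ν (p n))).pAC q.1 q.2)
        (fun q => (trueNuisance (lawOf ν p₀)).pAC q.1 q.2) (a, c)
      simp only [hDdef]
      linarith
    · have := hs (fun c => (trueNuisance (lawOf ν (p n))).pC c)
        (fun c => (trueNuisance (lawOf ν p₀)).pC c) c
      simp only [hDdef]
      linarith
    · have := hs (fun a => (trueNuisance (lawOf ν (p n))).pA a)
        (fun a => (trueNuisance (lawOf ν p₀)).pA a) b
      simp only [hDdef]
      linarith
  have hsq : Tendsto (fun n : ℕ => √(n : ℝ) * (D n * D n)) atTop (𝓝 0) := by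
    have h1 : (fun n : ℕ => √(n : ℝ) * (D n * D n)) =O[atTop]
        fun n : ℕ => √(n : ℝ) * ((√(n : ℝ))⁻¹ * (√(n : ℝ))⁻¹) :=
      (Asymptotics.isBigO_refl _ _).mul (hD.mul hD)
    refine h1.trans_tendsto (tendsto_inv_sqrt_nat.congr fun n => ?_)
    rcases eq_or_ne (√(n : ℝ)) 0 with h0 | h0
    · simp [h0]
    · field_simp
  have hlim := hsq.const_mul (Fintype.card (𝒜 × 𝒵 × 𝒞) * (2 * K ^ 4 * Fintype.card (𝒜 × 𝒞)) * 9)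
  rw [mul_zero] at hlim
  refine squeeze_zero_norm (fun n => ?_) hlim
  rw [norm_mul, Real.norm_eq_abs, Real.norm_eq_abs, abs_of_nonneg (Real.sqrt_nonneg _)]
  have := mul_le_mul_of_nonneg_left (hbias n) (Real.sqrt_nonneg (n : ℝ))
  linarith

theorem exists_integral_phi_sq_le (hn : ∀ n, ModelFacts a₁ a₀ (lawOf ν (p n)) (θn n))
    (hYn : ∀ n, MemLp Obs.out 2 (lawOf ν (p n))) {B : ℝ}
    (hB : ∀ n, ∫ x : Obs 𝒜 𝒵 𝒞, x.out ^ 2 ∂(lawOf ν (p n)) ≤ B) (U W : 𝒜 × 𝒵 × 𝒞 → ℝ) :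
    ∃ B' : ℝ, ∀ n, ∫ x : Obs 𝒜 𝒵 𝒞, (U (cellOf x) * x.out + W (cellOf x)) ^ 2 ∂(lawOf ν (p n)) ≤
      B' := by
  obtain ⟨C, hC⟩ := exists_bound_cellwise U
  obtain ⟨C', hC'⟩ := exists_bound_cellwise W
  refine ⟨2 * C ^ 2 * B + 2 * C' ^ 2, fun n => ?_⟩
  haveI := (hn n).prob
  have i1 := (hYn n).integrable_sq.const_mul (2 * C ^ 2)
  refine (integral_mono (memLp_affine (hYn n) U W).integrable_sq
    (i1.add (integrable_const (2 * C' ^ 2))) fun x => ?_).trans ?_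
  · have h1 : U (cellOf x) ^ 2 ≤ C ^ 2 := sq_le_sq.2 ((hC _).trans (le_abs_self C))
    have h2 : W (cellOf x) ^ 2 ≤ C' ^ 2 := sq_le_sq.2 ((hC' _).trans (le_abs_self C'))
    have h3 := mul_le_mul_of_nonneg_right h1 (sq_nonneg x.out)
    simp only [Pi.add_apply]
    nlinarith [sq_nonneg (U (cellOf x) * x.out - W (cellOf x))]
  · simp only [Pi.add_apply]
    rw [integral_add i1 (integrable_const _), integral_const_mul]
    simp only [integral_const, probReal_univ, one_smul]
    have := mul_le_mul_of_nonneg_left (hB n) (by positivity : 0 ≤ 2 * C ^ 2)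
    linarith

/-- Pathwise differentiability of the average causal effect, with influence function `φ`. -/
theorem tendsto_effect (h : LocalSeq ν p₀ p ℓ σ) (h₀ : ModelFacts a₁ a₀ (lawOf ν p₀) θ)
    (hn : ∀ n, ModelFacts a₁ a₀ (lawOf ν (p n)) (θn n)) (hY : MemLp Obs.out 2 (lawOf ν p₀))
    (hYn : ∀ n, MemLp Obs.out 2 (lawOf ν (p n))) {B : ℝ}
    (hB : ∀ n, ∫ x : Obs 𝒜 𝒵 𝒞, x.out ^ 2 ∂(lawOf ν (p n)) ≤ B) :
    Tendsto (fun n : ℕ => √(n : ℝ) * (θn n - θ) - √(n : ℝ) *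
      ∫ x, phi a₁ a₀ (trueNuisance (lawOf ν p₀)) θ x * ℓ n x ∂(lawOf ν p₀)) atTop (𝓝 0) := by
  set η := trueNuisance (lawOf ν p₀) with hη
  set U : 𝒜 × 𝒵 × 𝒞 → ℝ := fun q => mSlope a₁ a₀ η q.1 q.2.1
  set W : 𝒜 × 𝒵 × 𝒞 → ℝ := fun q => mIntercept a₁ a₀ η q - θ
  have e : phi a₁ a₀ η θ = fun x => U (cellOf x) * x.out + W (cellOf x) := by
    funext x
    rw [phi, mFun_eq]
    simp only [U, W]
    ring
  haveI := h.prob_base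
  haveI := h.prob
  obtain ⟨B', hB'⟩ := exists_integral_phi_sq_le hn hYn hB U W
  have hexp := h.tendsto_mean_expansion (g := phi a₁ a₀ η θ) (e ▸ measurable_affine U W)
    (h₀.memLp_phi hY η) (fun n => e ▸ memLp_affine (hYn n) U W) (B := B') (by rw [e]; exact hB')
  -- The mean of φ under the local law is that of m(·,η₀) minus θ. Its first-order expansion minus
  -- the negligible bias leaves the movement of the effect.
  have := hexp.sub (h.tendsto_bias h₀ hn hY hYn hB)
  rw [sub_zero] at this
  refine this.congr fun n => ?_
  have e1 : ∫ x, phi a₁ a₀ η θ x ∂(lawOf ν (p n)) = ∫ x, mFun a₁ a₀ η x ∂(lawOf ν (p n)) - θ := by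
    simp only [phi]
    rw [integral_sub ((hn n).integrable_mFun _) (integrable_const _)]
    simp
  rw [e1, hη, h₀.integral_phi]
  ring

end LocalSeq

end Finite

end FDTD

namespace FDTD

/-! ### Regularity -/

section Finite
variable {𝒜 𝒵 𝒞 : Type u} [MeasurableSpace 𝒜] [MeasurableSpace 𝒵] [MeasurableSpace 𝒞]
  [DiscreteMeasurableSpace 𝒜] [DiscreteMeasurableSpace 𝒵] [DiscreteMeasurableSpace 𝒞]
  [Fintype 𝒜] [Fintype 𝒵] [Fintype 𝒞]
  {a₁ a₀ : 𝒜} {θ : ℝ}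

/-- The sample enters through both the nuisance values and the argument. As cells are countably
many, joint measurability reduces to measurability for each fixed cell. -/
theorem MeasurableNuisance.measurable_mFun {S : Type*} [MeasurableSpace S]
    {η : S → Nuisance 𝒜 𝒵 𝒞} (hη : MeasurableNuisance η) {X : S → Obs 𝒜 𝒵 𝒞} (hX : Measurable X) :
    Measurable fun s => mFun a₁ a₀ (η s) (X s) := by
  have h1 := hη.EY
  have h2 := hη.pZ
  have h3 := hη.pAC
  have h4 := hη.pA
  have h5 := hη.pC
  have hslope : ∀ q : 𝒜 × 𝒵 × 𝒞, Measurable fun s => mSlope a₁ a₀ (η s) q.1 q.2.1 := fun q => by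
    simp only [mSlope]
    fun_prop
  have hint : ∀ q : 𝒜 × 𝒵 × 𝒞, Measurable fun s => mIntercept a₁ a₀ (η s) q := fun q => by
    have := hslope q
    simp only [mIntercept, mTreat, mReg, tsum_fintype]
    fun_prop
  have hpair : Measurable fun s => (cellOf (X s), s) :=
    (measurable_cellOf.comp hX).prodMk measurable_id
  have m1 : Measurable fun q : (𝒜 × 𝒵 × 𝒞) × S => mSlope a₁ a₀ (η q.2) q.1.1 q.1.2.1 :=
    measurable_from_prod_countable_right hslope
  have m2 : Measurable fun q : (𝒜 × 𝒵 × 𝒞) × S => mIntercept a₁ a₀ (η q.2) q.1 :=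
    measurable_from_prod_countable_right hint
  simp_rw [mFun_eq]
  exact ((m1.comp hpair).mul (measurable_out.comp hX)).add (m2.comp hpair)

theorem measurable_thetaHat {n r : ℕ} {η : Sample 𝒜 𝒵 𝒞 n r → Nuisance 𝒜 𝒵 𝒞}
    (hη : MeasurableNuisance η) :
    Measurable fun s : Sample 𝒜 𝒵 𝒞 n r => 1 / (n : ℝ) * ∑ i, mFun a₁ a₀ (η s) (s.1 i) :=
  (Finset.measurable_fun_sum _ fun i _ =>
    hη.measurable_mFun ((measurable_pi_apply i).comp measurable_fst)).const_mul _

variable [Nonempty 𝒜] [Nonempty 𝒵] [Nonempty 𝒞] {r : ℕ → ℕ}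
  {θhat : ∀ n, Sample 𝒜 𝒵 𝒞 n (r n) → ℝ}

/-- The limiting distribution of the estimator along local sequences. -/
theorem LocalSeq.tendsto_estimator {ν : Measure (Obs 𝒜 𝒵 𝒞)} {p₀ : Obs 𝒜 𝒵 𝒞 → ℝ}
    {p : ℕ → Obs 𝒜 𝒵 𝒞 → ℝ} {ℓ : ℕ → Obs 𝒜 𝒵 𝒞 → ℝ} {σ : Obs 𝒜 𝒵 𝒞 → ℝ} {θn : ℕ → ℝ}
    (h : LocalSeq ν p₀ p ℓ σ) (h₀ : ModelFacts a₁ a₀ (lawOf ν p₀) θ)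
    (hn : ∀ n, ModelFacts a₁ a₀ (lawOf ν (p n)) (θn n)) (hY : MemLp Obs.out 2 (lawOf ν p₀))
    (hYn : ∀ n, MemLp Obs.out 2 (lawOf ν (p n))) {B : ℝ}
    (hB : ∀ n, ∫ x : Obs 𝒜 𝒵 𝒞, x.out ^ 2 ∂(lawOf ν (p n)) ≤ B)
    (hr : (fun n => (r n : ℝ)) =O[atTop] (fun n => (n : ℝ)))
    (hθm : ∀ n, n ≠ 0 → Measurable (θhat n))
    (hlin : TendsZero (fun n => sampleLaw (lawOf ν p₀) n (r n)) fun n s =>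
      √(n : ℝ) * (θhat n s - θ) -
        (1 / √(n : ℝ)) * ∑ i, phi a₁ a₀ (trueNuisance (lawOf ν p₀)) θ (s.1 i))
    (f : ℝ →ᵇ ℝ) :
    Tendsto (fun n : ℕ => ∫ s, f (√(n : ℝ) * (θhat n s - θn n))
      ∂(sampleLaw (lawOf ν (p n)) n (r n))) atTop
      (𝓝 (∫ y, f y ∂(gaussianReal 0 (∫ x, phi a₁ a₀ (trueNuisance (lawOf ν p₀)) θ x ^ 2
        ∂(lawOf ν p₀)).toNNReal))) := by
  haveI := h.prob_base
  haveI := h.prob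
  set φ := phi a₁ a₀ (trueNuisance (lawOf ν p₀)) θ with hφ
  have hφ2 : MemLp φ 2 (lawOf ν p₀) := h₀.memLp_phi hY _
  have hφm : Measurable φ := by
    have e : φ = fun x => (fun q : 𝒜 × 𝒵 × 𝒞 =>
        mSlope a₁ a₀ (trueNuisance (lawOf ν p₀)) q.1 q.2.1) (cellOf x) * x.out +
        (fun q => mIntercept a₁ a₀ (trueNuisance (lawOf ν p₀)) q - θ) (cellOf x) := by
      funext x
      rw [hφ, phi, mFun_eq]
      ring
    rw [e]
    exact measurable_affine (fun q : 𝒜 × 𝒵 × 𝒞 =>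
      mSlope a₁ a₀ (trueNuisance (lawOf ν p₀)) q.1 q.2.1)
      (fun q => mIntercept a₁ a₀ (trueNuisance (lawOf ν p₀)) q - θ)
  have hV : 0 ≤ ∫ x, φ x ^ 2 ∂(lawOf ν p₀) := integral_nonneg fun x => sq_nonneg _
  have hchar := h.tendsto_charFun_pow hφm hφ2 h₀.integral_phi
    (h.tendsto_effect h₀ hn hY hYn hB)
  have hcont := h.tendsZero hr hlin
  -- The estimating equation says nothing at n = 0, where the estimator may even fail to be
  -- measurable; shifting the index discards that term.
  refine (tendsto_add_atTop_iff_nat 1).1 ?_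
  refine tendsto_integral_of_charFun
    (Q := fun n => sampleLaw (lawOf ν (p (n + 1))) (n + 1) (r (n + 1)))
    (T := fun n s => √((n + 1 : ℕ) : ℝ) * (θhat (n + 1) s - θn (n + 1)))
    (W := fun n s => 1 / √((n + 1 : ℕ) : ℝ) * ∑ i, φ (s.1 i) -
      √((n + 1 : ℕ) : ℝ) * (θn (n + 1) - θ)) (fun n => ?_) (fun n => ?_) ?_ (fun u => ?_) f
  · exact ((hθm (n + 1) n.succ_ne_zero).sub_const _).const_mul _
  · exact ((Finset.measurable_fun_sum _ fun i _ =>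
      hφm.comp ((measurable_pi_apply i).comp measurable_fst)).const_mul _).sub_const _
  · intro ε hε
    refine ((tendsto_add_atTop_iff_nat 1).2 (hcont ε hε)).congr fun n => ?_
    congr 1
    ext s
    simp only [Set.mem_ofPred_eq]
    -- The movement of the effect cancels in T - W, which is exactly the linearization error at the
    -- base law.
    rw [show ∀ a b c : ℝ, √((n + 1 : ℕ) : ℝ) * (a - b) - (c - √((n + 1 : ℕ) : ℝ) * (b - θ)) =
      √((n + 1 : ℕ) : ℝ) * (a - θ) - c from fun a b c => by ring]
  · simp_rw [integral_exp_sum_sampleLaw]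
    refine ((tendsto_add_atTop_iff_nat 1).2 (hchar u)).trans_eq ?_
    rw [charFun_gaussianReal]
    congr 2
    rw [Real.coe_toNNReal _ hV]
    push_cast
    ring

end Finite

/-! ### From parametric submodels to local sequences, and regularity -/

section Submodel
variable {𝒜 𝒵 𝒞 : Type u} [MeasurableSpace 𝒜] [MeasurableSpace 𝒵] [MeasurableSpace 𝒞]
  {a₁ a₀ : 𝒜} {P : Measure (Obs 𝒜 𝒵 𝒞)}

theorem memLp_out_of_lintegral {Q : Measure (Obs 𝒜 𝒵 𝒞)} {B : ℝ}
    (h : ∫⁻ x : Obs 𝒜 𝒵 𝒞, ENNReal.ofReal (x.out ^ 2) ∂Q ≤ ENNReal.ofReal B) :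
    MemLp Obs.out 2 Q ∧ ∫ x : Obs 𝒜 𝒵 𝒞, x.out ^ 2 ∂Q ≤ |B| := by
  have hm : Measurable fun x : Obs 𝒜 𝒵 𝒞 => x.out ^ 2 := measurable_out.pow_const 2
  refine ⟨(memLp_two_iff_integrable_sq measurable_out.aestronglyMeasurable).2
    ⟨hm.aestronglyMeasurable, ?_⟩, ?_⟩
  · rw [hasFiniteIntegral_iff_ofReal (Eventually.of_forall fun x => sq_nonneg _)]
    exact h.trans_lt ENNReal.ofReal_lt_top
  · rw [integral_eq_lintegral_of_nonneg_ae (Eventually.of_forall fun x => sq_nonneg _)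
      hm.aestronglyMeasurable]
    refine ENNReal.toReal_le_of_le_ofReal (abs_nonneg B) (h.trans ?_)
    exact ENNReal.ofReal_le_ofReal (le_abs_self B)

/-- Local sequences of parameters give local sequences of densities. -/
theorem RegularSubmodel.localSeq {k : ℕ} (M : RegularSubmodel a₁ a₀ P k) [IsProbabilityMeasure P]
    {t : ℕ → EuclideanSpace ℝ (Fin k)} {B : ℝ} (ht : ∀ n : ℕ, √(n : ℝ) * ‖t n‖ ≤ B)
    (ht0 : Tendsto t atTop (𝓝 0))
    (hlaw₀ : lawOf M.dom (M.density 0) = P)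
    (hprob : ∀ n, IsProbabilityMeasure (lawOf M.dom (M.density (t n)))) :
    LocalSeq M.dom (M.density 0) (fun n => M.density (t n))
      (fun n x => inner ℝ (t n) (M.score x)) (fun x => B * ‖M.score x‖) := by
  have hB : 0 ≤ B := by simpa using ht 0
  have hsc : ∀ s, Measurable fun x => (inner ℝ s (M.score x) : ℝ) := fun s =>
    measurable_const.inner M.measurable_score
  refine ⟨M.measurable_density 0, fun n => M.measurable_density _, M.density_nonneg 0,
    fun n => M.density_nonneg _, by rw [hlaw₀]; infer_instance, hprob, fun n => hsc _,
    M.measurable_score.norm.const_mul B, ?_, fun x => by positivity, fun n x => ?_, fun n => ?_, ?_⟩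
  · rw [hlaw₀]
    exact M.memLp_score.norm.const_mul B
  · calc √(n : ℝ) * |inner ℝ (t n) (M.score x)| ≤ √(n : ℝ) * (‖t n‖ * ‖M.score x‖) := by
          gcongr
          exact abs_real_inner_le_norm _ _
      _ = √(n : ℝ) * ‖t n‖ * ‖M.score x‖ := by ring
      _ ≤ B * ‖M.score x‖ := by
          gcongr
          exact ht n
  · rw [hlaw₀]
    refine M.memLp_score.of_le_mul (c := ‖t n‖) (hsc _).aestronglyMeasurable
      (Eventually.of_forall fun x => ?_)
    rw [Real.norm_eq_abs]
    exact abs_real_inner_le_norm _ _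
  · have h1 := M.quadratic_mean_differentiable.comp_tendsto ht0
    have h2 : (fun n : ℕ => (n : ℝ) * ‖t n‖ ^ 2) =O[atTop] fun _ : ℕ => (1 : ℝ) := by
      refine Asymptotics.IsBigO.of_bound (B ^ 2) (Eventually.of_forall fun n => ?_)
      rw [norm_one, mul_one, Real.norm_of_nonneg (by positivity)]
      have := pow_le_pow_left₀ (by positivity) (ht n) 2
      rwa [mul_pow, Real.sq_sqrt (Nat.cast_nonneg n)] at this
    have h3 := ((Asymptotics.isBigO_refl (fun n : ℕ => (n : ℝ)) atTop).mul_isLittleO h1).trans_isBigO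
      h2
    exact (Asymptotics.isLittleO_one_iff ℝ).1 h3

end Submodel

section Regular
variable {𝒜 𝒵 𝒞 : Type u} [MeasurableSpace 𝒜] [MeasurableSpace 𝒵] [MeasurableSpace 𝒞]
  [DiscreteMeasurableSpace 𝒜] [DiscreteMeasurableSpace 𝒵] [DiscreteMeasurableSpace 𝒞]
  [Fintype 𝒜] [Fintype 𝒵] [Fintype 𝒞] [Nonempty 𝒜] [Nonempty 𝒵] [Nonempty 𝒞]
  {a₁ a₀ : 𝒜} {θ : ℝ} {P : Measure (Obs 𝒜 𝒵 𝒞)} {r : ℕ → ℕ}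
  {θhat : ∀ n, Sample 𝒜 𝒵 𝒞 n (r n) → ℝ}

/-- The limit law N(0, E φ²) depends on P alone, which is the content of regularity. -/
theorem ModelFacts.isRegularEstimator (h₀ : ModelFacts a₁ a₀ P θ) (hY : MemLp Obs.out 2 P)
    (hr : (fun n => (r n : ℝ)) =O[atTop] (fun n => (n : ℝ)))
    (hθm : ∀ n, n ≠ 0 → Measurable (θhat n))
    (hlin : TendsZero (fun n => sampleLaw P n (r n)) fun n s => √(n : ℝ) * (θhat n s - θ) -
        (1 / √(n : ℝ)) * ∑ i, phi a₁ a₀ (trueNuisance P) θ (s.1 i)) :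
    IsRegularEstimator a₁ a₀ P r θhat := by
  haveI := h₀.prob
  refine ⟨gaussianReal 0 (∫ x, phi a₁ a₀ (trueNuisance P) θ x ^ 2 ∂P).toNNReal, inferInstance, ?_⟩
  rintro k M t ⟨B, hB⟩ f
  have hB0 : 0 ≤ B := by simpa using hB 0
  obtain ⟨D, hD⟩ := M.bounded_moment
  have hgood := (M.mem_model.and M.law_eq).and hD
  classical
  set good : EuclideanSpace ℝ (Fin k) → Prop := fun s =>
    (IsModelLaw a₁ a₀ (M.law s) (M.ace s) ∧
      M.law s = M.dom.withDensity fun x => ENNReal.ofReal (M.density s x)) ∧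
      ∫⁻ x : Obs 𝒜 𝒵 𝒞, ENNReal.ofReal (x.out ^ 2) ∂(M.law s) ≤ ENNReal.ofReal D with hgooddef
  have hgood0 : good 0 := hgood.self_of_nhds
  -- Membership in the model, domination and the moment bound hold only near 0. Replacing bad
  -- parameters by 0 makes them hold for every n, and alters only finitely many indices.
  set t' : ℕ → EuclideanSpace ℝ (Fin k) := fun n => if good (t n) then t n else 0 with ht'
  have hgood' : ∀ n, good (t' n) := fun n => by
    simp only [ht']
    split_ifs with h
    exacts [h, hgood0]
  have hnorm : ∀ n, ‖t' n‖ ≤ ‖t n‖ := fun n => by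
    simp only [ht']
    split_ifs with h
    · exact le_rfl
    · simp
  have hB' : ∀ n : ℕ, √(n : ℝ) * ‖t' n‖ ≤ B := fun n =>
    (mul_le_mul_of_nonneg_left (hnorm n) (Real.sqrt_nonneg _)).trans (hB n)
  have ht0 : Tendsto t atTop (𝓝 0) := by
    refine squeeze_zero_norm' ?_ (tendsto_div_sqrt_nat B)
    filter_upwards [eventually_gt_atTop 0] with n hn
    rw [le_div_iff₀' (Real.sqrt_pos.2 (by exact_mod_cast hn))]
    exact hB n
  have ht0' : Tendsto t' atTop (𝓝 0) :=
    squeeze_zero_norm hnorm (by simpa using ht0.norm)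
  have hlaw : ∀ n, M.law (t' n) = lawOf M.dom (M.density (t' n)) := fun n => (hgood' n).1.2
  have hlaw₀ : lawOf M.dom (M.density 0) = P := hgood0.1.2.symm.trans M.law_zero
  have hn : ∀ n, ModelFacts a₁ a₀ (lawOf M.dom (M.density (t' n))) (M.ace (t' n)) := fun n =>
    hlaw n ▸ (hgood' n).1.1.modelFacts
  have hmom : ∀ n, MemLp Obs.out 2 (lawOf M.dom (M.density (t' n))) ∧
      ∫ x : Obs 𝒜 𝒵 𝒞, x.out ^ 2 ∂(lawOf M.dom (M.density (t' n))) ≤ |D| := fun n =>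
    hlaw n ▸ memLp_out_of_lintegral (hgood' n).2
  have hseq := M.localSeq hB' ht0' hlaw₀ fun n => (hn n).prob
  have := hseq.tendsto_estimator (θ := θ) (θn := fun n => M.ace (t' n)) (r := r) (θhat := θhat)
    (hlaw₀.symm ▸ h₀) hn (hlaw₀.symm ▸ hY) (fun n => (hmom n).1) (fun n => (hmom n).2) hr hθm
    (by rw [hlaw₀]; exact hlin) f
  rw [hlaw₀] at this
  refine this.congr' ?_
  filter_upwards [ht0.eventually hgood] with n hgn
  have : t' n = t n := if_pos hgn
  rw [← hlaw n, this]

end Regular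

end FDTD

/-! ### The main theorem -/

theorem mainTheorem8 {Ω 𝒜 𝒵 𝒞 : Type u}
    [MeasurableSpace Ω]
    [MeasurableSpace 𝒜] [DiscreteMeasurableSpace 𝒜] [Countable 𝒜]
    [MeasurableSpace 𝒵] [DiscreteMeasurableSpace 𝒵] [Countable 𝒵]
    [MeasurableSpace 𝒞] [DiscreteMeasurableSpace 𝒞] [Countable 𝒞]
    (μ : Measure Ω) [IsProbabilityMeasure μ]
    (V : FDTD.CausalVars Ω 𝒜 𝒵 𝒞) (a₁ a₀ : 𝒜)
    (hmodel : FDTD.IsFDTDModel V μ a₁ a₀)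
    (P : Measure (FDTD.Obs 𝒜 𝒵 𝒞)) (hP : P = μ.map V.obs)
    (r : ℕ → ℕ)
    (ηhat : ∀ n, FDTD.Sample 𝒜 𝒵 𝒞 n (r n) → FDTD.Nuisance 𝒜 𝒵 𝒞)
    (hηhat : ∀ n, FDTD.MeasurableNuisance (ηhat n))
    (θhat : ∀ n, FDTD.Sample 𝒜 𝒵 𝒞 n (r n) → ℝ)
    (hθhat : ∀ n (s : FDTD.Sample 𝒜 𝒵 𝒞 n (r n)),
      (1 / (n : ℝ)) * ∑ i, FDTD.phi a₁ a₀ (ηhat n s) (θhat n s) (s.1 i) = 0) :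
    -- consistency
    (∀ (k : ℕ) (N : (Fin k → ℝ) → FDTD.Nuisance 𝒜 𝒵 𝒞)
        (βhat : ∀ n, FDTD.Sample 𝒜 𝒵 𝒞 n (r n) → Fin k → ℝ) (b : Fin k → ℝ),
      (∀ n s, ηhat n s = N (βhat n s)) →
      FDTD.IsLittleOP (fun n => FDTD.sampleLaw P n (r n)) (fun n s => ‖βhat n s - b‖ₑ) →
      FDTD.RegularityConsistency a₁ a₀ P N b →
      (((N b).EY = (FDTD.trueNuisance P).EY ∧ (N b).pAC = (FDTD.trueNuisance P).pAC ∧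
          (N b).pC = (FDTD.trueNuisance P).pC ∧
          ∀ a ∈ ({a₁, a₀} : Set 𝒜), (N b).pA a = ∑' c, (N b).pAC a c * (N b).pC c) ∨
        (N b).pZ = (FDTD.trueNuisance P).pZ) →
      FDTD.IsLittleOP (fun n => FDTD.sampleLaw P n (r n))
        (fun n s => ‖θhat n s - FDTD.ACE V μ a₁ a₀‖ₑ)) ∧
    -- asymptotic linearity and regularity
    (Integrable (fun x : FDTD.Obs 𝒜 𝒵 𝒞 => x.out ^ 2) P →
      (fun n => (r n : ℝ)) =O[atTop] (fun n => (n : ℝ)) →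
      FDTD.RegularityNormality a₁ a₀ P r ηhat →
      FDTD.Boundedness a₁ a₀ P r ηhat →
      FDTD.ProductRates a₁ a₀ P r ηhat →
      FDTD.IsAsymptoticallyLinear P r θhat (FDTD.ACE V μ a₁ a₀)
          (FDTD.phi a₁ a₀ (FDTD.trueNuisance P) (FDTD.ACE V μ a₁ a₀)) ∧
        FDTD.IsRegularEstimator a₁ a₀ P r θhat) := by
  subst hP
  have facts := hmodel.modelFacts
  haveI := facts.prob
  obtain ⟨ω⟩ := nonempty_of_isProbabilityMeasure μ
  haveI : Nonempty 𝒜 := ⟨V.A ω⟩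
  haveI : Nonempty 𝒵 := ⟨V.Z ω⟩
  haveI : Nonempty 𝒞 := ⟨V.C ω⟩
  have hθ : ∀ n (s : FDTD.Sample 𝒜 𝒵 𝒞 n (r n)), n ≠ 0 →
      θhat n s = 1 / (n : ℝ) * ∑ i, FDTD.mFun a₁ a₀ (ηhat n s) (s.1 i) := fun n s hn =>
    FDTD.thetaHat_eq hn (hθhat n s)
  refine ⟨fun k N βhat b hN hβ hreg hcase => ?_, fun hY2 hr hreg hb hp => ?_⟩
  · refine FDTD.isLittleOP_of_regularityConsistency (fun n s hn => ?_) hβ hreg ?_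
    · rw [← hN]
      exact hθ n s hn
    · rcases hcase with ⟨hE, hAC, hC, hA⟩ | hZ
      · exact facts.integral_mFun_of_outcome hreg.series hreg.integrable_m hE hAC hC hA
      · exact facts.integral_mFun_of_mediator hreg.series hreg.integrable_m hZ
  -- Boundedness leaves finitely many values of A, Z and C, so all series below are finite sums.
  · obtain ⟨_, _, _⟩ := facts.finite_types hb
    haveI := Fintype.ofFinite 𝒜
    haveI := Fintype.ofFinite 𝒵
    haveI := Fintype.ofFinite 𝒞
    have hY : MemLp FDTD.Obs.out 2 (μ.map V.obs) :=
      (memLp_two_iff_integrable_sq FDTD.measurable_out.aestronglyMeasurable).2 hY2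
    have hlin := facts.isAsymptoticallyLinear hY hθ hreg.l2_consistent hb hp
    refine ⟨hlin, facts.isRegularEstimator hY hr (fun n hn => ?_)
      (FDTD.isLittleOP_iff_real.1 hlin.linear)⟩
    rw [show θhat n = _ from funext fun s => hθ n s hn]
    exact FDTD.measurable_thetaHat (hηhat n)
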